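/- **Setting.** Let $n,H\ge 1$. A finite-horizon $n$-player general-sum Markov game consists of a finite state set $\mathcal S$ with an initial state $s_1$, finite nonempty action sets $\mathcal A_i$ ($i\in[n]$) with $A_{\max}=\max_i|\mathcal A_i|$, transition probabilities $\mathbb P_h(s'\mid s,\boldsymbol a)$ and rewards $r_{i,h}(s,\boldsymbol a)\in[0,1]$ for $h\in[H]$, $s\in\mathcal S$, $\boldsymbol a\in\prod_i\mathcal A_i$. Write $\Delta_{\mathcal X}$ for the probability simplex over a finite set $\mathcal X$, $[\mathbb P_hV](s,\boldsymbol a)=\sum_{s'}\mathbb P_h(s'\mid s,\boldsymbol a)V(s')$, $[f\pi](s)=\sum_{\boldsymbol a}\prod_j\pi_j(a_j\mid s)f(s,\boldsymbol a)$, and $[f\pi_{-i}](s,a_i)=\sum_{\boldsymbol a_{-i}}\prod_{j\ne i}\pi_j(a_j\mid s)f(s,a_i,\boldsymbol a_{-i})$. A joint policy $\pi$ consists of a probability space of random samples $\omega$, one of which is drawn per episode and shared by all players, and of mixed strategies $\pi_{i,h}(\omega,\tau_h,s_h)\in\Delta_{\mathcal A_i}$ depending on $\omega$, on the history $\tau_h$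 of the states and joint actions of the steps before $h$, and on the current state $s_h$; given $(\omega,\tau_h,s_h)$ the players draw their actions independently. $V_i^\pi(s_1)$ is the expected total reward of player $i$ over the $H$ steps, starting at $s_1$. A strategy modification $\phi_i$ of player $i$ is a family of maps $\phi_{i,h}(\tau_h,s_h,\cdot):\Delta_{\mathcal A_i}\to\Delta_{\mathcal A_i}$, each of them linear; $(\phi_i\diamond\pi_i)\odot\pi_{-i}$ is the joint policy in which player $i$ plays $\phi_{i,h}(\tau_h,s_h,\pi_{i,h}(\omega,\tau_h,s_h))$ and the others play as in $\pi$. Put $$\mathrm{CEGap}(\pi)=\max_{i\in[n]}\max_{\phi_i}\Big(V_i^{(\phi_i\diamond\pi_i)\odot\pi_{-i}}(s_1)-V_i^{\pi}(s_1)\Big);$$ $\pi$ is an $\varepsilon$-approximate correlated equilibrium if $\mathrm{CEGap}(\pi)\le\varepsilon$. **Weights.** $\alpha_t=\frac{H+1}{H+t}$, $\alpha_t^i=\alpha_i\prod_{j=i+1}^t(1-\alpha_j)$ for $1\le i\le t$, $w_t=\alpha_t^t/\alpha_t^1$ for $t\ge1$, and $w_0=w_1$. **BM-OFTRL-LogBar**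 over a finite set $\mathcal A$ with step size $\eta$ outputs $x^0,x^1,\dots\in\Delta_{\mathcal A}$ and receives a utility vector $u^t=w_t\hat u^t\in\mathbb R^{\mathcal A}$ after each output $x^t$. For every $a\in\mathcal A$ let $\hat u_a^t=x^t[a]\,\hat u^t$, let $R(x)=-\sum_r\log x[r]$ (with value $+\infty$ where some $x[r]=0$), let $x_a^0=\arg\min_{x\in\Delta_{\mathcal A}}R(x)$, and for $t\ge1$ $$x_a^t=\arg\max_{x\in\Delta_{\mathcal A}}\Big\{\frac{\eta}{w_t}\Big\langle x,\;w_t\hat u_a^{t-1}+\sum_{\tau=1}^{t-1}w_\tau\hat u_a^\tau\Big\rangle-R(x)\Big\}.$$ The output $x^t$ is the stationary distribution of the row-stochastic matrix whose row $a$ is $x_a^t$, that is, $x^t[b]=\sum_a x^t[a]\,x_a^t[b]$ for all $b$. **Algorithm V.** For each $(i,h,s)$ run an instance of BM-OFTRL-LogBar over $\mathcal A_i$, with initial output $\pi^0_{i,h}(\cdot\mid s)$, and put $V^0_{i,h}(s)=H-h+1$. In round $t=1,2,\dots,T$: forward to the instance of each $(i,h,s)$ the utility $u^{t-1}_{i,h,s}=\frac{w_{t-1}}{H}[(r_{i,h}+\mathbb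 P_hV^{t-1}_{i,h+1})\pi^{t-1}_{-i,h}](s,\cdot)$ and let $\pi^t_{i,h}(\cdot\mid s)$ be its next output; then for $h=H,\dots,1$ put $V^t_{i,h}(s)=(1-\alpha_t)V^{t-1}_{i,h}(s)+\alpha_t[(r_{i,h}+\mathbb P_hV^t_{i,h+1})\pi^t_h](s)$. Here $V^t_{i,H+1}=0$. **Algorithm Q** is the same with $Q^0_{i,h}(s,\boldsymbol a)=H-h+1$, utilities $u^{t-1}_{i,h,s}=\frac{w_{t-1}}{H}[Q^{t-1}_{i,h}\pi^{t-1}_{-i,h}](s,\cdot)$, and the update $Q^t_{i,h}(s,\boldsymbol a)=(1-\alpha_t)Q^{t-1}_{i,h}(s,\boldsymbol a)+\alpha_t\big(r_{i,h}+\mathbb P_h[Q^t_{i,h+1}\pi^t_{h+1}]\big)(s,\boldsymbol a)$ for $h=H,\dots,1$, where $[Q^t_{i,H+1}\pi^t_{H+1}]=0$. **Output.** The output policy $\widehat\pi^T$ draws $j_1\in[T]$ with probabilities $\alpha_T^{j_1}$, then for $h=2,\dots,H$ draws $j_h\in[j_{h-1}]$ with probabilities $\alpha_{j_{h-1}}^{j_h}$;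 the sample $\omega=(j_1,\dots,j_H)$ is shared by all players, and at step $h$ in state $s$ each player $i$ plays $\pi^{j_h}_{i,h}(\cdot\mid s)$. **Theorem.** For every such game and every $T\ge2$, if the step size is $\eta=\frac{1}{128\,n\sqrt H\,A_{\max}}$, then the output policy $\widehat\pi^T$ of Algorithm V and the output policy $\widehat\pi^T$ of Algorithm Q both satisfy $$\mathrm{CEGap}(\widehat\pi^T)\le 8192\,H^{3.5}\,n\,A_{\max}^3\cdot\frac{(\log T)^2}{T}.$$ -/

import Mathlib

noncomputable section

namespace MarkovCE

/-! ### Finite-horizon general-sum Markov games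

Players are `Fin n`; steps are `Fin H`, so the index `h : Fin H` stands for step number `h + 1`.
Player `i` has the finite action set `A i`, and a joint action is an element of `∀ i, A i`. -/

/-- An `n`-player general-sum Markov game with horizon `H`, state space `S`, action sets `A i`. -/
structure MarkovGame (n H : ℕ) (S : Type*) (A : Fin n → Type*) [Fintype S] where
  /-- the state in which every episode starts -/
  init : S
  /-- `trans h s a` is the law of the next state after joint action `a` at `s` in step `h` -/
  trans : Fin H → S → (∀ i, A i) → stdSimplex ℝ S
  /-- `reward i h s a` is the reward of player `i` -/
  reward : Fin n → Fin H → S → (∀ i, A i) → ℝ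
  reward_mem : ∀ i h s a, reward i h s a ∈ Set.Icc (0 : ℝ) 1

/-- The histories at step `h`: the pairs (state, joint action) of all earlier steps. -/
abbrev History {n H : ℕ} (S : Type*) (A : Fin n → Type*) (h : Fin H) : Type _ :=
  Fin h → S × (∀ i, A i)

/-- A joint policy: all players see the same random sample `ω` (drawn once per episode from the
probability measure `law`), and at step `h`, after history `τ` and in state `s`, player `i` plays
the mixed strategy `strategy i h ω τ s`. -/
structure JointPolicy {n : ℕ} (H : ℕ) (S : Type*) (A : Fin n → Type*) [∀ i, Fintype (A i)]
    (Ω : Type*) [MeasurableSpace Ω] where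
  law : MeasureTheory.Measure Ω
  isProbabilityMeasure_law : MeasureTheory.IsProbabilityMeasure law
  strategy : ∀ (i : Fin n) (h : Fin H), Ω → History S A h → S → stdSimplex ℝ (A i)
  measurable_strategy : ∀ i h τ s a, Measurable fun ω => (strategy i h ω τ s : A i → ℝ) a

/-- A strategy modification for player `i`: for every step, history and state, a linear
transformation of the simplex of mixed strategies of player `i`. -/
structure StrategyModification {n : ℕ} (H : ℕ) (S : Type*) (A : Fin n → Type*)
    [∀ i, Fintype (A i)] (i : Fin n) where
  toFun : ∀ h : Fin H, History S A h → S → stdSimplex ℝ (A i) → stdSimplex ℝ (A i)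
  linear : ∀ h τ s, ∃ L : (A i → ℝ) →ₗ[ℝ] (A i → ℝ),
    ∀ x : stdSimplex ℝ (A i), (toFun h τ s x : A i → ℝ) = L x

section Values

variable {n H : ℕ} {S : Type*} {A : Fin n → Type*} [∀ i, Fintype (A i)]
  {Ω : Type*} [MeasurableSpace Ω]

/-- The joint policy in which player `i` plays the modified policy and all other players keep
theirs; the random sample is still shared. -/
def JointPolicy.modify (π : JointPolicy H S A Ω) (i : Fin n)
    (φ : StrategyModification H S A i) : JointPolicy H S A Ω where
  law := π.law
  isProbabilityMeasure_law := π.isProbabilityMeasure_law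
  strategy := Function.update π.strategy i fun h ω τ s => φ.toFun h τ s (π.strategy i h ω τ s)
  measurable_strategy := by
    intro j h τ s a
    by_cases hj : j = i
    · subst hj
      obtain ⟨L, hL⟩ := φ.linear h τ s
      simp only [Function.update_self, hL]
      have hc : Continuous L := L.continuous_of_finiteDimensional
      exact (measurable_pi_apply a).comp
        (hc.measurable.comp (measurable_pi_lambda _ fun b => π.measurable_strategy j h τ s b))
    · simp only [Function.update_of_ne hj]
      exact π.measurable_strategy j h τ s a

/-- The part of a trajectory (states and joint actions of all `H` steps) before step `h`. -/
def historyAt (traj : Fin H → S × (∀ i, A i)) (h : Fin H) : History S A h :=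
  fun k => traj (Fin.castLE h.isLt.le k)

variable [Fintype S]

open Classical in
/-- Probability that the state at step `h` is the one of the trajectory, given the trajectory
before step `h`. -/
def MarkovGame.stateProb (G : MarkovGame n H S A) (traj : Fin H → S × (∀ i, A i))
    (h : Fin H) : ℝ :=
  if h.val = 0 then (if (traj h).1 = G.init then 1 else 0)
  else
    let p : Fin H := ⟨h.val - 1, lt_of_le_of_lt (Nat.sub_le _ _) h.isLt⟩
    (G.trans p (traj p).1 (traj p).2 : S → ℝ) (traj h).1

/-- Probability of a trajectory when the random sample is `ω`: given `ω`, the history and the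
state, the players draw their actions independently from their mixed strategies. -/
def MarkovGame.trajProb (G : MarkovGame n H S A) (π : JointPolicy H S A Ω) (ω : Ω)
    (traj : Fin H → S × (∀ i, A i)) : ℝ :=
  ∏ h, (G.stateProb traj h *
    ∏ i, (π.strategy i h ω (historyAt traj h) (traj h).1 : A i → ℝ) ((traj h).2 i))

/-- The value of `π` for player `i` at the start of the episode: its expected total reward. -/
def MarkovGame.value (G : MarkovGame n H S A) (π : JointPolicy H S A Ω) (i : Fin n) : ℝ :=
  ∫ ω, ∑ traj : Fin H → S × (∀ i, A i),
    G.trajProb π ω traj * ∑ h, G.reward i h (traj h).1 (traj h).2 ∂π.law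

/-- The correlated-equilibrium gap: the largest gain that a player can get from a strategy
modification. It is taken in the extended reals so that the supremum has its true meaning. -/
def MarkovGame.ceGap (G : MarkovGame n H S A) (π : JointPolicy H S A Ω) : EReal :=
  ⨆ (i : Fin n) (φ : StrategyModification H S A i),
    ((G.value (π.modify i φ) i - G.value π i : ℝ) : EReal)

/-- `π` is an `ε`-approximate correlated equilibrium. -/
def MarkovGame.IsApproxCE (G : MarkovGame n H S A) (π : JointPolicy H S A Ω) (ε : ℝ) : Prop :=
  G.ceGap π ≤ (ε : EReal)

end Values

/-! ### Weights -/

/-- `α_t = (H + 1) / (H + t)`. -/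
def alpha (H t : ℕ) : ℝ := ((H : ℝ) + 1) / ((H : ℝ) + t)

/-- `α_t^i = α_i ∏_{j = i + 1}^t (1 - α_j)` for `1 ≤ i ≤ t` (so `α_t^t = α_t`), and `0` for other
pairs of indices. -/
def alphaW (H t i : ℕ) : ℝ :=
  if 1 ≤ i ∧ i ≤ t then alpha H i * ∏ j ∈ Finset.Ioc i t, (1 - alpha H j) else 0

/-- `w_t = α_t^t / α_t^1` for `t ≥ 1`, and `w_0 = w_1`. -/
def weight (H : ℕ) : ℕ → ℝ
  | 0 => alphaW H 1 1 / alphaW H 1 1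
  | t + 1 => alphaW H (t + 1) (t + 1) / alphaW H (t + 1) 1

theorem alphaW_nonneg (H t i : ℕ) : 0 ≤ alphaW H t i := by
  unfold alphaW
  split_ifs with h
  · refine mul_nonneg (by unfold alpha; positivity) (Finset.prod_nonneg fun j hj => ?_)
    have hj1 : (1 : ℝ) ≤ j := by
      have := (Finset.mem_Ioc.1 hj).1
      exact_mod_cast (by omega : 1 ≤ j)
    unfold alpha
    rw [sub_nonneg, div_le_one (by positivity)]
    linarith
  · exact le_rfl

theorem alphaW_sum (H t T : ℕ) (ht : 1 ≤ t) (hT : t ≤ T) :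
    ∑ j : Fin (T + 1), alphaW H t j = 1 := by
  have key : ∀ t : ℕ, 1 ≤ t → ∑ j ∈ Finset.Icc 1 t, alphaW H t j = 1 := by
    intro t ht
    induction t, ht using Nat.le_induction with
    | base =>
      have : (H : ℝ) + 1 ≠ 0 := by positivity
      simp [alphaW, alpha, this]
    | succ t ht ih =>
      rw [Finset.sum_Icc_succ_top (by omega)]
      have h1 : ∀ j ∈ Finset.Icc 1 t,
          alphaW H (t + 1) j = (1 - alpha H (t + 1)) * alphaW H t j := by
        intro j hj
        obtain ⟨hj1, hj2⟩ := Finset.mem_Icc.1 hj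
        have h2 : j ≤ t + 1 := by omega
        simp only [alphaW, hj1, hj2, h2, and_self, if_true]
        rw [Finset.prod_Ioc_succ_top hj2]
        ring
      rw [Finset.sum_congr rfl h1, ← Finset.mul_sum, ih]
      simp [alphaW]
  rw [Fin.sum_univ_eq_sum_range (fun j => alphaW H t j) (T + 1), ← key t ht]
  symm
  apply Finset.sum_subset
  · intro j hj
    have := Finset.mem_Icc.1 hj
    simp; omega
  · intro j _ hj
    rw [Finset.mem_Icc] at hj
    simp [alphaW, hj]

/-! ### The regret minimizer BM-OFTRL-LogBar -/

section Learner

variable {ι : Type*} [Fintype ι]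

/-- The log barrier `R(x) = -∑_r log x[r]`, for vectors with positive entries. -/
def logBarrier (x : ι → ℝ) : ℝ := -∑ r, Real.log (x r)

/-- The points of the simplex with positive entries. As the log barrier is `+∞` at all other
points of the simplex, maximizing `⟨x, c⟩ - R(x)` over the simplex means maximizing it here. -/
def openSimplex (ι : Type*) [Fintype ι] : Set (ι → ℝ) := {x ∈ stdSimplex ℝ ι | ∀ r, 0 < x r}

theorem exists_logBarrier_argmax [Nonempty ι] (c : ι → ℝ) :
    ∃ x ∈ openSimplex ι, IsMaxOn (fun y : ι → ℝ => y ⬝ᵥ c - logBarrier y) (openSimplex ι) x := by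
  classical
  set f : (ι → ℝ) → ℝ := fun y => y ⬝ᵥ c - logBarrier y with hf
  have hcard : (0 : ℝ) < Fintype.card ι := by exact_mod_cast Fintype.card_pos
  let v : ι → ℝ := fun _ => (Fintype.card ι : ℝ)⁻¹
  have hv : v ∈ openSimplex ι := by
    refine ⟨⟨fun _ => by positivity, ?_⟩, fun _ => by positivity⟩
    simp [v, hcard.ne']
  have hle : ∀ y ∈ openSimplex ι, ∀ r, y r ≤ 1 := fun y hy r => by
    rw [← hy.1.2]
    exact Finset.single_le_sum (fun i _ => hy.1.1 i) (Finset.mem_univ r)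
  let δ : ℝ := Real.exp (f v - ∑ r, |c r|)
  let K : Set (ι → ℝ) := stdSimplex ℝ ι ∩ {y | ∀ r, δ ≤ y r}
  have hK : IsCompact K := by
    refine (isCompact_stdSimplex ℝ ι).inter_right ?_
    simp only [Set.ofPred_forall]
    exact isClosed_iInter fun r => isClosed_le continuous_const (continuous_apply r)
  have hKpos : ∀ y ∈ K, ∀ r, 0 < y r := fun y hy r => (Real.exp_pos _).trans_le (hy.2 r)
  have hlevel : ∀ y ∈ openSimplex ι, f v ≤ f y → y ∈ K := by
    intro y hy hfy
    refine ⟨hy.1, fun r => ?_⟩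
    rw [← Real.exp_log (hy.2 r)]
    apply Real.exp_le_exp.2
    have h1 : y ⬝ᵥ c ≤ ∑ r, |c r| := by
      refine Finset.sum_le_sum fun i _ => ?_
      calc y i * c i ≤ y i * |c i| := mul_le_mul_of_nonneg_left (le_abs_self _) (hy.1.1 i)
        _ ≤ 1 * |c i| := mul_le_mul_of_nonneg_right (hle y hy i) (abs_nonneg _)
        _ = |c i| := one_mul _
    have h2 : ∑ i, Real.log (y i) ≤ Real.log (y r) := by
      rw [← Finset.add_sum_erase _ _ (Finset.mem_univ r)]
      have := Finset.sum_nonpos (s := Finset.univ.erase r) (f := fun i => Real.log (y i))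
        fun i _ => Real.log_nonpos (hy.1.1 i) (hle y hy i)
      linarith
    have h3 : f y = y ⬝ᵥ c + ∑ i, Real.log (y i) := by simp [hf, logBarrier]
    linarith
  have hcont : ContinuousOn f K := by
    simp only [hf, logBarrier, dotProduct]
    refine ContinuousOn.sub (by fun_prop) (ContinuousOn.neg ?_)
    exact continuousOn_finsetSum _ fun i _ =>
      (continuous_apply i).continuousOn.log fun y hy => (hKpos y hy i).ne'
  obtain ⟨x, hxK, hx⟩ := hK.exists_isMaxOn ⟨v, hlevel v hv le_rfl⟩ hcont
  refine ⟨x, ⟨hxK.1, hKpos x hxK⟩, fun y hy => ?_⟩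
  by_cases h : f v ≤ f y
  · exact hx (hlevel y hy h)
  · exact (not_le.1 h).le.trans (hx (hlevel v hv le_rfl))

/-- `argmax_{x ∈ Δ} ⟨x, c⟩ - R(x)` for the log barrier `R` (the maximizer is unique). -/
def logBarArgmax [Nonempty ι] (c : ι → ℝ) : stdSimplex ℝ ι :=
  ⟨(exists_logBarrier_argmax c).choose, (exists_logBarrier_argmax c).choose_spec.1.1⟩

theorem exists_stationary [Nonempty ι] (M : ι → stdSimplex ℝ ι) :
    ∃ x : stdSimplex ℝ ι, ∀ b, ∑ a, x.1 a * (M a).1 b = x.1 b := by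
  classical
  let N : Matrix ι ι ℝ := fun a b => (M a).1 b
  have hdet : (N - 1).det = 0 := by
    refine Matrix.exists_mulVec_eq_zero_iff.1 ⟨fun _ => 1, fun h => ?_, ?_⟩
    · exact one_ne_zero (congrFun h (Classical.arbitrary ι))
    · ext a
      have : ∑ b, N a b = 1 := (M a).2.2
      rw [Matrix.sub_mulVec, Matrix.one_mulVec]
      simp [Matrix.mulVec, dotProduct, this]
  obtain ⟨v, hv0, hv⟩ := Matrix.exists_vecMul_eq_zero_iff.2 hdet
  have hfix : ∀ b, ∑ a, v a * N a b = v b := by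
    intro b
    have := congrFun hv b
    rw [Matrix.vecMul_sub, Matrix.vecMul_one] at this
    simpa [sub_eq_zero, Matrix.vecMul, dotProduct] using this
  have hN : ∀ a b, 0 ≤ N a b := fun a b => (M a).2.1 b
  have hle : ∀ b ∈ Finset.univ, |v b| ≤ ∑ a, |v a| * N a b := by
    intro b _
    calc |v b| = |∑ a, v a * N a b| := by rw [hfix b]
      _ ≤ ∑ a, |v a * N a b| := Finset.abs_sum_le_sum_abs _ _
      _ = ∑ a, |v a| * N a b := by simp [abs_mul, abs_of_nonneg (hN _ _)]
  have hsum : ∑ b, |v b| = ∑ b, ∑ a, |v a| * N a b := by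
    rw [Finset.sum_comm]
    refine Finset.sum_congr rfl fun a _ => ?_
    rw [← Finset.mul_sum, show ∑ b, N a b = 1 from (M a).2.2, mul_one]
  have heq := (Finset.sum_eq_sum_iff_of_le hle).1 hsum
  have hpos : 0 < ∑ b, |v b| := by
    obtain ⟨b, hb⟩ := Function.ne_iff.1 hv0
    exact Finset.sum_pos' (fun _ _ => abs_nonneg _) ⟨b, Finset.mem_univ b, abs_pos.2 hb⟩
  refine ⟨⟨fun b => |v b| / ∑ b, |v b|, fun b => by positivity, ?_⟩, fun b => ?_⟩
  · rw [← Finset.sum_div, div_self hpos.ne']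
  · have := heq b (Finset.mem_univ b)
    change ∑ a, |v a| / (∑ b, |v b|) * N a b = |v b| / ∑ b, |v b|
    rw [this, Finset.sum_div]
    refine Finset.sum_congr rfl fun a _ => ?_
    ring

/-- A stationary distribution of the stochastic matrix with rows `M a`. (It is unique if all
entries of the matrix are positive, as they are whenever it is used below.) -/
def stationary [Nonempty ι] (M : ι → stdSimplex ℝ ι) : stdSimplex ℝ ι :=
  (exists_stationary M).choose

/-- The state of BM-OFTRL-LogBar over the action set `ι` in round `t`: the output `x^t`, and for
every `a`, the utility `∑_{τ = 1}^{t - 1} u_a^τ` accumulated by the external regret minimizer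
attached to `a`. -/
structure Learner (ι : Type*) [Fintype ι] where
  output : stdSimplex ℝ ι
  cumUtil : ι → ι → ℝ

/-- Round `0`: every external regret minimizer plays `x_a^0 = argmin R`. -/
def Learner.initial (ι : Type*) [Fintype ι] [Nonempty ι] : Learner ι where
  output := stationary fun _ => logBarArgmax 0
  cumUtil := 0

/-- The transition from round `t - 1` to round `t`, when the (weighted) utility `u = u^{t - 1}` is
received. Minimizer `a` receives `u_a^{t - 1} = x^{t - 1}[a] • u^{t - 1}`, uses it as prediction
after rescaling it by `w_t / w_{t - 1}`, and plays
`x_a^t = argmax_x (η / w_t) ⟨x, (w_t / w_{t - 1}) u_a^{t - 1} + ∑_{τ = 1}^{t - 1} u_a^τ⟩ - R(x)`.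
The utility of round `0` serves only as a prediction. -/
def Learner.update [Nonempty ι] (w : ℕ → ℝ) (η : ℝ) (t : ℕ) (L : Learner ι) (u : ι → ℝ) :
    Learner ι :=
  let ua : ι → ι → ℝ := fun a => L.output.1 a • u
  let cum : ι → ι → ℝ := fun a => if t = 1 then 0 else L.cumUtil a + ua a
  { output := stationary fun a =>
      logBarArgmax ((η / w t) • ((w t / w (t - 1)) • ua a + cum a))
    cumUtil := cum }

end Learner

/-! ### Policy optimization -/

section Algorithms

variable {n H : ℕ} {S : Type*} {A : Fin n → Type*} [∀ i, Fintype (A i)]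

/-- A profile of Markov policies, one for each player. -/
abbrev MarkovProfile (H : ℕ) (S : Type*) (A : Fin n → Type*) [∀ i, Fintype (A i)] : Type _ :=
  ∀ i, Fin H → S → stdSimplex ℝ (A i)

/-- `⟨f, π_h(· ∣ s)⟩` for the product policy `π`. -/
def expJoint (π : MarkovProfile H S A) (h : Fin H) (s : S) (f : (∀ i, A i) → ℝ) : ℝ :=
  ∑ a : ∀ i, A i, (∏ j, (π j h s).1 (a j)) * f a

open Classical in
/-- `⟨f(a_i, ·), π_{-i,h}(· ∣ s)⟩`: player `i` plays `ai`, the other players follow `π`. -/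
def expOthers (π : MarkovProfile H S A) (i : Fin n) (h : Fin H) (s : S)
    (f : (∀ i, A i) → ℝ) (ai : A i) : ℝ :=
  ∑ a : ∀ i, A i with a i = ai, (∏ j ∈ Finset.univ.erase i, (π j h s).1 (a j)) * f a

variable [Fintype S]

/-- `[r_{i,h} + P_h V](s, a)`. -/
def MarkovGame.backup (G : MarkovGame n H S A) (i : Fin n) (h : Fin H) (V : S → ℝ) (s : S)
    (a : ∀ i, A i) : ℝ :=
  G.reward i h s a + ∑ s', (G.trans h s a).1 s' * V s'

variable [∀ i, Nonempty (A i)]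

/-- The Markov policies that are played by a family of learners. -/
def profileOf (L : ∀ i : Fin n, Fin H → S → Learner (A i)) : MarkovProfile H S A :=
  fun i h s => (L i h s).output

/-- The state of the algorithm with `V` value update after a round. The index `h : Fin (H + 1)` of
`V` includes the terminal step `H + 1`, where the value is `0`. -/
structure VState (n H : ℕ) (S : Type*) (A : Fin n → Type*) [∀ i, Fintype (A i)] where
  learner : ∀ i : Fin n, Fin H → S → Learner (A i)
  V : Fin n → Fin (H + 1) → S → ℝ

/-- One round `t ≥ 1` of the algorithm with `V` value update. -/
def vStep (G : MarkovGame n H S A) (η : ℝ) (t : ℕ) (σ : VState n H S A) : VState n H S A :=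
  let L : ∀ i : Fin n, Fin H → S → Learner (A i) := fun i h s =>
    (σ.learner i h s).update (weight H) η t
      ((weight H (t - 1) / H) •
        expOthers (profileOf σ.learner) i h s (G.backup i h (σ.V i h.succ) s))
  { learner := L
    V := fun i => Fin.reverseInduction (motive := fun _ => S → ℝ) (fun _ => 0)
      fun h next s => (1 - alpha H t) * σ.V i h.castSucc s +
        alpha H t * expJoint (profileOf L) h s (G.backup i h next s) }

/-- The algorithm with `V` value update (state after round `t`). -/
def vRun (G : MarkovGame n H S A) (η : ℝ) : ℕ → VState n H S A
  | 0 => ⟨fun i _ _ => Learner.initial (A i), fun _ h _ => (H : ℝ) - (h : ℕ)⟩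
  | t + 1 => vStep G η (t + 1) (vRun G η t)

/-- The state of the algorithm with `Q` value update after a round. -/
structure QState (n H : ℕ) (S : Type*) (A : Fin n → Type*) [∀ i, Fintype (A i)] where
  learner : ∀ i : Fin n, Fin H → S → Learner (A i)
  Q : Fin n → Fin H → S → (∀ i, A i) → ℝ

/-- The `Q` value update of one round at step `h` for player `i`, when `next` is the new value
`[Q_{i,h+1} π_{h+1}]` of the following step. -/
def qUpdate (G : MarkovGame n H S A) (t : ℕ) (Qold : Fin n → Fin H → S → (∀ i, A i) → ℝ)
    (i : Fin n) (h : Fin H) (next : S → ℝ) (s : S) (a : ∀ i, A i) : ℝ :=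
  (1 - alpha H t) * Qold i h s a + alpha H t * G.backup i h next s a

/-- The new values `[Q_{i,h} π_h](s)` of one round, from the terminal step (where it is `0`)
backwards. -/
def qValue (G : MarkovGame n H S A) (t : ℕ) (Qold : Fin n → Fin H → S → (∀ i, A i) → ℝ)
    (π : MarkovProfile H S A) (i : Fin n) : Fin (H + 1) → S → ℝ :=
  Fin.reverseInduction (motive := fun _ => S → ℝ) (fun _ => 0)
    fun h next s => expJoint π h s (qUpdate G t Qold i h next s)

/-- One round `t ≥ 1` of the algorithm with `Q` value update. -/
def qStep (G : MarkovGame n H S A) (η : ℝ) (t : ℕ) (σ : QState n H S A) : QState n H S A :=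
  let L : ∀ i : Fin n, Fin H → S → Learner (A i) := fun i h s =>
    (σ.learner i h s).update (weight H) η t
      ((weight H (t - 1) / H) • expOthers (profileOf σ.learner) i h s (σ.Q i h s))
  { learner := L
    Q := fun i h => qUpdate G t σ.Q i h (qValue G t σ.Q (profileOf L) i h.succ) }

/-- The algorithm with `Q` value update (state after round `t`). -/
def qRun (G : MarkovGame n H S A) (η : ℝ) : ℕ → QState n H S A
  | 0 => ⟨fun i _ _ => Learner.initial (A i), fun _ h _ _ => (H : ℝ) - (h : ℕ)⟩
  | t + 1 => qStep G η (t + 1) (qRun G η t)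

end Algorithms

/-! ### The output policy -/

/-- Probability of drawing the round indices `j 0, j 1, …` one after the other, where the first
one is drawn with probabilities `α_t^·`, and each further one with probabilities `α_m^·` for the
index `m` drawn before. -/
def drawProb (H T : ℕ) : (k : ℕ) → ℕ → (Fin k → Fin (T + 1)) → ℝ
  | 0, _, _ => 1
  | k + 1, t, j => alphaW H t (j 0) * drawProb H T k (j 0) (Fin.tail j)

theorem drawProb_nonneg (H T k t : ℕ) (j : Fin k → Fin (T + 1)) : 0 ≤ drawProb H T k t j := by
  induction k generalizing t with
  | zero => simp [drawProb]
  | succ k ih => exact mul_nonneg (alphaW_nonneg _ _ _) (ih _ _)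

theorem drawProb_sum (H T k t : ℕ) (ht : 1 ≤ t) (hT : t ≤ T) :
    ∑ j : Fin k → Fin (T + 1), drawProb H T k t j = 1 := by
  induction k generalizing t with
  | zero => simp [drawProb]
  | succ k ih =>
    rw [← (Fin.consEquiv fun _ => Fin (T + 1)).sum_comp, Fintype.sum_prod_type]
    have hc : ∀ (a : Fin (T + 1)) (b : Fin k → Fin (T + 1)),
        Fin.tail ((Fin.consEquiv fun _ => Fin (T + 1)) (a, b)) = b := fun _ _ => rfl
    simp only [drawProb, Fin.consEquiv_apply, Fin.cons_zero, hc, ← Finset.mul_sum]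
    rw [← alphaW_sum H t T ht hT]
    refine Finset.sum_congr rfl fun j _ => ?_
    by_cases hj : 1 ≤ (j : ℕ)
    · rw [ih _ hj (by omega), mul_one]
    · simp [alphaW, hj]

/-- The law of the round indices used by the output policy after `T` rounds. -/
def drawPMF (H T : ℕ) (hT : 1 ≤ T) : PMF (Fin H → Fin (T + 1)) :=
  PMF.ofFintype (fun j => ENNReal.ofReal (drawProb H T H T j)) (by
    rw [← ENNReal.ofReal_sum_of_nonneg fun j _ => drawProb_nonneg H T H T j,
      drawProb_sum H T H T hT le_rfl, ENNReal.ofReal_one])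

/-- The output policy after `T` rounds, if `π t` is the profile of Markov policies of round `t`.
The shared random sample is the tuple of round indices; at step `h` all players play the Markov
policies of the round drawn for step `h`. -/
def outputPolicy {n H : ℕ} {S : Type*} {A : Fin n → Type*} [∀ i, Fintype (A i)]
    (π : ℕ → MarkovProfile H S A) (T : ℕ) (hT : 1 ≤ T) :
    JointPolicy H S A (Fin H → Fin (T + 1)) where
  law := (drawPMF H T hT).toMeasure
  isProbabilityMeasure_law := inferInstance
  strategy := fun i h ω _ s => π (ω h) i h s
  measurable_strategy := fun _ _ _ _ _ => measurable_of_finite _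

/-- `A_max`, the largest number of actions of a player. -/
def maxActions {n : ℕ} (A : Fin n → Type*) [∀ i, Fintype (A i)] : ℕ :=
  Finset.univ.sup fun i => Fintype.card (A i)

/-- The step size `η = 1 / (128 n √H A_max)`. -/
def stepSize {n : ℕ} (H : ℕ) (A : Fin n → Type*) [∀ i, Fintype (A i)] : ℝ :=
  1 / (128 * n * Real.sqrt H * maxActions A)

end MarkovCE

end

namespace MarkovCE

/-! ### Weights -/

/-! Suppose the index drawn before step `h` is `t`, and let `v t h s` be the value that the output
policy then collects from state `s` on. It is the `α_t^k`-average over `k ≤ t` of the expected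
backups of `v k (h+1)` under the profile of round `k`. Algorithm V computes exactly this `v`. In
Algorithm Q the table of round `t` is the backup of the running average of the values `[Q π]`,
because backups are affine (`qRun_Q_eq`), and that average satisfies the same recursion. Both
algorithms are therefore instances of `IsRun`: from round 1 on, each learner receives its true
action values for `v`, divided by `H`.

A strategy modification sees the history but not the drawn index. Conditionally on the previous
index `t`, its gain at one step is thus at most an `α_t^k`-weighted swap regret. If this regret is
at most `c / t`, then `Σ_k α_t^k / k ≤ (1 + 1/H) / t` makes the errors of the `H` steps add up to at
most `3 H c / T` (`MarkovGame.value_modify_sub_le`, proved with a potential along random paths).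

For the regret rate, `α_t^k` is proportional to `w_k`, so ordinary regret with weights `w_k` is what
matters. Stationarity of the output splits swap regret into external regrets of the rows. Optimistic
leader iterates with the log barrier have regret at most a barrier term, plus the squared variation
of the utilities, minus the squared relative movement of the rows (`optPlay_regret_le_variation`). A
stationary distribution moves by a factor controlled by the relative movement of the rows
(`IsStationary.le_exp_mul`), so the negative term dominates the squared `ℓ¹`-movement of the output
(`IsSwapLearner.swapRegret_le`).

The utilities of a player vary by at most `α_t` plus the movement of the other players. Swap regrets
are nonnegative for a suitable comparator, hence summing the bounds over the players bounds the
total movement, and with the given step size all variation is absorbed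
(`swapRegret_le_of_variation`). What remains is the barrier term, of order `log T`, and a summable
drift. When `T` is below `A_max` or equals `2`, the trivial regret bound `H` is enough. -/

theorem alpha_pos (H t : ℕ) (hH : 1 ≤ H) : 0 < alpha H t := by
  have : (1 : ℝ) ≤ H := by exact_mod_cast hH
  unfold alpha; positivity

theorem alpha_le_one (H t : ℕ) (ht : 1 ≤ t) : alpha H t ≤ 1 := by
  have : (1 : ℝ) ≤ t := by exact_mod_cast ht
  unfold alpha
  rw [div_le_one (by positivity)]
  linarith

@[simp] theorem alpha_one (H : ℕ) : alpha H 1 = 1 := by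
  unfold alpha
  push_cast
  exact div_self (by positivity)

theorem one_sub_alpha_succ (H t : ℕ) : 1 - alpha H (t + 1) = t / (H + t + 1) := by
  unfold alpha
  push_cast
  field_simp
  ring

theorem alphaW_self (H t : ℕ) (ht : 1 ≤ t) : alphaW H t t = alpha H t := by
  simp [alphaW, ht]

theorem alphaW_succ (H t i : ℕ) (hi : i ≤ t) :
    alphaW H (t + 1) i = (1 - alpha H (t + 1)) * alphaW H t i := by
  unfold alphaW
  by_cases h : 1 ≤ i
  · have h2 : i ≤ t + 1 := by omega
    simp only [h, hi, h2, and_self, if_true]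
    rw [Finset.prod_Ioc_succ_top hi]
    ring
  · simp [h]

theorem alphaW_zero_right (H t : ℕ) : alphaW H t 0 = 0 := by
  simp [alphaW]

theorem one_le_of_alphaW_ne_zero {H t i : ℕ} (h : alphaW H t i ≠ 0) : 1 ≤ i := by
  by_contra h1
  exact h (by simp [alphaW, h1])

/-- The weights vanish at `0` and above `t`. Rounds are written `k + 1` with `k < t` from here on,
while the output policy draws from `Fin (T + 1)`. -/
theorem sum_fin_alphaW_mul (H t T : ℕ) (hT : t ≤ T) (f : ℕ → ℝ) :
    ∑ j : Fin (T + 1), alphaW H t j * f j = ∑ k ∈ Finset.range t, alphaW H t (k + 1) * f (k + 1) := by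
  rw [Fin.sum_univ_eq_sum_range (fun j => alphaW H t j * f j) (T + 1), Finset.sum_range_succ',
    alphaW_zero_right, zero_mul, add_zero]
  symm
  apply Finset.sum_subset
  · intro j hj
    simp at hj ⊢
    omega
  · intro j _ hj
    simp [alphaW] at hj ⊢
    intro h
    omega

theorem sum_alphaW_succ_mul (H t : ℕ) (f : ℕ → ℝ) :
    ∑ k ∈ Finset.range (t + 1), alphaW H (t + 1) (k + 1) * f (k + 1) =
      (1 - alpha H (t + 1)) * ∑ k ∈ Finset.range t, alphaW H t (k + 1) * f (k + 1) +
        alpha H (t + 1) * f (t + 1) := by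
  rw [Finset.sum_range_succ, alphaW_self _ _ (by omega), Finset.mul_sum]
  congr 1
  refine Finset.sum_congr rfl fun k hk => ?_
  rw [alphaW_succ _ _ _ (by simpa using hk), mul_assoc]

theorem sum_alphaW (H t : ℕ) (ht : 1 ≤ t) :
    ∑ k ∈ Finset.range t, alphaW H t (k + 1) = 1 := by
  have h1 := sum_fin_alphaW_mul H t t le_rfl fun _ => 1
  simp only [mul_one] at h1
  rw [← h1, alphaW_sum H t t ht le_rfl]

/-- The induction step closes with equality; only the base case is slack. The factor `1 + 1/H` is
what lets an error of rate `1/t` pass through `H` steps at bounded cost. -/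
theorem sum_alphaW_div_le (H t : ℕ) (hH : 1 ≤ H) (ht : 1 ≤ t) :
    ∑ k ∈ Finset.range t, alphaW H t (k + 1) * ((1 : ℝ) / ((k + 1 : ℕ) : ℝ)) ≤
      (1 + 1 / (H : ℝ)) * (1 / (t : ℝ)) := by
  have hH' : (1 : ℝ) ≤ H := by exact_mod_cast hH
  induction t, ht using Nat.le_induction with
  | base =>
    simp [alphaW]
  | succ t ht ih =>
    have ht' : (1 : ℝ) ≤ t := by exact_mod_cast ht
    have h0 : 0 ≤ 1 - alpha H (t + 1) := by rw [one_sub_alpha_succ]; positivity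
    rw [sum_alphaW_succ_mul H t fun k => (1 : ℝ) / (k : ℝ)]
    refine (add_le_add_left (mul_le_mul_of_nonneg_left ih h0) _).trans (le_of_eq ?_)
    rw [one_sub_alpha_succ]
    unfold alpha
    push_cast
    field_simp
    ring

theorem weight_succ_succ (H t : ℕ) :
    weight H (t + 2) * (t + 1) = weight H (t + 1) * (H + t + 1) := by
  have hpos : ∀ t : ℕ, 0 < alphaW H (t + 1) 1 := by
    intro t
    induction t with
    | zero => simp [alphaW]
    | succ t ih =>
      rw [alphaW_succ _ _ _ (by omega), one_sub_alpha_succ]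
      push_cast
      positivity
  have h1 := (hpos t).ne'
  simp only [weight]
  rw [alphaW_self _ _ (by omega), alphaW_self _ _ (by omega), alphaW_succ H (t + 1) 1 (by omega),
    one_sub_alpha_succ]
  unfold alpha
  push_cast
  field_simp
  ring

@[simp] theorem weight_one (H : ℕ) : weight H 1 = 1 := by
  simp [weight, alphaW]

@[simp] theorem weight_zero (H : ℕ) : weight H 0 = 1 := by
  simp [weight, alphaW]

theorem weight_pos (H t : ℕ) : 0 < weight H t := by
  rcases t with _ | t
  · simp
  induction t with
  | zero => simp
  | succ t ih =>
    have h := weight_succ_succ H t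
    have h2 : 0 < weight H (t + 1) * (H + t + 1) := by positivity
    rw [← h] at h2
    exact pos_of_mul_pos_left h2 (by positivity)

theorem weight_le_succ (H t : ℕ) : weight H t ≤ weight H (t + 1) := by
  rcases t with _ | t
  · simp
  have h := weight_succ_succ H t
  have h0 := weight_pos H (t + 1)
  have h2 : weight H (t + 1) * (t + 1) ≤ weight H (t + 2) * (t + 1) := by
    rw [h]
    have : (0 : ℝ) ≤ H := by positivity
    gcongr
    linarith
  exact le_of_mul_le_mul_right h2 (by positivity)

/-- For rounds `t ≥ 1` the ratio is `(H + t) / t`, at most `H + 1 ≤ 2H`. It is needed because the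
positive terms of the regret bound carry `w (k + 1)` and the negative ones only `w k`. -/
theorem weight_succ_le (H t : ℕ) (hH : 1 ≤ H) : weight H (t + 1) ≤ 2 * H * weight H t := by
  have hH' : (1 : ℝ) ≤ H := by exact_mod_cast hH
  rcases t with _ | t
  · simp; linarith
  have h := weight_succ_succ H t
  have h0 := weight_pos H (t + 1)
  have h2 : weight H (t + 2) * (t + 1) ≤ 2 * H * weight H (t + 1) * (t + 1) := by
    rw [h]
    have : (0 : ℝ) ≤ t := by positivity
    have : (H : ℝ) + t + 1 ≤ 2 * H * (t + 1) := by nlinarith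
    nlinarith
  exact le_of_mul_le_mul_right h2 (by positivity)

/-- This is the purpose of the weights: multiplied by `α_t^1`, a regret with weights `w` becomes a
regret with the drawing probabilities of the output policy, for every `t` at once. -/
theorem alphaW_eq_mul_weight (H t k : ℕ) (hk : k < t) :
    alphaW H t (k + 1) = alphaW H t 1 * weight H (k + 1) := by
  have hne : alphaW H (k + 1) 1 ≠ 0 := by
    intro h
    have := weight_pos H (k + 1)
    simp [weight, h] at this
  induction t, (show k + 1 ≤ t from hk) using Nat.le_induction with
  | base =>
    simp only [weight]
    field_simp
  | succ t ht ih =>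
    rw [alphaW_succ _ _ _ ht, alphaW_succ _ _ 1 (by omega), ih (by omega)]
    ring

/-- The case distinction is needed because `w_0 = 1` although the empty sum is `0`. -/
theorem sum_weight_mul_alpha (H t : ℕ) :
    (∑ k ∈ Finset.range t, weight H (k + 1)) * (H + 1) = weight H t * (if t = 0 then 0 else H + t) := by
  induction t with
  | zero => simp
  | succ t ih =>
    rw [Finset.sum_range_succ, add_mul, ih]
    rcases t with _ | t
    · simp
    · have h := weight_succ_succ H t
      simp only [Nat.add_eq_zero_iff, one_ne_zero, and_false, if_false]
      push_cast
      linear_combination (-1 : ℝ) * h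

/-- For `t ≥ 1` the left-hand side equals `H / (H + 1)`. It measures how far the change of step size
from `η / w_t` to `η / w_{t+1}` moves the scaled accumulated utility. -/
theorem weight_sum_drift_le (H t : ℕ) :
    (1 / weight H t - 1 / weight H (t + 1)) * ∑ k ∈ Finset.range t, weight H (k + 1) ≤ 1 := by
  rcases t with _ | t
  · simp
  have h := weight_succ_succ H t
  have hs := sum_weight_mul_alpha H (t + 1)
  have h0 := weight_pos H (t + 1)
  have h1 := weight_pos H (t + 2)
  simp only [Nat.add_eq_zero_iff, one_ne_zero, and_false, if_false] at hs
  push_cast at hs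
  set s := ∑ k ∈ Finset.range (t + 1), weight H (k + 1)
  have hs' : s = weight H (t + 1) * (H + (t + 1)) / (H + 1) := by
    rw [eq_div_iff (by positivity), hs]
  have h2 : weight H (t + 2) = weight H (t + 1) * (H + t + 1) / (t + 1) := by
    rw [eq_div_iff (by positivity), h]
  change (1 / weight H (t + 1) - 1 / weight H (t + 2)) * s ≤ 1
  have : (1 / weight H (t + 1) - 1 / weight H (t + 2)) * s = H / (H + 1) := by
    rw [hs', h2]
    field_simp
    ring
  rw [this, div_le_one (by positivity)]
  linarith

/-! ### The log barrier -/

section LogBarrier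

variable {ι : Type*} [Fintype ι]

theorem le_one_of_mem_stdSimplex {x : ι → ℝ} (hx : x ∈ stdSimplex ℝ ι) (r : ι) : x r ≤ 1 := by
  rw [← hx.2]
  exact Finset.single_le_sum (fun i _ => hx.1 i) (Finset.mem_univ r)

theorem logBarrier_nonneg {x : ι → ℝ} (hx : x ∈ stdSimplex ℝ ι) : 0 ≤ logBarrier x := by
  unfold logBarrier
  rw [neg_nonneg]
  exact Finset.sum_nonpos fun r _ => Real.log_nonpos (hx.1 r) (le_one_of_mem_stdSimplex hx r)

/-- The Bregman divergence of the log barrier. -/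
noncomputable def barrierDiv (y x : ι → ℝ) : ℝ := ∑ r, (y r / x r - 1 - Real.log (y r / x r))

/-- The squared norm of `y - x` in the local norm of the log barrier at `x`. -/
noncomputable def relSq (y x : ι → ℝ) : ℝ := ∑ r, (y r / x r - 1) ^ 2

theorem relSq_nonneg (y x : ι → ℝ) : 0 ≤ relSq y x := Finset.sum_nonneg fun _ _ => sq_nonneg _

/-- With `s = √(1 + z)`, the bound `log s ≤ s - 1` leaves `z - log (1 + z) ≥ (s - 1)²`. Since `z² =
(s - 1)² (s + 1)²`, the claim reduces to `(s + 1)² ≤ 5`, which holds for `s ≤ √1.5`. -/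
theorem log_one_add_le_sub_sq_div {z : ℝ} (h1 : -1 < z) (h2 : z ≤ 1 / 2) :
    Real.log (1 + z) ≤ z - z ^ 2 / 5 := by
  have hpos : 0 < 1 + z := by linarith
  set s := Real.sqrt (1 + z) with hs
  have hs0 : 0 < s := Real.sqrt_pos.2 hpos
  have hsq : s ^ 2 = 1 + z := Real.sq_sqrt hpos.le
  have hlog : Real.log (1 + z) = 2 * Real.log s := by
    rw [← hsq, Real.log_pow]
    norm_num
  have h3 : Real.log s ≤ s - 1 := Real.log_le_sub_one_of_pos hs0
  have hs1 : s ≤ 1.2248 := by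
    refine Real.sqrt_le_iff.2 ⟨by norm_num, ?_⟩
    norm_num
    linarith
  have hz : z = s ^ 2 - 1 := by linarith
  have h4 : (s + 1) ^ 2 ≤ 5 := by nlinarith
  have h5 : z ^ 2 = (s - 1) ^ 2 * (s + 1) ^ 2 := by rw [hz]; ring
  have h6 : z ^ 2 / 5 ≤ (s - 1) ^ 2 := by
    rw [h5]
    have := mul_le_mul_of_nonneg_left h4 (sq_nonneg (s - 1))
    linarith
  rw [hlog]
  nlinarith

theorem relSq_le_barrierDiv {x y : ι → ℝ} (hx : ∀ r, 0 < x r) (hy : ∀ r, 0 < y r)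
    (h : ∀ r, |y r / x r - 1| ≤ 1 / 2) : relSq y x / 5 ≤ barrierDiv y x := by
  unfold relSq barrierDiv
  rw [Finset.sum_div]
  refine Finset.sum_le_sum fun r _ => ?_
  have h1 : 0 < y r / x r := div_pos (hy r) (hx r)
  have := log_one_add_le_sub_sq_div (z := y r / x r - 1) (by linarith) (abs_le.1 (h r)).2
  rw [show 1 + (y r / x r - 1) = y r / x r by ring] at this
  linarith

variable [Nonempty ι]

theorem logBarArgmax_pos (c : ι → ℝ) (r : ι) : 0 < (logBarArgmax c).1 r :=
  (exists_logBarrier_argmax c).choose_spec.1.2 r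

theorem logBarArgmax_isMaxOn (c : ι → ℝ) :
    IsMaxOn (fun y : ι → ℝ => y ⬝ᵥ c - logBarrier y) (openSimplex ι) (logBarArgmax c).1 :=
  (exists_logBarrier_argmax c).choose_spec.2

/-- The first-order optimality condition. -/
theorem logBarArgmax_optimality (c d : ι → ℝ) (hd : ∑ r, d r = 0) :
    ∑ r, d r * (c r + 1 / (logBarArgmax c).1 r) = 0 := by
  set x := (logBarArgmax c).1 with hx
  have hpos : ∀ r, 0 < x r := logBarArgmax_pos c
  have hsum : ∑ r, x r = 1 := (logBarArgmax c).2.2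
  let f : ℝ → ℝ := fun s => (x + s • d) ⬝ᵥ c - logBarrier (x + s • d)
  have hmem : ∀ᶠ s in nhds (0 : ℝ), ∀ r, 0 < (x + s • d) r := by
    rw [Filter.eventually_all]
    intro r
    have hc : Continuous fun s : ℝ => (x + s • d) r := by
      simp only [Pi.add_apply, Pi.smul_apply]
      fun_prop
    exact hc.continuousAt.eventually (lt_mem_nhds (by simpa using hpos r))
  have hmax : IsLocalMax f 0 := by
    filter_upwards [hmem] with s hs
    have h1 : x + s • d ∈ openSimplex ι := by
      refine ⟨⟨fun r => (hs r).le, ?_⟩, hs⟩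
      simp [Finset.sum_add_distrib, ← Finset.mul_sum, hd, hsum]
    have := logBarArgmax_isMaxOn c h1
    simpa [f] using this
  have hder : HasDerivAt f (∑ r, d r * (c r + 1 / x r)) 0 := by
    have hf : f = fun s => ∑ r, ((x r + s * d r) * c r + Real.log (x r + s * d r)) := by
      funext s
      simp [f, dotProduct, logBarrier, Finset.sum_add_distrib]
    rw [hf]
    refine HasDerivAt.fun_sum fun r _ => ?_
    have h1 : HasDerivAt (fun s : ℝ => x r + s * d r) (d r) 0 := by
      simpa using ((hasDerivAt_id (0 : ℝ)).mul_const (d r)).const_add (x r)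
    have h2 := (h1.mul_const (c r)).add (h1.log (by simpa using (hpos r).ne'))
    refine h2.congr_deriv ?_
    simp
    ring
  exact hmax.hasDerivAt_eq_zero hder

/-- An equality, since the maximizer is interior: the first-order term vanishes in every direction
inside the simplex, and the linear part does not contribute to the Bregman remainder. -/
theorem dotProduct_sub_logBarrier_eq (c : ι → ℝ) {y : ι → ℝ} (hy : y ∈ openSimplex ι) :
    (logBarArgmax c).1 ⬝ᵥ c - logBarrier (logBarArgmax c).1 =
      (y ⬝ᵥ c - logBarrier y) + barrierDiv y (logBarArgmax c).1 := by
  set x := (logBarArgmax c).1 with hx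
  have hpos : ∀ r, 0 < x r := logBarArgmax_pos c
  have hsum : ∑ r, x r = 1 := (logBarArgmax c).2.2
  have h := logBarArgmax_optimality c (fun r => y r - x r) (by simp [hy.1.2, hsum])
  rw [← hx] at h
  have h2 : (x ⬝ᵥ c - logBarrier x) + ∑ r, (y r - x r) * (c r + 1 / x r) =
      (y ⬝ᵥ c - logBarrier y) + barrierDiv y x := by
    simp only [dotProduct, logBarrier, barrierDiv, sub_neg_eq_add, ← Finset.sum_add_distrib]
    refine Finset.sum_congr rfl fun r _ => ?_
    have := (hpos r).ne'
    rw [Real.log_div (hy.2 r).ne' this]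
    field_simp
    ring
  rw [h, add_zero] at h2
  exact h2

theorem logBarArgmax_mem (c : ι → ℝ) : (logBarArgmax c).1 ∈ openSimplex ι :=
  (exists_logBarrier_argmax c).choose_spec.1

/-- Multiplicative stability of the maximizer. -/
theorem logBarArgmax_stability {c c' : ι → ℝ} {M : ℝ} (hM : M ≤ 1 / 2)
    (h : ∀ r, |c' r - c r| ≤ M) (r : ι) :
    |(logBarArgmax c').1 r / (logBarArgmax c).1 r - 1| ≤ 2 * M := by
  set x := (logBarArgmax c).1 with hx
  set x' := (logBarArgmax c').1 with hx'
  have hpos : ∀ r, 0 < x r := logBarArgmax_pos c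
  have hpos' : ∀ r, 0 < x' r := logBarArgmax_pos c'
  have hsum : ∑ r, x r = 1 := (logBarArgmax c).2.2
  have hsum' : ∑ r, x' r = 1 := (logBarArgmax c').2.2
  have hM0 : 0 ≤ M := (abs_nonneg _).trans (h r)
  let z : ι → ℝ := fun r => x' r / x r - 1
  have hz1 : ∀ r, 0 < 1 + z r := fun r => by
    have := div_pos (hpos' r) (hpos r)
    simpa [z] using this
  have h1 := logBarArgmax_optimality c (fun r => x' r - x r) (by simp [hsum, hsum'])
  have h2 := logBarArgmax_optimality c' (fun r => x' r - x r) (by simp [hsum, hsum'])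
  rw [← hx] at h1
  rw [← hx'] at h2
  -- Difference of the two optimality conditions in the direction `x' - x`, written in the relative
  -- change `z`.
  have h3 : ∑ r, z r ^ 2 / (1 + z r) = ∑ r, z r * x r * (c' r - c r) := by
    have : ∑ r, (z r ^ 2 / (1 + z r) - z r * x r * (c' r - c r)) =
        ∑ r, (x' r - x r) * (c r + 1 / x r) - ∑ r, (x' r - x r) * (c' r + 1 / x' r) := by
      rw [← Finset.sum_sub_distrib]
      refine Finset.sum_congr rfl fun r _ => ?_
      have h5 := (hpos r).ne'
      have h6 := (hpos' r).ne'
      simp only [z, add_sub_cancel]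
      field_simp
      ring
    rw [h1, h2, Finset.sum_sub_distrib] at this
    linarith
  obtain ⟨q, -, hq⟩ := Finset.exists_max_image Finset.univ (fun r => |z r|) ⟨r, Finset.mem_univ r⟩
  have hle : ∑ r, z r * x r * (c' r - c r) ≤ |z q| * M := by
    calc ∑ r, z r * x r * (c' r - c r) ≤ ∑ r, |z q| * M * x r := by
          refine Finset.sum_le_sum fun r _ => ?_
          calc z r * x r * (c' r - c r) ≤ |z r * x r * (c' r - c r)| := le_abs_self _
            _ = |z r| * |c' r - c r| * x r := by
              rw [abs_mul, abs_mul, abs_of_pos (hpos r)]; ring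
            _ ≤ |z q| * M * x r := by
              have := hpos r
              have := hq r (Finset.mem_univ r)
              have := h r
              gcongr
      _ = |z q| * M := by rw [← Finset.mul_sum, hsum, mul_one]
  -- Only the coordinate with the largest relative change is kept on the left; on the right `∑ x =
  -- 1` makes the bound independent of the dimension.
  have hge : |z q| ^ 2 / (1 + |z q|) ≤ ∑ r, z r ^ 2 / (1 + z r) := by
    refine le_trans ?_ (Finset.single_le_sum (f := fun r => z r ^ 2 / (1 + z r))
      (fun r _ => div_nonneg (sq_nonneg _) (hz1 r).le) (Finset.mem_univ q))
    rw [sq_abs]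
    have := hz1 q
    have := le_abs_self (z q)
    gcongr
  have hfin : |z q| ≤ 2 * M := by
    rw [h3] at hge
    have h4 := hge.trans hle
    have h0 := abs_nonneg (z q)
    rw [div_le_iff₀ (by positivity)] at h4
    by_contra hcon
    push Not at hcon
    have h5 : 0 < |z q| := by linarith
    have h6 : |z q| ≤ M * (1 + |z q|) := by
      refine le_of_mul_le_mul_left ?_ h5
      linarith
    nlinarith
  exact (hq r (Finset.mem_univ r)).trans hfin

end LogBarrier

/-! ### Optimistic follow-the-regularized-leader with the log barrier -/

section ExternalRegret

variable {ι : Type*} [Fintype ι]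

/-- The accumulated weighted utility of the rounds `1, …, t`. -/
def cumulUtil (w : ℕ → ℝ) (g : ℕ → ι → ℝ) (t : ℕ) : ι → ℝ :=
  ∑ k ∈ Finset.range t, w (k + 1) • g (k + 1)

variable [Nonempty ι]

/-- The optimistic iterates. -/
noncomputable def optPlay (w : ℕ → ℝ) (η : ℝ) (g : ℕ → ι → ℝ) : ℕ → stdSimplex ℝ ι
  | 0 => logBarArgmax 0
  | k + 1 => logBarArgmax ((η / w (k + 1)) • (w (k + 1) • g k + cumulUtil w g k))

/-- The regularized leader after round `t`. -/
noncomputable def leader (w : ℕ → ℝ) (η : ℝ) (g : ℕ → ι → ℝ) (t : ℕ) : stdSimplex ℝ ι :=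
  logBarArgmax ((η / w t) • cumulUtil w g t)

theorem leader_zero (w : ℕ → ℝ) (η : ℝ) (g : ℕ → ι → ℝ) : leader w η g 0 = optPlay w η g 0 := by
  simp [leader, optPlay, cumulUtil]

theorem optPlay_mem (w : ℕ → ℝ) (η : ℝ) (g : ℕ → ι → ℝ) (t : ℕ) :
    (optPlay w η g t).1 ∈ openSimplex ι := by
  cases t <;> exact logBarArgmax_mem _

theorem leader_mem (w : ℕ → ℝ) (η : ℝ) (g : ℕ → ι → ℝ) (t : ℕ) :
    (leader w η g t).1 ∈ openSimplex ι := logBarArgmax_mem _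

theorem dotProduct_sub_mul_logBarrier_eq {η w : ℝ} (hη : 0 < η) (hw : 0 < w) (c : ι → ℝ)
    {y : ι → ℝ} (hy : y ∈ openSimplex ι) :
    (logBarArgmax ((η / w) • c)).1 ⬝ᵥ c - w / η * logBarrier (logBarArgmax ((η / w) • c)).1 =
      y ⬝ᵥ c - w / η * logBarrier y + w / η * barrierDiv y (logBarArgmax ((η / w) • c)).1 := by
  have h := dotProduct_sub_logBarrier_eq ((η / w) • c) hy
  simp only [dotProduct_smul, smul_eq_mul] at h
  have h1 : w / η * (η / w) = 1 := by field_simp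
  have h2 := congrArg (fun s => w / η * s) h
  simp only [mul_sub, mul_add, ← mul_assoc, h1, one_mul] at h2
  exact h2

/-- Telescoping along leader, optimistic iterate, next leader. Each of the two passages is an exact
Bregman identity, and their utilities differ by the prediction error `g (k + 1) - g k`. The
regularizer coefficient grows from `w t / η` to `w (t + 1) / η`, which is harmless as the barrier is
nonnegative on the simplex. -/
theorem leader_value_le {w : ℕ → ℝ} {η : ℝ} (hη : 0 < η) (hw : ∀ t, 0 < w t)
    (hmono : ∀ t, w t ≤ w (t + 1)) (g : ℕ → ι → ℝ) (t : ℕ) :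
    (leader w η g t).1 ⬝ᵥ cumulUtil w g t - w t / η * logBarrier (leader w η g t).1 ≤
      ∑ k ∈ Finset.range t, (w (k + 1) * ((optPlay w η g (k + 1)).1 ⬝ᵥ g (k + 1)) +
        (w (k + 1) * (((leader w η g (k + 1)).1 - (optPlay w η g (k + 1)).1) ⬝ᵥ
            (g (k + 1) - g k)) -
          w (k + 1) / η * barrierDiv (leader w η g (k + 1)).1 (optPlay w η g (k + 1)).1 -
          w k / η * barrierDiv (optPlay w η g (k + 1)).1 (leader w η g k).1)) := by
  induction t with
  | zero =>
    simp only [cumulUtil, Finset.range_zero, Finset.sum_empty, dotProduct_zero]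
    have := logBarrier_nonneg (leader w η g 0).2
    have := hw 0
    have : 0 ≤ w 0 / η * logBarrier (leader w η g 0).1 := by positivity
    linarith
  | succ t ih =>
    rw [Finset.sum_range_succ]
    have hU : cumulUtil w g (t + 1) = cumulUtil w g t + w (t + 1) • g (t + 1) := by
      simp [cumulUtil, Finset.sum_range_succ]
    have h1 := dotProduct_sub_mul_logBarrier_eq hη (hw (t + 1))
      (w (t + 1) • g t + cumulUtil w g t) (leader_mem w η g (t + 1))
    have h2 := dotProduct_sub_mul_logBarrier_eq hη (hw t) (cumulUtil w g t)
      (optPlay_mem w η g (t + 1))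
    change (optPlay w η g (t + 1)).1 ⬝ᵥ _ - _ * logBarrier (optPlay w η g (t + 1)).1 =
      _ - _ + _ * barrierDiv _ (optPlay w η g (t + 1)).1 at h1
    change (leader w η g t).1 ⬝ᵥ _ - _ * logBarrier (leader w η g t).1 =
      _ - _ + _ * barrierDiv _ (leader w η g t).1 at h2
    rw [hU]
    have h3 : 0 ≤ (w (t + 1) / η - w t / η) * logBarrier (optPlay w η g (t + 1)).1 := by
      refine mul_nonneg ?_ (logBarrier_nonneg (optPlay w η g (t + 1)).2)
      rw [← sub_div]
      exact div_nonneg (sub_nonneg.2 (hmono t)) hη.le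
    simp only [dotProduct_add, sub_dotProduct, dotProduct_sub, dotProduct_smul, smul_eq_mul]
      at h1 h2 ih ⊢
    linarith

/-- The regret against `p`, with the stability terms still expressed by Bregman divergences. -/
theorem optPlay_regret_le {w : ℕ → ℝ} {η : ℝ} (hη : 0 < η) (hw : ∀ t, 0 < w t)
    (hmono : ∀ t, w t ≤ w (t + 1)) (g : ℕ → ι → ℝ) (t : ℕ) {p : ι → ℝ} (hp : p ∈ openSimplex ι) :
    ∑ k ∈ Finset.range t, w (k + 1) * ((p - (optPlay w η g (k + 1)).1) ⬝ᵥ g (k + 1)) ≤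
      w t / η * logBarrier p + ∑ k ∈ Finset.range t,
        (w (k + 1) * (((leader w η g (k + 1)).1 - (optPlay w η g (k + 1)).1) ⬝ᵥ
            (g (k + 1) - g k)) -
          w (k + 1) / η * barrierDiv (leader w η g (k + 1)).1 (optPlay w η g (k + 1)).1 -
          w k / η * barrierDiv (optPlay w η g (k + 1)).1 (leader w η g k).1) := by
  have h1 := leader_value_le hη hw hmono g t
  rw [Finset.sum_add_distrib] at h1
  have h2 := dotProduct_sub_mul_logBarrier_eq hη (hw t) (cumulUtil w g t) hp
  change (leader w η g t).1 ⬝ᵥ _ - _ * logBarrier (leader w η g t).1 =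
      _ - _ + _ * barrierDiv _ (leader w η g t).1 at h2
  have h3 : 0 ≤ w t / η * barrierDiv p (leader w η g t).1 := by
    refine mul_nonneg (div_nonneg (hw t).le hη.le) (Finset.sum_nonneg fun r _ => ?_)
    have := Real.log_le_sub_one_of_pos (div_pos (hp.2 r) ((leader_mem w η g t).2 r))
    linarith
  have h4 : p ⬝ᵥ cumulUtil w g t = ∑ k ∈ Finset.range t, w (k + 1) * (p ⬝ᵥ g (k + 1)) := by
    simp [cumulUtil, dotProduct_sum, dotProduct_smul]
  simp only [sub_dotProduct p, mul_sub, Finset.sum_sub_distrib] at h1 ⊢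
  linarith

/-- The vectors inside the two maximizations differ exactly by `η (g (k + 1) - g k)`: the prediction
is replaced by the utility that occurred. -/
theorem leader_div_optPlay_sub_one_le {w : ℕ → ℝ} {η : ℝ} (hη : 0 < η) (hη' : η ≤ 1 / 4)
    (hw : ∀ t, 0 < w t) {g : ℕ → ι → ℝ} (hg : ∀ t r, g t r ∈ Set.Icc (0 : ℝ) 1) (k : ℕ) (r : ι) :
    |(leader w η g (k + 1)).1 r / (optPlay w η g (k + 1)).1 r - 1| ≤ 2 * η := by
  refine logBarArgmax_stability (by linarith) (fun r => ?_) r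
  have hw1 := (hw (k + 1)).ne'
  have h : ((η / w (k + 1)) • cumulUtil w g (k + 1)) r -
      ((η / w (k + 1)) • (w (k + 1) • g k + cumulUtil w g k)) r = η * (g (k + 1) r - g k r) := by
    simp only [cumulUtil, Finset.sum_range_succ, Pi.smul_apply, Pi.add_apply, smul_eq_mul]
    field_simp
    ring
  rw [h, abs_mul, abs_of_pos hη]
  have h1 := hg (k + 1) r
  have h2 := hg k r
  have : |g (k + 1) r - g k r| ≤ 1 := abs_le.2 ⟨by linarith [h1.1, h2.2], by linarith [h1.2, h2.1]⟩
  nlinarith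

/-- The vectors inside the two maximizations differ by `η` times the prediction minus the drift
caused by the change of step size. Both lie in `[0, 1]`, so their difference is at most `1` in
absolute value. -/
theorem optPlay_div_leader_sub_one_le {w : ℕ → ℝ} {η : ℝ} (hη : 0 < η) (hη' : η ≤ 1 / 4)
    (hw : ∀ t, 0 < w t) (hmono : ∀ t, w t ≤ w (t + 1))
    (hdrift : ∀ t, (1 / w t - 1 / w (t + 1)) * ∑ k ∈ Finset.range t, w (k + 1) ≤ 1)
    {g : ℕ → ι → ℝ} (hg : ∀ t r, g t r ∈ Set.Icc (0 : ℝ) 1) (k : ℕ) (r : ι) :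
    |(optPlay w η g (k + 1)).1 r / (leader w η g k).1 r - 1| ≤ 2 * η := by
  refine logBarArgmax_stability (by linarith) (fun r => ?_) r
  have hw1 := (hw (k + 1)).ne'
  have hw0 := (hw k).ne'
  have h : ((η / w (k + 1)) • (w (k + 1) • g k + cumulUtil w g k)) r -
      ((η / w k) • cumulUtil w g k) r =
        η * (g k r - (1 / w k - 1 / w (k + 1)) * cumulUtil w g k r) := by
    simp only [Pi.smul_apply, Pi.add_apply, smul_eq_mul]
    field_simp
    ring
  have hc : 0 ≤ 1 / w k - 1 / w (k + 1) :=
    sub_nonneg.2 (one_div_le_one_div_of_le (hw k) (hmono k))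
  have hU0 : 0 ≤ cumulUtil w g k r := by
    simp only [cumulUtil, Finset.sum_apply, Pi.smul_apply, smul_eq_mul]
    exact Finset.sum_nonneg fun j _ => mul_nonneg (hw _).le (hg _ _).1
  have hU1 : cumulUtil w g k r ≤ ∑ j ∈ Finset.range k, w (j + 1) := by
    simp only [cumulUtil, Finset.sum_apply, Pi.smul_apply, smul_eq_mul]
    exact Finset.sum_le_sum fun j _ => mul_le_of_le_one_right (hw _).le (hg _ _).2
  have h3 := (mul_le_mul_of_nonneg_left hU1 hc).trans (hdrift k)
  have h4 := mul_nonneg hc hU0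
  rw [h, abs_mul, abs_of_pos hη]
  have h2 := hg k r
  have : |g k r - (1 / w k - 1 / w (k + 1)) * cumulUtil w g k r| ≤ 1 :=
    abs_le.2 ⟨by linarith [h2.1], by linarith [h2.2]⟩
  nlinarith

/-- The regret is bounded by the variation of the utilities, minus the movement of the play. -/
theorem optPlay_regret_le_variation {w : ℕ → ℝ} {η : ℝ} (hη : 0 < η) (hη' : η ≤ 1 / 4)
    (hw : ∀ t, 0 < w t) (hmono : ∀ t, w t ≤ w (t + 1))
    (hdrift : ∀ t, (1 / w t - 1 / w (t + 1)) * ∑ k ∈ Finset.range t, w (k + 1) ≤ 1)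
    {g : ℕ → ι → ℝ} (hg : ∀ t r, g t r ∈ Set.Icc (0 : ℝ) 1) {δ : ℕ → ℝ}
    (hδ : ∀ k r, |g (k + 1) r - g k r| ≤ δ k) (t : ℕ) {p : ι → ℝ} (hp : p ∈ openSimplex ι) :
    ∑ k ∈ Finset.range t, w (k + 1) * ((p - (optPlay w η g (k + 1)).1) ⬝ᵥ g (k + 1)) ≤
      w t / η * logBarrier p + ∑ k ∈ Finset.range t,
        (5 / 2 * η * w (k + 1) * δ k ^ 2 -
          (w (k + 1) / (10 * η) * relSq (leader w η g (k + 1)).1 (optPlay w η g (k + 1)).1 +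
          w k / (10 * η) * relSq (optPlay w η g (k + 1)).1 (leader w η g k).1)) := by
  refine (optPlay_regret_le hη hw hmono g t hp).trans ?_
  refine add_le_add le_rfl (Finset.sum_le_sum fun k _ => ?_)
  set x := (optPlay w η g (k + 1)).1 with hx
  set y := (leader w η g (k + 1)).1 with hy
  set y0 := (leader w η g k).1 with hy0
  have hxm : x ∈ openSimplex ι := optPlay_mem w η g (k + 1)
  have hym : y ∈ openSimplex ι := leader_mem w η g (k + 1)
  have hy0m : y0 ∈ openSimplex ι := leader_mem w η g k
  have h1 := relSq_le_barrierDiv hxm.2 hym.2 fun r =>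
    (leader_div_optPlay_sub_one_le hη hη' hw hg k r).trans (by linarith)
  have h2 := relSq_le_barrierDiv hy0m.2 hxm.2 fun r =>
    (optPlay_div_leader_sub_one_le hη hη' hw hmono hdrift hg k r).trans (by linarith)
  have h3 : (y - x) ⬝ᵥ (g (k + 1) - g k) ≤ relSq y x / (10 * η) + 5 / 2 * η * δ k ^ 2 := by
    calc (y - x) ⬝ᵥ (g (k + 1) - g k)
        ≤ ∑ r, ((y r / x r - 1) ^ 2 / (10 * η) + 5 / 2 * η * δ k ^ 2 * x r) := by
          refine Finset.sum_le_sum fun r _ => ?_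
          have hxr := hxm.2 r
          have hxr1 := le_one_of_mem_stdSimplex hxm.1 r
          set z := y r / x r - 1 with hz
          set d := g (k + 1) r - g k r with hd
          have e1 : (y - x) r * (g (k + 1) - g k) r = z * (x r * d) := by
            simp only [Pi.sub_apply, hz, hd]
            field_simp
          -- Young's inequality, tuned to use half of the divergence term `relSq / (5 η)`. The other
          -- half stays as the negative movement term.
          have e2 : z * (x r * d) ≤ z ^ 2 / (10 * η) + 5 / 2 * η * (x r * d) ^ 2 := by
            have : 0 ≤ (z - 5 * η * (x r * d)) ^ 2 / (10 * η) := by positivity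
            have e : (z - 5 * η * (x r * d)) ^ 2 / (10 * η) =
              z ^ 2 / (10 * η) + 5 / 2 * η * (x r * d) ^ 2 - z * (x r * d) := by
              field_simp
              ring
            linarith
          have e3 : (x r * d) ^ 2 ≤ δ k ^ 2 * x r := by
            have e4 : d ^ 2 ≤ δ k ^ 2 := sq_le_sq' (abs_le.1 (hδ k r)).1 (abs_le.1 (hδ k r)).2
            -- Giving up one factor `x r` lets the terms `δ² x r` sum to `δ²`, with no factor for
            -- the number of actions.
            have e5 : x r ^ 2 ≤ x r := by nlinarith
            calc (x r * d) ^ 2 = d ^ 2 * x r ^ 2 := by ring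
              _ ≤ δ k ^ 2 * x r := by gcongr
          rw [e1]
          refine e2.trans ?_
          have := mul_le_mul_of_nonneg_left e3 (show 0 ≤ 5 / 2 * η by positivity)
          linarith
      _ = relSq y x / (10 * η) + 5 / 2 * η * δ k ^ 2 := by
          rw [Finset.sum_add_distrib, ← Finset.sum_div, ← Finset.mul_sum, hxm.1.2, mul_one]
          rfl
  have hw1 := hw (k + 1)
  have hw0 := hw k
  have h4 := mul_le_mul_of_nonneg_left h3 hw1.le
  have h5 := mul_le_mul_of_nonneg_left h1 (show 0 ≤ w (k + 1) / η by positivity)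
  have h6 := mul_le_mul_of_nonneg_left h2 (show 0 ≤ w k / η by positivity)
  have e1 : w (k + 1) * (relSq y x / (10 * η) + 5 / 2 * η * δ k ^ 2) =
    5 / 2 * η * w (k + 1) * δ k ^ 2 + w (k + 1) / (10 * η) * relSq y x := by
    field_simp
    ring
  have e2 : w (k + 1) / η * (relSq y x / 5) = 2 * (w (k + 1) / (10 * η) * relSq y x) := by
    field_simp
    ring
  have e3 : w k / η * (relSq x y0 / 5) = 2 * (w k / (10 * η) * relSq x y0) := by
    field_simp
    ring
  have h7 : 0 ≤ w k / (10 * η) * relSq x y0 := mul_nonneg (by positivity) (relSq_nonneg _ _)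
  linarith

end ExternalRegret

/-! ### Perturbation of stationary distributions -/

section Stationary

variable {ι : Type*} [Fintype ι]

/-- `x` is a stationary distribution of the stochastic matrix with rows `M a`. -/
def IsStationary (M : ι → stdSimplex ℝ ι) (x : stdSimplex ℝ ι) : Prop :=
  ∀ b, ∑ a, x.1 a * (M a).1 b = x.1 b

theorem isStationary_stationary [Nonempty ι] (M : ι → stdSimplex ℝ ι) :
    IsStationary M (stationary M) :=
  (exists_stationary M).choose_spec

theorem IsStationary.pos {M : ι → stdSimplex ℝ ι} {x : stdSimplex ℝ ι} (hx : IsStationary M x)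
    (hM : ∀ a b, 0 < (M a).1 b) (b : ι) : 0 < x.1 b := by
  obtain ⟨a, ha⟩ : ∃ a, 0 < x.1 a := by
    by_contra h
    push Not at h
    have h1 : ∑ a, x.1 a ≤ 0 := Finset.sum_nonpos fun a _ => h a
    have h2 : ∑ a, x.1 a = 1 := x.2.2
    linarith
  rw [← hx b]
  exact Finset.sum_pos' (fun c _ => mul_nonneg (x.2.1 c) (hM c b).le)
    ⟨a, Finset.mem_univ a, mul_pos ha (hM a b)⟩

/-- The ratio `x b / x a₀` is the expected number of visits to `b` between two visits to `a₀`. It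
depends on row `a₀` only through the law of the first step, so changing that row by a factor `c`
changes the ratio by at most `c`. The proof is a minimum principle for the cross difference `z`. -/
theorem IsStationary.cross_le {M N : ι → stdSimplex ℝ ι} {x y : stdSimplex ℝ ι}
    (hx : IsStationary M x) (hy : IsStationary N y) (hM : ∀ a b, 0 < (M a).1 b) {a₀ : ι}
    (heq : ∀ a, a ≠ a₀ → N a = M a) {c : ℝ} (hc : 1 ≤ c)
    (hle : ∀ b, (N a₀).1 b ≤ c * (M a₀).1 b) (b : ι) :
    y.1 b * x.1 a₀ ≤ c * (x.1 b * y.1 a₀) := by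
  classical
  let z : ι → ℝ := fun b => c * (x.1 b * y.1 a₀) - y.1 b * x.1 a₀
  have hz0 : 0 ≤ z a₀ := by
    have : 0 ≤ x.1 a₀ * y.1 a₀ := mul_nonneg (x.2.1 _) (y.2.1 _)
    change 0 ≤ c * (x.1 a₀ * y.1 a₀) - y.1 a₀ * x.1 a₀
    nlinarith
  have hz : ∀ b, ∑ a ∈ Finset.univ.erase a₀, z a * (M a).1 b ≤ z b := by
    intro b
    have h1 : z b = ∑ a, (c * (x.1 a * y.1 a₀) * (M a).1 b - y.1 a * x.1 a₀ * (N a).1 b) := by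
      change c * (x.1 b * y.1 a₀) - y.1 b * x.1 a₀ = _
      rw [← hx b, ← hy b, Finset.sum_mul, Finset.sum_mul, Finset.mul_sum,
        ← Finset.sum_sub_distrib]
      exact Finset.sum_congr rfl fun a _ => by ring
    rw [h1, ← Finset.add_sum_erase _ _ (Finset.mem_univ a₀)]
    have h2 : ∑ a ∈ Finset.univ.erase a₀, z a * (M a).1 b =
        ∑ a ∈ Finset.univ.erase a₀,
          (c * (x.1 a * y.1 a₀) * (M a).1 b - y.1 a * x.1 a₀ * (N a).1 b) := by
      refine Finset.sum_congr rfl fun a ha => ?_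
      rw [heq a (Finset.ne_of_mem_erase ha)]
      simp only [z]
      ring
    rw [h2]
    have h3 : 0 ≤ x.1 a₀ * y.1 a₀ := mul_nonneg (x.2.1 _) (y.2.1 _)
    have := mul_le_mul_of_nonneg_left (hle b) h3
    linarith
  -- The negative part of `z` vanishes at `a₀` and satisfies `m ≤ m M`. Total mass is preserved by
  -- `M`, so there can be no strict inequality; but positivity of column `a₀` would make it strict
  -- at `a₀` unless `m = 0`.
  let m : ι → ℝ := fun b => max (-z b) 0
  have hm0 : ∀ b, 0 ≤ m b := fun b => le_max_right _ _
  have hma : m a₀ = 0 := max_eq_right (by linarith)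
  have hm : ∀ b, m b ≤ ∑ a, m a * (M a).1 b := by
    intro b
    rw [← Finset.add_sum_erase _ _ (Finset.mem_univ a₀), hma, zero_mul, zero_add]
    refine max_le ?_ (Finset.sum_nonneg fun a _ => mul_nonneg (hm0 a) (hM a b).le)
    refine (neg_le_neg (hz b)).trans ?_
    rw [← Finset.sum_neg_distrib]
    refine Finset.sum_le_sum fun a _ => ?_
    rw [← neg_mul]
    exact mul_le_mul_of_nonneg_right (le_max_left _ _) (hM a b).le
  have hzero : m b = 0 := by
    by_contra hne
    have hpos : 0 < m b := lt_of_le_of_ne (hm0 b) (Ne.symm hne)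
    have hlt : ∑ b, m b < ∑ b, ∑ a, m a * (M a).1 b := by
      refine Finset.sum_lt_sum (fun b _ => hm b) ⟨a₀, Finset.mem_univ _, ?_⟩
      rw [hma]
      exact Finset.sum_pos' (fun a _ => mul_nonneg (hm0 a) (hM a a₀).le)
        ⟨b, Finset.mem_univ b, mul_pos hpos (hM b a₀)⟩
    rw [Finset.sum_comm] at hlt
    refine hlt.ne (Finset.sum_congr rfl fun a _ => ?_)
    rw [← Finset.mul_sum, show ∑ b, (M a).1 b = 1 from (M a).2.2, mul_one]
  have h1 : -z b ≤ 0 := by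
    rw [← hzero]
    exact le_max_left _ _
  simp only [z] at h1
  linarith

/-- One factor `c` comes from the ratios to the entry at `a₀`. The other comes from that entry
itself, by summing the reversed inequality over the simplex. -/
theorem IsStationary.le_sq_mul_of_eq_off {M N : ι → stdSimplex ℝ ι} {x y : stdSimplex ℝ ι}
    (hx : IsStationary M x) (hy : IsStationary N y) (hM : ∀ a b, 0 < (M a).1 b)
    (hN : ∀ a b, 0 < (N a).1 b) {a₀ : ι} (heq : ∀ a, a ≠ a₀ → N a = M a) {c : ℝ} (hc : 1 ≤ c)
    (hle : ∀ b, (N a₀).1 b ≤ c * (M a₀).1 b) (hle' : ∀ b, (M a₀).1 b ≤ c * (N a₀).1 b) (b : ι) :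
    y.1 b ≤ c ^ 2 * x.1 b := by
  have h1 := hx.cross_le hy hM heq hc hle b
  have h2 : y.1 a₀ ≤ c * x.1 a₀ := by
    have h3 := Finset.sum_le_sum fun b (_ : b ∈ Finset.univ) =>
      hy.cross_le hx hN (fun a ha => (heq a ha).symm) hc hle' b
    rw [← Finset.sum_mul, ← Finset.mul_sum, ← Finset.sum_mul,
      show ∑ b, x.1 b = 1 from x.2.2, show ∑ b, y.1 b = 1 from y.2.2] at h3
    linarith
  have hpos := hx.pos hM a₀
  refine le_of_mul_le_mul_right ?_ hpos
  have h4 := mul_le_mul_of_nonneg_left h2 (mul_nonneg (by linarith : 0 ≤ c) (x.2.1 b))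
  linarith

theorem IsStationary.unique {M : ι → stdSimplex ℝ ι} {x y : stdSimplex ℝ ι}
    (hx : IsStationary M x) (hy : IsStationary M y) (hM : ∀ a b, 0 < (M a).1 b) : x = y := by
  ext b
  have h1 := hx.le_sq_mul_of_eq_off hy hM hM (a₀ := b) (fun _ _ => rfl) le_rfl (by simp) (by simp) b
  have h2 := hy.le_sq_mul_of_eq_off hx hM hM (a₀ := b) (fun _ _ => rfl) le_rfl (by simp) (by simp) b
  change x.1 b = y.1 b
  linarith

/-- If every row changes by a bounded factor, so does the stationary distribution. -/
theorem IsStationary.le_exp_mul [Nonempty ι] {M N : ι → stdSimplex ℝ ι} {x y : stdSimplex ℝ ι}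
    (hx : IsStationary M x) (hy : IsStationary N y) (hM : ∀ a b, 0 < (M a).1 b)
    (hN : ∀ a b, 0 < (N a).1 b) {δ : ι → ℝ} (hδ : ∀ a, 0 ≤ δ a)
    (hle : ∀ a b, (N a).1 b ≤ Real.exp (δ a) * (M a).1 b)
    (hle' : ∀ a b, (M a).1 b ≤ Real.exp (δ a) * (N a).1 b) (b : ι) :
    y.1 b ≤ Real.exp (2 * ∑ a, δ a) * x.1 b := by
  classical
  -- Hybrid matrices: the rows are exchanged one at a time, each at the cost of a factor `exp (δ a)
  -- ^ 2`.
  let P : Finset ι → ι → stdSimplex ℝ ι := fun s a => if a ∈ s then N a else M a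
  have hP : ∀ s a b, 0 < (P s a).1 b := by
    intro s a b
    simp only [P]
    split_ifs
    exacts [hN a b, hM a b]
  have key : ∀ s : Finset ι, ∀ y : stdSimplex ℝ ι, IsStationary (P s) y →
      ∀ b, y.1 b ≤ Real.exp (2 * ∑ a ∈ s, δ a) * x.1 b := by
    intro s
    induction s using Finset.induction_on with
    | empty =>
      intro y hy b
      have : P ∅ = M := by
        funext a
        simp [P]
      rw [this] at hy
      simp [hx.unique hy hM]
    | insert a s ha ih =>
      intro y hy b
      have hz := isStationary_stationary (P s)
      have h1 : P s a = M a := by simp [P, ha]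
      have h2 : P (insert a s) a = N a := by simp [P]
      have h3 := hz.le_sq_mul_of_eq_off hy (hP _) (hP _) (a₀ := a)
        (fun c hc => by simp [P, hc]) (Real.one_le_exp (hδ a))
        (fun b => by rw [h1, h2]; exact hle a b) (fun b => by rw [h1, h2]; exact hle' a b) b
      refine h3.trans ?_
      rw [Finset.sum_insert ha, mul_add, Real.exp_add, mul_assoc, two_mul (δ a), Real.exp_add,
        ← sq]
      exact mul_le_mul_of_nonneg_left (ih _ hz b) (sq_nonneg _)
  refine key Finset.univ y ?_ b
  have : P Finset.univ = N := by
    funext a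
    simp [P]
  rwa [this]

/-- The `ℓ¹`-distance of the stationary distributions of two positive matrices, when the entries
of row `a` differ by at most the factor `1 ± m a`. -/
theorem IsStationary.sum_abs_sub_le [Nonempty ι] {M N : ι → stdSimplex ℝ ι} {x y : stdSimplex ℝ ι}
    (hx : IsStationary M x) (hy : IsStationary N y) (hM : ∀ a b, 0 < (M a).1 b)
    (hN : ∀ a b, 0 < (N a).1 b) {m : ι → ℝ} (hm : ∀ a b, |(N a).1 b / (M a).1 b - 1| ≤ m a)
    (hm1 : ∑ a, m a ≤ 1 / 9) : ∑ b, |y.1 b - x.1 b| ≤ 4 * ∑ a, m a := by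
  have hm0 : ∀ a, 0 ≤ m a := fun a => (abs_nonneg _).trans (hm a (Classical.arbitrary ι))
  have hm2 : ∀ a, m a ≤ 1 / 9 := fun a =>
    (Finset.single_le_sum (fun c _ => hm0 c) (Finset.mem_univ a)).trans hm1
  -- The constant `3/2` makes `(1 + δ)(1 - m) ≥ 1` for small `m`, so that the reversed ratio is also
  -- at most `exp δ`. The exponent is then `κ = 3 ∑ m ≤ 1/3`, and `exp κ - 1 ≤ κ + κ² ≤ 4 ∑ m`.
  let δ : ι → ℝ := fun a => 3 / 2 * m a
  have hδ : ∀ a, 0 ≤ δ a := fun a => mul_nonneg (by norm_num) (hm0 a)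
  have hNM : ∀ a b, (N a).1 b ≤ Real.exp (δ a) * (M a).1 b := by
    intro a b
    rw [← div_le_iff₀ (hM a b)]
    have h1 := (abs_le.1 (hm a b)).2
    have h2 := Real.add_one_le_exp (δ a)
    have := hm0 a
    simp only [δ] at h2 ⊢
    linarith
  have hMN : ∀ a b, (M a).1 b ≤ Real.exp (δ a) * (N a).1 b := by
    intro a b
    have h1 := (abs_le.1 (hm a b)).1
    have h2 := Real.add_one_le_exp (δ a)
    have h3 : 1 ≤ Real.exp (δ a) * (1 - m a) := by
      have h4 : (1 + 3 / 2 * m a) * (1 - m a) ≤ Real.exp (δ a) * (1 - m a) := by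
        refine mul_le_mul_of_nonneg_right ?_ (by linarith [hm2 a])
        simp only [δ] at h2 ⊢
        linarith
      nlinarith [hm0 a, hm2 a]
    have h5 : (1 - m a) * (M a).1 b ≤ (N a).1 b := by
      rw [← le_div_iff₀ (hM a b)]
      linarith
    calc (M a).1 b ≤ Real.exp (δ a) * (1 - m a) * (M a).1 b :=
          le_mul_of_one_le_left (hM a b).le h3
      _ = Real.exp (δ a) * ((1 - m a) * (M a).1 b) := by ring
      _ ≤ _ := mul_le_mul_of_nonneg_left h5 (Real.exp_pos _).le
  have h1 := hx.le_exp_mul hy hM hN hδ hNM hMN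
  have h2 := hy.le_exp_mul hx hN hM hδ hMN hNM
  set κ := 2 * ∑ a, δ a with hκ
  have hκ' : κ = 3 * ∑ a, m a := by
    rw [hκ, ← Finset.mul_sum]
    ring
  have hs0 : 0 ≤ ∑ a, m a := Finset.sum_nonneg fun a _ => hm0 a
  have hκ0 : 0 ≤ κ := by linarith
  have hexp : Real.exp κ - 1 ≤ 4 * ∑ a, m a := by
    have h3 := (abs_le.1 (Real.abs_exp_sub_one_sub_id_le (x := κ)
      (abs_le.2 ⟨by linarith, by linarith⟩))).2
    nlinarith
  have hge1 := Real.one_le_exp hκ0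
  calc ∑ b, |y.1 b - x.1 b| ≤ ∑ b, (Real.exp κ - 1) * x.1 b := by
        refine Finset.sum_le_sum fun b _ => abs_le.2 ⟨?_, by linarith [h1 b]⟩
        have h3 : Real.exp κ * (x.1 b - y.1 b) ≤ Real.exp κ * ((Real.exp κ - 1) * x.1 b) := by
          have h4 := h2 b
          have h5 := x.2.1 b
          have h6 := mul_nonneg (mul_self_nonneg (Real.exp κ - 1)) h5
          nlinarith
        have := le_of_mul_le_mul_left h3 (Real.exp_pos κ)
        linarith
    _ = Real.exp κ - 1 := by rw [← Finset.mul_sum, show ∑ b, x.1 b = 1 from x.2.2, mul_one]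
    _ ≤ _ := hexp

end Stationary

/-! ### Swap regret of a single learner -/

section SwapRegret

variable {ι : Type*} [Fintype ι]

/-- The `ℓ¹`-distance. -/
def l1Dist (x y : ι → ℝ) : ℝ := ∑ a, |x a - y a|

theorem l1Dist_nonneg (x y : ι → ℝ) : 0 ≤ l1Dist x y := Finset.sum_nonneg fun _ _ => abs_nonneg _

theorem dotProduct_mem_Icc {x u : ι → ℝ} (hx : x ∈ stdSimplex ℝ ι)
    (hu : ∀ r, u r ∈ Set.Icc (0 : ℝ) 1) : x ⬝ᵥ u ∈ Set.Icc (0 : ℝ) 1 := by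
  refine ⟨Finset.sum_nonneg fun r _ => mul_nonneg (hx.1 r) (hu r).1, ?_⟩
  rw [← hx.2]
  exact Finset.sum_le_sum fun r _ => mul_le_of_le_one_right (hx.1 r) (hu r).2

theorem norm_sub_one_sq_le_relSq (y x : ι → ℝ) :
    ‖fun r => y r / x r - 1‖ ^ 2 ≤ relSq y x := by
  rw [← Real.le_sqrt (norm_nonneg _) (relSq_nonneg _ _)]
  refine (pi_norm_le_iff_of_nonneg (Real.sqrt_nonneg _)).2 fun r => ?_
  rw [Real.norm_eq_abs]
  refine Real.abs_le_sqrt ?_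
  exact Finset.single_le_sum (f := fun r => (y r / x r - 1) ^ 2) (fun _ _ => sq_nonneg _)
    (Finset.mem_univ r)

variable [Nonempty ι]

/-- The movement of the stationary distributions is controlled by the relative movement of the
rows. -/
theorem l1Dist_sq_le_relSq {X Y Z : ι → stdSimplex ℝ ι} {x z : stdSimplex ℝ ι}
    (hx : IsStationary X x) (hz : IsStationary Z z) (hX : ∀ a b, 0 < (X a).1 b)
    (hY : ∀ a b, 0 < (Y a).1 b) (hZ : ∀ a b, 0 < (Z a).1 b) {m : ℝ}
    (hm : Fintype.card ι * m ≤ 1 / 9) (hYX : ∀ a b, |(Y a).1 b / (X a).1 b - 1| ≤ m)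
    (hZY : ∀ a b, |(Z a).1 b / (Y a).1 b - 1| ≤ m) :
    l1Dist z.1 x.1 ^ 2 ≤ 32 * Fintype.card ι *
      (∑ a, relSq (Y a).1 (X a).1 + ∑ a, relSq (Z a).1 (Y a).1) := by
  have hm0 : 0 ≤ m := (abs_nonneg _).trans (hYX (Classical.arbitrary ι) (Classical.arbitrary ι))
  have hnorm : ∀ {P Q : ι → stdSimplex ℝ ι}, (∀ a b, |(P a).1 b / (Q a).1 b - 1| ≤ m) →
      ∑ a, ‖fun b => (P a).1 b / (Q a).1 b - 1‖ ≤ 1 / 9 := by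
    intro P Q h
    refine le_trans (Finset.sum_le_sum fun a _ => (pi_norm_le_iff_of_nonneg hm0).2 (h a)) ?_
    simpa using hm
  -- The path from `X` to `Z` passes through the stationary distribution of the intermediate matrix
  -- `Y`. The uniform bound `m` only guarantees smallness; the distances are measured by the actual
  -- sup norms of the row changes.
  have hy := isStationary_stationary Y
  have h1 := hx.sum_abs_sub_le hy hX hY
    (fun a b => norm_le_pi_norm (fun b => (Y a).1 b / (X a).1 b - 1) b) (hnorm hYX)
  have h2 := hy.sum_abs_sub_le hz hY hZ
    (fun a b => norm_le_pi_norm (fun b => (Z a).1 b / (Y a).1 b - 1) b) (hnorm hZY)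
  set p : ι → ℝ := fun a => ‖fun b => (Y a).1 b / (X a).1 b - 1‖ with hp
  set q : ι → ℝ := fun a => ‖fun b => (Z a).1 b / (Y a).1 b - 1‖ with hq
  have h3 : l1Dist z.1 x.1 ≤ 4 * ∑ a, (p a + q a) := by
    have : l1Dist z.1 x.1 ≤ ∑ b, |(stationary Y).1 b - x.1 b| +
        ∑ b, |z.1 b - (stationary Y).1 b| := by
      rw [← Finset.sum_add_distrib]
      refine Finset.sum_le_sum fun b _ => ?_
      rw [add_comm]
      exact abs_sub_le _ _ _
    rw [Finset.sum_add_distrib, mul_add]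
    linarith
  have h4 : (∑ a, (p a + q a)) ^ 2 ≤ Fintype.card ι * ∑ a, (p a + q a) ^ 2 := by
    simpa using sq_sum_le_card_mul_sum_sq (s := Finset.univ) (f := fun a => p a + q a)
  have h5 : ∑ a, (p a + q a) ^ 2 ≤
      2 * (∑ a, relSq (Y a).1 (X a).1 + ∑ a, relSq (Z a).1 (Y a).1) := by
    rw [← Finset.sum_add_distrib, Finset.mul_sum]
    refine Finset.sum_le_sum fun a _ => ?_
    have h6 : p a ^ 2 ≤ _ := norm_sub_one_sq_le_relSq (Y a).1 (X a).1
    have h7 : q a ^ 2 ≤ _ := norm_sub_one_sq_le_relSq (Z a).1 (Y a).1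
    nlinarith [sq_nonneg (p a - q a)]
  calc l1Dist z.1 x.1 ^ 2 ≤ (4 * ∑ a, (p a + q a)) ^ 2 :=
        pow_le_pow_left₀ (l1Dist_nonneg _ _) h3 2
    _ = 16 * (∑ a, (p a + q a)) ^ 2 := by ring
    _ ≤ 16 * (Fintype.card ι * (2 * (∑ a, relSq (Y a).1 (X a).1 +
          ∑ a, relSq (Z a).1 (Y a).1))) := by
        have : (0 : ℝ) ≤ Fintype.card ι := by positivity
        have := h4.trans (mul_le_mul_of_nonneg_left h5 this)
        linarith
    _ = _ := by ring

/-! ### Comparators in the interior of the simplex -/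

/-- The point `p` moved towards the barycentre of the simplex. -/
noncomputable def towardsCenter (T : ℕ) (p : ι → ℝ) : ι → ℝ :=
  fun r => (1 - 1 / (T : ℝ)) * p r + 1 / (T : ℝ) * (Fintype.card ι : ℝ)⁻¹

theorem towardsCenter_mem {T : ℕ} (hT : 1 ≤ T) {p : ι → ℝ} (hp : p ∈ stdSimplex ℝ ι) :
    towardsCenter T p ∈ openSimplex ι := by
  have hT' : (1 : ℝ) ≤ T := by exact_mod_cast hT
  have h1 : 0 ≤ 1 - 1 / (T : ℝ) := by
    rw [sub_nonneg, div_le_one (by positivity)]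
    exact hT'
  have hcard : (0 : ℝ) < Fintype.card ι := by exact_mod_cast Fintype.card_pos
  have hpos : ∀ r, 0 < towardsCenter T p r := fun r =>
    add_pos_of_nonneg_of_pos (mul_nonneg h1 (hp.1 r)) (by positivity)
  refine ⟨⟨fun r => (hpos r).le, ?_⟩, hpos⟩
  simp only [towardsCenter, Finset.sum_add_distrib, ← Finset.mul_sum, hp.2, Finset.sum_const,
    Finset.card_univ, nsmul_eq_mul]
  rw [mul_inv_cancel₀ hcard.ne']
  ring

/-- The barrier is infinite on the boundary, where the relevant comparators may lie. After the shift
every coordinate is at least `1 / (card * T)`, which is the source of the logarithm in the rate. -/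
theorem logBarrier_towardsCenter_le {T : ℕ} (hT : 1 ≤ T) {p : ι → ℝ} (hp : p ∈ stdSimplex ℝ ι) :
    logBarrier (towardsCenter T p) ≤ Fintype.card ι * Real.log (Fintype.card ι * T) := by
  have hT' : (1 : ℝ) ≤ T := by exact_mod_cast hT
  have h1 : 0 ≤ 1 - 1 / (T : ℝ) := by
    rw [sub_nonneg, div_le_one (by positivity)]
    exact hT'
  have hcard : (0 : ℝ) < Fintype.card ι := by exact_mod_cast Fintype.card_pos
  unfold logBarrier
  rw [← Finset.sum_neg_distrib, ← nsmul_eq_mul, ← Finset.card_univ]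
  refine Finset.sum_le_card_nsmul _ _ _ fun r _ => ?_
  rw [← Real.log_inv]
  have h2 : ((Fintype.card ι : ℝ) * T)⁻¹ ≤ towardsCenter T p r := by
    have : 0 ≤ (1 - 1 / (T : ℝ)) * p r := mul_nonneg h1 (hp.1 r)
    unfold towardsCenter
    rw [mul_inv]
    have e : (1 : ℝ) / T * (Fintype.card ι : ℝ)⁻¹ = (Fintype.card ι : ℝ)⁻¹ * (T : ℝ)⁻¹ := by
      rw [one_div, mul_comm]
    linarith
  have hpos := (towardsCenter_mem hT hp).2 r
  exact Real.log_le_log (inv_pos.2 hpos) (inv_le_of_inv_le₀ (by positivity) h2)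

theorem dotProduct_le_towardsCenter {T : ℕ} (hT : 1 ≤ T) {p u : ι → ℝ} (hp : p ∈ stdSimplex ℝ ι)
    (hu : ∀ r, u r ∈ Set.Icc (0 : ℝ) 1) : p ⬝ᵥ u ≤ towardsCenter T p ⬝ᵥ u + 1 / T := by
  have hcard : (0 : ℝ) < Fintype.card ι := by exact_mod_cast Fintype.card_pos
  have h1 : towardsCenter T p ⬝ᵥ u = (1 - 1 / (T : ℝ)) * (p ⬝ᵥ u) +
      1 / (T : ℝ) * ∑ r, (Fintype.card ι : ℝ)⁻¹ * u r := by
    simp only [towardsCenter, dotProduct, Finset.mul_sum, ← Finset.sum_add_distrib]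
    exact Finset.sum_congr rfl fun r _ => by ring
  have h2 : 0 ≤ 1 / (T : ℝ) * ∑ r, (Fintype.card ι : ℝ)⁻¹ * u r :=
    mul_nonneg (by positivity)
      (Finset.sum_nonneg fun r _ => mul_nonneg (by positivity) (hu r).1)
  have h3 := mul_le_mul_of_nonneg_left (dotProduct_mem_Icc hp hu).2
    (show 0 ≤ 1 / (T : ℝ) by positivity)
  rw [h1]
  linarith

/-! ### Reduction of swap regret to external regret -/

/-- Learner dynamics: in every round the output is stationary for the matrix whose row `a` is the
optimistic iterate for the utilities `x^t[a] • u^t`. -/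
def IsSwapLearner (w : ℕ → ℝ) (η : ℝ) (u : ℕ → ι → ℝ) (x : ℕ → stdSimplex ℝ ι) : Prop :=
  ∀ t, IsStationary (fun a => optPlay w η (fun k => (x k).1 a • u k) t) (x t)

/-- Since `x = ∑ x[a] X_a`, swap regret is the sum over `a` of the external regrets of the rows for
the utilities `x[a] • u`. Their movement terms combine into a negative multiple of the squared
`ℓ¹`-movement of the output; the constant is `320 = 10 * 32`. The parameter `T` only sets the shift
of the comparators and is independent of the length `t`. -/
theorem IsSwapLearner.swapRegret_le {w : ℕ → ℝ} {η : ℝ} {u : ℕ → ι → ℝ}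
    {x : ℕ → stdSimplex ℝ ι} (hx : IsSwapLearner w η u x) (hη : 0 < η)
    (hcard : η * Fintype.card ι ≤ 1 / 128) (hw : ∀ t, 0 < w t) (hmono : ∀ t, w t ≤ w (t + 1))
    (hdrift : ∀ t, (1 / w t - 1 / w (t + 1)) * ∑ k ∈ Finset.range t, w (k + 1) ≤ 1)
    (hu : ∀ t r, u t r ∈ Set.Icc (0 : ℝ) 1) {D : ℕ → ℝ} (hD : ∀ k r, |u (k + 1) r - u k r| ≤ D k)
    {T : ℕ} (hT : 1 ≤ T) (t : ℕ) (N : ι → stdSimplex ℝ ι) :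
    ∑ k ∈ Finset.range t, w (k + 1) *
        (∑ a, (x (k + 1)).1 a * ((N a).1 ⬝ᵥ u (k + 1)) - (x (k + 1)).1 ⬝ᵥ u (k + 1)) ≤
      (Fintype.card ι : ℝ) ^ 2 * (w t / η) * Real.log (Fintype.card ι * T) +
        (∑ k ∈ Finset.range t, w (k + 1)) / T +
        ∑ k ∈ Finset.range t,
          (5 * η * w (k + 1) * (l1Dist (x (k + 1)).1 (x k).1 ^ 2 + D k ^ 2) -
            w k / (320 * Fintype.card ι * η) * l1Dist (x (k + 1)).1 (x k).1 ^ 2) := by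
  classical
  have hc1 : (1 : ℝ) ≤ Fintype.card ι := by exact_mod_cast Fintype.card_pos
  have hη' : η ≤ 1 / 128 := by nlinarith
  set g : ι → ℕ → ι → ℝ := fun a k => (x k).1 a • u k with hg
  set X : ι → ℕ → stdSimplex ℝ ι := fun a => optPlay w η (g a) with hX
  set Y : ι → ℕ → stdSimplex ℝ ι := fun a => leader w η (g a) with hY
  have hst : ∀ t, IsStationary (fun a => X a t) (x t) := hx
  have hg01 : ∀ a t r, g a t r ∈ Set.Icc (0 : ℝ) 1 := fun a t r => by
    simp only [hg, Pi.smul_apply, smul_eq_mul]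
    exact ⟨mul_nonneg ((x t).2.1 a) (hu t r).1,
      mul_le_one₀ (le_one_of_mem_stdSimplex (x t).2 a) (hu t r).1 (hu t r).2⟩
  -- The utility of row `a` varies with the learner's own weight `x[a]` as well as with `u`. This is
  -- why the own movement also appears among the positive terms.
  let δ : ι → ℕ → ℝ := fun a k => |(x (k + 1)).1 a - (x k).1 a| + (x (k + 1)).1 a * D k
  have hδ : ∀ a k r, |g a (k + 1) r - g a k r| ≤ δ a k := by
    intro a k r
    simp only [hg, Pi.smul_apply, smul_eq_mul]
    have e : (x (k + 1)).1 a * u (k + 1) r - (x k).1 a * u k r =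
        ((x (k + 1)).1 a - (x k).1 a) * u k r + (x (k + 1)).1 a * (u (k + 1) r - u k r) := by ring
    rw [e]
    refine (abs_add_le _ _).trans (add_le_add ?_ ?_)
    · rw [abs_mul, abs_of_nonneg (hu k r).1]
      exact mul_le_of_le_one_right (abs_nonneg _) (hu k r).2
    · rw [abs_mul, abs_of_nonneg ((x (k + 1)).2.1 a)]
      exact mul_le_mul_of_nonneg_left (hD k r) ((x (k + 1)).2.1 a)
  have hδsum : ∀ k, ∑ a, δ a k ^ 2 ≤ 2 * (l1Dist (x (k + 1)).1 (x k).1 ^ 2 + D k ^ 2) := by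
    intro k
    have h1 : ∑ a, |(x (k + 1)).1 a - (x k).1 a| ^ 2 ≤ l1Dist (x (k + 1)).1 (x k).1 ^ 2 :=
      Finset.sum_sq_le_sq_sum_of_nonneg fun a _ => abs_nonneg _
    have h2 : ∑ a, (x (k + 1)).1 a ^ 2 ≤ 1 := by
      rw [← (x (k + 1)).2.2]
      refine Finset.sum_le_sum fun a _ => ?_
      have := le_one_of_mem_stdSimplex (x (k + 1)).2 a
      have := (x (k + 1)).2.1 a
      nlinarith
    calc ∑ a, δ a k ^ 2 ≤ ∑ a, (2 * |(x (k + 1)).1 a - (x k).1 a| ^ 2 +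
          2 * D k ^ 2 * (x (k + 1)).1 a ^ 2) := by
          refine Finset.sum_le_sum fun a _ => ?_
          nlinarith [sq_nonneg (|(x (k + 1)).1 a - (x k).1 a| - (x (k + 1)).1 a * D k)]
      _ ≤ _ := by
          rw [Finset.sum_add_distrib, ← Finset.mul_sum, ← Finset.mul_sum]
          have := mul_le_mul_of_nonneg_left h2 (show 0 ≤ 2 * D k ^ 2 by positivity)
          linarith
  let p : ι → ι → ℝ := fun a => towardsCenter T (N a).1
  have hreg := Finset.sum_le_sum fun a (_ : a ∈ Finset.univ) =>
    optPlay_regret_le_variation hη (by linarith) hw hmono hdrift (hg01 a) (hδ a) t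
      (towardsCenter_mem hT (N a).2)
  -- the left-hand side
  have hlhs : ∑ k ∈ Finset.range t, w (k + 1) *
        (∑ a, (x (k + 1)).1 a * ((N a).1 ⬝ᵥ u (k + 1)) - (x (k + 1)).1 ⬝ᵥ u (k + 1)) ≤
      ∑ a, ∑ k ∈ Finset.range t, w (k + 1) * ((p a - (X a (k + 1)).1) ⬝ᵥ g a (k + 1)) +
        (∑ k ∈ Finset.range t, w (k + 1)) / T := by
    rw [Finset.sum_comm, Finset.sum_div, ← Finset.sum_add_distrib]
    refine Finset.sum_le_sum fun k _ => ?_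
    have e1 : ∑ a, w (k + 1) * ((p a - (X a (k + 1)).1) ⬝ᵥ g a (k + 1)) =
        w (k + 1) * (∑ a, (x (k + 1)).1 a * (p a ⬝ᵥ u (k + 1)) -
          (x (k + 1)).1 ⬝ᵥ u (k + 1)) := by
      have e2 : (x (k + 1)).1 ⬝ᵥ u (k + 1) =
          ∑ a, (x (k + 1)).1 a * ((X a (k + 1)).1 ⬝ᵥ u (k + 1)) := by
        simp only [dotProduct, Finset.mul_sum]
        rw [Finset.sum_comm]
        refine Finset.sum_congr rfl fun b _ => ?_
        rw [← hst (k + 1) b, Finset.sum_mul]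
        exact Finset.sum_congr rfl fun a _ => by ring
      rw [e2, ← Finset.sum_sub_distrib, Finset.mul_sum]
      refine Finset.sum_congr rfl fun a _ => ?_
      simp only [hg, dotProduct_smul, sub_dotProduct, smul_eq_mul]
      ring
    rw [e1, ← mul_one_div, ← mul_add]
    refine mul_le_mul_of_nonneg_left ?_ (hw _).le
    have h3 : ∑ a, (x (k + 1)).1 a * ((N a).1 ⬝ᵥ u (k + 1)) ≤
        ∑ a, ((x (k + 1)).1 a * (p a ⬝ᵥ u (k + 1)) + (x (k + 1)).1 a * (1 / T)) := by
      refine Finset.sum_le_sum fun a _ => ?_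
      rw [← mul_add]
      exact mul_le_mul_of_nonneg_left (dotProduct_le_towardsCenter hT (N a).2 (hu _))
        ((x (k + 1)).2.1 a)
    rw [Finset.sum_add_distrib, ← Finset.sum_mul,
      show ∑ a, (x (k + 1)).1 a = 1 from (x (k + 1)).2.2, one_mul] at h3
    linarith
  -- the movement of the rows
  let Z : ℕ → ℝ := fun k => ∑ a, relSq (Y a k).1 (X a k).1
  let Q : ℕ → ℝ := fun k => ∑ a, relSq (X a (k + 1)).1 (Y a k).1
  -- Passing from output `k` to output `k + 1` uses the step from iterate to leader in round `k`,
  -- but the regret bound provides these steps for rounds `1, …, t`. The index shift is free because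
  -- leader and iterate coincide in round `0`.
  have hZ0 : Z 0 = 0 := by
    refine Finset.sum_eq_zero fun a _ => ?_
    simp only [hY, hX, leader_zero]
    refine Finset.sum_eq_zero fun r _ => ?_
    rw [div_self ((optPlay_mem w η (g a) 0).2 r).ne']
    norm_num
  have hZn : ∀ k, 0 ≤ Z k := fun k => Finset.sum_nonneg fun a _ => relSq_nonneg _ _
  have hmove : ∀ k, l1Dist (x (k + 1)).1 (x k).1 ^ 2 ≤
      32 * Fintype.card ι * (Z k + Q k) := by
    intro k
    refine l1Dist_sq_le_relSq (Y := fun a => Y a k) (hst k) (hst (k + 1))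
      (fun a => (optPlay_mem w η (g a) k).2) (fun a => (leader_mem w η (g a) k).2)
      (fun a => (optPlay_mem w η (g a) (k + 1)).2) (m := 2 * η) (by nlinarith) ?_ ?_
    · intro a b
      rcases k with _ | k
      · simp only [hY, hX, leader_zero]
        rw [div_self ((optPlay_mem w η (g a) 0).2 b).ne']
        simp only [sub_self, abs_zero]
        positivity
      · exact leader_div_optPlay_sub_one_le hη (by linarith) hw (hg01 a) k b
    · intro a b
      exact optPlay_div_leader_sub_one_le hη (by linarith) hw hmono hdrift (hg01 a) k b
  have hshift : ∑ k ∈ Finset.range t, w k / (10 * η) * Z k ≤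
      ∑ k ∈ Finset.range t, w (k + 1) / (10 * η) * Z (k + 1) := by
    have h1 := Finset.sum_range_succ' (fun k => w k / (10 * η) * Z k) t
    rw [Finset.sum_range_succ, hZ0, mul_zero, add_zero] at h1
    have : 0 ≤ w t / (10 * η) * Z t := mul_nonneg (by have := hw t; positivity) (hZn t)
    linarith
  have hneg : ∑ k ∈ Finset.range t,
        w k / (320 * Fintype.card ι * η) * l1Dist (x (k + 1)).1 (x k).1 ^ 2 ≤
      ∑ k ∈ Finset.range t, (w (k + 1) / (10 * η) * Z (k + 1) + w k / (10 * η) * Q k) := by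
    rw [Finset.sum_add_distrib]
    refine le_trans ?_ (add_le_add hshift le_rfl)
    rw [← Finset.sum_add_distrib]
    refine Finset.sum_le_sum fun k _ => ?_
    have hwk := hw k
    have h1 := mul_le_mul_of_nonneg_left (hmove k)
      (show 0 ≤ w k / (320 * Fintype.card ι * η) by positivity)
    refine h1.trans (le_of_eq ?_)
    field_simp
    ring
  have hbar : ∑ a, w t / η * logBarrier (p a) ≤
      (Fintype.card ι : ℝ) ^ 2 * (w t / η) * Real.log (Fintype.card ι * T) := by
    have hwt := hw t
    calc ∑ a, w t / η * logBarrier (p a) ≤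
          ∑ _a : ι, w t / η * (Fintype.card ι * Real.log (Fintype.card ι * T)) := by
          refine Finset.sum_le_sum fun a _ => ?_
          exact mul_le_mul_of_nonneg_left (logBarrier_towardsCenter_le hT (N a).2) (by positivity)
      _ = _ := by
          rw [Finset.sum_const, Finset.card_univ, nsmul_eq_mul]
          ring
  have hvar : ∑ k ∈ Finset.range t, 5 / 2 * η * w (k + 1) * ∑ a, δ a k ^ 2 ≤
      ∑ k ∈ Finset.range t,
        5 * η * w (k + 1) * (l1Dist (x (k + 1)).1 (x k).1 ^ 2 + D k ^ 2) := by
    refine Finset.sum_le_sum fun k _ => ?_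
    have hwk := hw (k + 1)
    have := mul_le_mul_of_nonneg_left (hδsum k) (show 0 ≤ 5 / 2 * η * w (k + 1) by positivity)
    linarith
  have hrhs : ∑ a, (w t / η * logBarrier (p a) + ∑ k ∈ Finset.range t,
        (5 / 2 * η * w (k + 1) * δ a k ^ 2 -
          (w (k + 1) / (10 * η) * relSq (Y a (k + 1)).1 (X a (k + 1)).1 +
          w k / (10 * η) * relSq (X a (k + 1)).1 (Y a k).1))) =
      ∑ a, w t / η * logBarrier (p a) +
        (∑ k ∈ Finset.range t, 5 / 2 * η * w (k + 1) * ∑ a, δ a k ^ 2 -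
        ∑ k ∈ Finset.range t, (w (k + 1) / (10 * η) * Z (k + 1) + w k / (10 * η) * Q k)) := by
    rw [Finset.sum_add_distrib, Finset.sum_comm, ← Finset.sum_sub_distrib]
    congr 1
    refine Finset.sum_congr rfl fun k _ => ?_
    simp only [Z, Q, Finset.mul_sum, Finset.sum_sub_distrib, Finset.sum_add_distrib]
  rw [Finset.sum_sub_distrib]
  have hreg' := hreg.trans (le_of_eq hrhs)
  refine hlhs.trans ?_
  linarith

end SwapRegret

/-! ### Several learners -/

section Players

variable {n : ℕ} {A : Fin n → Type*} [∀ i, Fintype (A i)]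

/-! ### Expectations under product strategies -/

theorem sum_prod_eq_one {p : ∀ j, A j → ℝ} (hp : ∀ j, p j ∈ stdSimplex ℝ (A j)) :
    ∑ a : ∀ j, A j, ∏ j, p j (a j) = 1 := by
  classical
  rw [← Fintype.piFinset_univ, ← Finset.prod_univ_sum]
  exact Finset.prod_eq_one fun j _ => (hp j).2

/-- The total variation distance of product distributions is at most the sum of the distances of
the factors. -/
theorem sum_abs_prod_sub_prod_le {p q : ∀ j, A j → ℝ} (hp : ∀ j, p j ∈ stdSimplex ℝ (A j))
    (hq : ∀ j, q j ∈ stdSimplex ℝ (A j)) :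
    ∑ a : ∀ j, A j, |∏ j, p j (a j) - ∏ j, q j (a j)| ≤ ∑ j, l1Dist (p j) (q j) := by
  classical
  let r : Finset (Fin n) → ∀ j, A j → ℝ := fun s j => if j ∈ s then p j else q j
  have hr : ∀ s j, r s j ∈ stdSimplex ℝ (A j) := by
    intro s j
    simp only [r]
    split_ifs
    exacts [hp j, hq j]
  have key : ∀ s : Finset (Fin n),
      ∑ a : ∀ j, A j, |∏ j, r s j (a j) - ∏ j, q j (a j)| ≤ ∑ j ∈ s, l1Dist (p j) (q j) := by
    intro s
    induction s using Finset.induction_on with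
    | empty => simp [r]
    | insert k s hk ih =>
      rw [Finset.sum_insert hk]
      have hstep : ∑ a : ∀ j, A j, |∏ j, r (insert k s) j (a j) - ∏ j, r s j (a j)| =
          l1Dist (p k) (q k) := by
        let m : ∀ j, A j → ℝ := Function.update (r s) k fun b => |p k b - q k b|
        have h1 : ∀ a : ∀ j, A j,
            |∏ j, r (insert k s) j (a j) - ∏ j, r s j (a j)| = ∏ j, m j (a j) := by
          intro a
          rw [← Finset.mul_prod_erase _ _ (Finset.mem_univ k),
            ← Finset.mul_prod_erase _ (fun j => r s j (a j)) (Finset.mem_univ k),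
            ← Finset.mul_prod_erase _ (fun j => m j (a j)) (Finset.mem_univ k)]
          have e1 : ∏ j ∈ Finset.univ.erase k, r (insert k s) j (a j) =
              ∏ j ∈ Finset.univ.erase k, r s j (a j) := by
            refine Finset.prod_congr rfl fun j hj => ?_
            have := Finset.ne_of_mem_erase hj
            simp [r, this]
          have e2 : ∏ j ∈ Finset.univ.erase k, m j (a j) =
              ∏ j ∈ Finset.univ.erase k, r s j (a j) := by
            refine Finset.prod_congr rfl fun j hj => ?_
            have := Finset.ne_of_mem_erase hj
            simp [m, this]
          rw [e1, e2, ← sub_mul, abs_mul,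
            abs_of_nonneg (Finset.prod_nonneg fun j _ => (hr s j).1 (a j))]
          simp [r, m, hk]
        rw [Finset.sum_congr rfl fun a _ => h1 a, ← Fintype.piFinset_univ, ← Finset.prod_univ_sum,
          ← Finset.mul_prod_erase _ _ (Finset.mem_univ k)]
        rw [Finset.prod_eq_one fun j hj => ?_]
        · simp [m, l1Dist]
        · simp only [m, Function.update_of_ne (Finset.ne_of_mem_erase hj)]
          exact (hr s j).2
      rw [← hstep]
      refine le_trans ?_ (add_le_add le_rfl ih)
      rw [← Finset.sum_add_distrib]
      exact Finset.sum_le_sum fun a _ => abs_sub_le _ _ _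
  have := key Finset.univ
  simpa [r] using this

/-- Expectation of `f` when every player `j` draws an action from `p j`. -/
def prodExp (p : ∀ j, A j → ℝ) (f : (∀ j, A j) → ℝ) : ℝ := ∑ a, (∏ j, p j (a j)) * f a

theorem prodExp_mono {p : ∀ j, A j → ℝ} (hp : ∀ j, p j ∈ stdSimplex ℝ (A j))
    {f g : (∀ j, A j) → ℝ} (h : ∀ a, f a ≤ g a) : prodExp p f ≤ prodExp p g :=
  Finset.sum_le_sum fun a _ =>
    mul_le_mul_of_nonneg_left (h a) (Finset.prod_nonneg fun j _ => (hp j).1 (a j))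

theorem prodExp_const {p : ∀ j, A j → ℝ} (hp : ∀ j, p j ∈ stdSimplex ℝ (A j)) (c : ℝ) :
    prodExp p (fun _ => c) = c := by
  rw [prodExp, ← Finset.sum_mul, sum_prod_eq_one hp, one_mul]

theorem prodExp_add (p : ∀ j, A j → ℝ) (f g : (∀ j, A j) → ℝ) :
    prodExp p (fun a => f a + g a) = prodExp p f + prodExp p g := by
  simp only [prodExp, mul_add, Finset.sum_add_distrib]

theorem prodExp_smul (p : ∀ j, A j → ℝ) (c : ℝ) (f : (∀ j, A j) → ℝ) :
    prodExp p (fun a => c * f a) = c * prodExp p f := by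
  simp only [prodExp, Finset.mul_sum]
  exact Finset.sum_congr rfl fun a _ => by ring

theorem prodExp_mem_Icc {p : ∀ j, A j → ℝ} (hp : ∀ j, p j ∈ stdSimplex ℝ (A j))
    {f : (∀ j, A j) → ℝ} {l r : ℝ} (h : ∀ a, f a ∈ Set.Icc l r) :
    prodExp p f ∈ Set.Icc l r := by
  constructor
  · rw [← prodExp_const hp l]
    exact prodExp_mono hp fun a => (h a).1
  · rw [← prodExp_const hp r]
    exact prodExp_mono hp fun a => (h a).2

theorem abs_prodExp_sub_le {p q : ∀ j, A j → ℝ} (hp : ∀ j, p j ∈ stdSimplex ℝ (A j))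
    (hq : ∀ j, q j ∈ stdSimplex ℝ (A j)) {f g : (∀ j, A j) → ℝ} {B ε : ℝ}
    (hf : ∀ a, |f a| ≤ B) (hfg : ∀ a, |f a - g a| ≤ ε) :
    |prodExp p f - prodExp q g| ≤ ε + B * ∑ j, l1Dist (p j) (q j) := by
  have e : prodExp p f - prodExp q g =
      ∑ a, ((∏ j, q j (a j)) * (f a - g a) +
        (∏ j, p j (a j) - ∏ j, q j (a j)) * f a) := by
    rw [prodExp, prodExp, ← Finset.sum_sub_distrib]
    exact Finset.sum_congr rfl fun a _ => by ring
  rw [e, Finset.sum_add_distrib]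
  refine (abs_add_le _ _).trans (add_le_add ?_ ?_)
  · refine (Finset.abs_sum_le_sum_abs _ _).trans ?_
    rw [← prodExp_const hq ε]
    refine Finset.sum_le_sum fun a _ => ?_
    have := Finset.prod_nonneg fun j (_ : j ∈ Finset.univ) => (hq j).1 (a j)
    rw [abs_mul, abs_of_nonneg this]
    exact mul_le_mul_of_nonneg_left (hfg a) this
  · refine (Finset.abs_sum_le_sum_abs _ _).trans ?_
    -- The sign of `B` is known only if a joint action exists; otherwise the probabilities could not
    -- sum to one.
    have hB : 0 ≤ B ∨ IsEmpty (∀ j, A j) := by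
      rcases isEmpty_or_nonempty (∀ j, A j) with h | ⟨⟨a⟩⟩
      · exact Or.inr h
      · exact Or.inl ((abs_nonneg _).trans (hf a))
    have h1 : ∑ a : ∀ j, A j, |(∏ j, p j (a j) - ∏ j, q j (a j)) * f a| ≤
        B * ∑ a : ∀ j, A j, |∏ j, p j (a j) - ∏ j, q j (a j)| := by
      rw [Finset.mul_sum]
      refine Finset.sum_le_sum fun a _ => ?_
      rw [abs_mul, mul_comm]
      exact mul_le_mul_of_nonneg_right (hf a) (abs_nonneg _)
    rcases hB with hB | hE
    · exact h1.trans (mul_le_mul_of_nonneg_left (sum_abs_prod_sub_prod_le hp hq) hB)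
    · exfalso
      have := sum_prod_eq_one hp
      simp at this

theorem expJoint_eq_prodExp {H : ℕ} {S : Type*} (π : MarkovProfile H S A) (h : Fin H) (s : S)
    (f : (∀ i, A i) → ℝ) : expJoint π h s f = prodExp (fun j => (π j h s).1) f := rfl

theorem sum_mul_expOthers {H : ℕ} {S : Type*} (π : MarkovProfile H S A) (i : Fin n) (h : Fin H)
    (s : S) (f : (∀ i, A i) → ℝ) (y : A i → ℝ) :
    ∑ b, y b * expOthers π i h s f b =
      prodExp (Function.update (fun j => (π j h s).1) i y) f := by
  classical
  unfold prodExp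
  rw [← Finset.sum_fiberwise Finset.univ (fun a : ∀ j, A j => a i)]
  refine Finset.sum_congr rfl fun b _ => ?_
  unfold expOthers
  rw [Finset.mul_sum]
  refine Finset.sum_congr (by congr) fun a ha => ?_
  have ha' : a i = b := by simpa using ha
  rw [← Finset.mul_prod_erase _ (fun j => Function.update (fun j => (π j h s).1) i y j (a j))
    (Finset.mem_univ i), Function.update_self, ha', mul_assoc]
  congr 2
  refine Finset.prod_congr rfl fun j hj => ?_
  rw [Function.update_of_ne (Finset.ne_of_mem_erase hj)]

open Classical in
theorem expOthers_eq_prodExp {H : ℕ} {S : Type*} (π : MarkovProfile H S A) (i : Fin n)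
    (h : Fin H) (s : S) (f : (∀ i, A i) → ℝ) (b : A i) :
    expOthers π i h s f b =
      prodExp (Function.update (fun j => (π j h s).1) i (Pi.single b 1)) f := by
  rw [← sum_mul_expOthers]
  simp [Pi.single_apply]

theorem update_mem_stdSimplex {p : ∀ j, A j → ℝ} (hp : ∀ j, p j ∈ stdSimplex ℝ (A j)) (i : Fin n)
    {y : A i → ℝ} (hy : y ∈ stdSimplex ℝ (A i)) (j : Fin n) :
    Function.update p i y j ∈ stdSimplex ℝ (A j) := by
  rcases eq_or_ne j i with rfl | hj
  · simpa using hy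
  · simpa [hj] using hp j

theorem expOthers_mem_Icc {H : ℕ} {S : Type*} (π : MarkovProfile H S A) (i : Fin n)
    (h : Fin H) (s : S) {f : (∀ i, A i) → ℝ} {l r : ℝ} (hf : ∀ a, f a ∈ Set.Icc l r) (b : A i) :
    expOthers π i h s f b ∈ Set.Icc l r := by
  classical
  rw [expOthers_eq_prodExp]
  exact prodExp_mem_Icc (update_mem_stdSimplex (fun j => (π j h s).2) i
    (single_mem_stdSimplex ℝ b)) hf

/-- Both expectations use the same point mass for player `i`, so only the movements of the other
players enter the total variation distance. -/
theorem abs_expOthers_sub_le {H : ℕ} {S : Type*} (π π' : MarkovProfile H S A) (i : Fin n)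
    (h : Fin H) (s : S) {f g : (∀ i, A i) → ℝ} {B ε : ℝ}
    (hf : ∀ a, |f a| ≤ B) (hfg : ∀ a, |f a - g a| ≤ ε) (b : A i) :
    |expOthers π i h s f b - expOthers π' i h s g b| ≤
      ε + B * ∑ j ∈ Finset.univ.erase i, l1Dist (π j h s).1 (π' j h s).1 := by
  classical
  rw [expOthers_eq_prodExp, expOthers_eq_prodExp]
  refine (abs_prodExp_sub_le
    (update_mem_stdSimplex (fun j => (π j h s).2) i (single_mem_stdSimplex ℝ b))
    (update_mem_stdSimplex (fun j => (π' j h s).2) i (single_mem_stdSimplex ℝ b))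
    hf hfg).trans (le_of_eq ?_)
  rw [← Finset.add_sum_erase _ _ (Finset.mem_univ i)]
  have e1 : l1Dist (Function.update (fun j => (π j h s).1) i (Pi.single b 1) i)
      (Function.update (fun j => (π' j h s).1) i (Pi.single b 1) i) = 0 := by
    simp [l1Dist]
  rw [e1, zero_add]
  congr 2
  refine Finset.sum_congr rfl fun j hj => ?_
  rw [Function.update_of_ne (Finset.ne_of_mem_erase hj),
    Function.update_of_ne (Finset.ne_of_mem_erase hj)]

/-- Used with `d` the movements of the players and `a` the drift of the values: the variation terms
of one learner are bounded by the squared movements of all players. -/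
theorem sq_add_sum_erase_le (i : Fin n) (d : Fin n → ℝ) (a : ℝ) :
    d i ^ 2 + (a + ∑ j ∈ Finset.univ.erase i, d j) ^ 2 ≤ 2 * a ^ 2 + 2 * n * ∑ j, d j ^ 2 := by
  have h1 : (∑ j ∈ Finset.univ.erase i, d j) ^ 2 ≤
      (Finset.univ.erase i).card * ∑ j ∈ Finset.univ.erase i, d j ^ 2 :=
    sq_sum_le_card_mul_sum_sq
  have hn : (1 : ℝ) ≤ n := by exact_mod_cast i.pos
  have hcard : ((Finset.univ.erase i).card : ℝ) ≤ n := by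
    exact_mod_cast (Finset.card_le_univ _).trans (by simp)
  have h0 : 0 ≤ ∑ j ∈ Finset.univ.erase i, d j ^ 2 := Finset.sum_nonneg fun j _ => sq_nonneg _
  have h2 := mul_le_mul_of_nonneg_right hcard h0
  rw [← Finset.add_sum_erase _ (fun j => d j ^ 2) (Finset.mem_univ i)]
  nlinarith [sq_nonneg (a - ∑ j ∈ Finset.univ.erase i, d j), sq_nonneg (d i)]

variable [∀ i, Nonempty (A i)]

/-- If the utilities of the players vary no more than the plays of the other players and a
summable drift `β`, the swap regret of every player is bounded independently of the variation. -/
theorem swapRegret_le_of_variation {w β : ℕ → ℝ} {η C N : ℝ} {u : ∀ i, ℕ → A i → ℝ}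
    {x : ∀ i, ℕ → stdSimplex ℝ (A i)} (hx : ∀ i, IsSwapLearner w η (u i) (x i)) (hη : 0 < η)
    (hN : ∀ i, (Fintype.card (A i) : ℝ) ≤ N) (hηN : η * N ≤ 1 / 128)
    (hw : ∀ t, 0 < w t) (hmono : ∀ t, w t ≤ w (t + 1)) (hC : ∀ t, w (t + 1) ≤ C * w t)
    (hηC : 6400 * (n : ℝ) ^ 2 * C * N * η ^ 2 ≤ 1)
    (hdrift : ∀ t, (1 / w t - 1 / w (t + 1)) * ∑ k ∈ Finset.range t, w (k + 1) ≤ 1)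
    (hu : ∀ i t r, u i t r ∈ Set.Icc (0 : ℝ) 1)
    (hvar : ∀ i k r, |u i (k + 1) r - u i k r| ≤
      β k + ∑ j ∈ Finset.univ.erase i, l1Dist (x j (k + 1)).1 (x j k).1)
    {T : ℕ} (hT : 1 ≤ T) (t : ℕ) (i : Fin n) (M : A i → stdSimplex ℝ (A i)) :
    ∑ k ∈ Finset.range t, w (k + 1) *
        (∑ a, (x i (k + 1)).1 a * ((M a).1 ⬝ᵥ u i (k + 1)) - (x i (k + 1)).1 ⬝ᵥ u i (k + 1)) ≤
      2 * (N ^ 2 * (w t / η) * Real.log (N * T) + (∑ k ∈ Finset.range t, w (k + 1)) / T +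
        10 * η * ∑ k ∈ Finset.range t, w (k + 1) * β k ^ 2) := by
  classical
  set K := N ^ 2 * (w t / η) * Real.log (N * T) + (∑ k ∈ Finset.range t, w (k + 1)) / T +
        10 * η * ∑ k ∈ Finset.range t, w (k + 1) * β k ^ 2 with hK
  let d : ℕ → Fin n → ℝ := fun k j => l1Dist (x j (k + 1)).1 (x j k).1
  let s : ℕ → ℝ := fun k => ∑ j, d k j ^ 2
  have hT' : (1 : ℝ) ≤ T := by exact_mod_cast hT
  have hn : (1 : ℝ) ≤ n := by exact_mod_cast i.pos
  have hc1 : ∀ i, (1 : ℝ) ≤ Fintype.card (A i) := fun i => by exact_mod_cast Fintype.card_pos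
  have hN1 : 1 ≤ N := (hc1 i).trans (hN i)
  have hs0 : ∀ k, 0 ≤ s k := fun k => Finset.sum_nonneg fun j _ => sq_nonneg _
  have hB : ∀ (i : Fin n) (M : A i → stdSimplex ℝ (A i)),
      ∑ k ∈ Finset.range t, w (k + 1) *
        (∑ a, (x i (k + 1)).1 a * ((M a).1 ⬝ᵥ u i (k + 1)) - (x i (k + 1)).1 ⬝ᵥ u i (k + 1)) ≤
      K + ∑ k ∈ Finset.range t, 10 * n * η * w (k + 1) * s k -
        ∑ k ∈ Finset.range t, w k / (320 * N * η) * d k i ^ 2 := by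
    intro i M
    refine ((hx i).swapRegret_le hη ((mul_le_mul_of_nonneg_left (hN i) hη.le).trans hηN) hw hmono
      hdrift (hu i) (hvar i) hT t M).trans ?_
    have h1 : (Fintype.card (A i) : ℝ) ^ 2 * (w t / η) * Real.log (Fintype.card (A i) * T) ≤
        N ^ 2 * (w t / η) * Real.log (N * T) := by
      have := hw t
      have h2 : 1 ≤ (Fintype.card (A i) : ℝ) * T := by nlinarith [hc1 i]
      have h3 : Real.log (Fintype.card (A i) * T) ≤ Real.log (N * T) :=
        Real.log_le_log (by linarith) (mul_le_mul_of_nonneg_right (hN i) (by linarith))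
      have := Real.log_nonneg h2
      have := hN i
      gcongr
    have h2 : ∑ k ∈ Finset.range t,
        (5 * η * w (k + 1) * (l1Dist (x i (k + 1)).1 (x i k).1 ^ 2 + (β k +
          ∑ j ∈ Finset.univ.erase i, l1Dist (x j (k + 1)).1 (x j k).1) ^ 2) -
          w k / (320 * Fintype.card (A i) * η) * l1Dist (x i (k + 1)).1 (x i k).1 ^ 2) ≤
        ∑ k ∈ Finset.range t, (10 * η * (w (k + 1) * β k ^ 2) + 10 * n * η * w (k + 1) * s k -
          w k / (320 * N * η) * d k i ^ 2) := by
      refine Finset.sum_le_sum fun k _ => ?_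
      have hw0 := hw k
      have hw1 := hw (k + 1)
      have h3 := mul_le_mul_of_nonneg_left (sq_add_sum_erase_le i (d k) (β k))
        (show 0 ≤ 5 * η * w (k + 1) by positivity)
      have h4 : w k / (320 * N * η) * d k i ^ 2 ≤
          w k / (320 * Fintype.card (A i) * η) * d k i ^ 2 := by
        have := hc1 i
        have := hN i
        gcongr
      simp only [d, s] at h3 h4 ⊢
      linarith
    refine (add_le_add (add_le_add h1 le_rfl) h2).trans (le_of_eq ?_)
    rw [Finset.sum_sub_distrib, Finset.sum_add_distrib, ← Finset.mul_sum, hK]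
    ring
  -- The identity modification, whose rows are point masses, has swap regret exactly zero. Each
  -- upper bound is therefore nonnegative.
  have hnonneg : ∀ i : Fin n, 0 ≤ K + ∑ k ∈ Finset.range t, 10 * n * η * w (k + 1) * s k -
        ∑ k ∈ Finset.range t, w k / (320 * N * η) * d k i ^ 2 := by
    intro i
    refine le_trans (le_of_eq ?_) (hB i fun a => ⟨Pi.single a 1, single_mem_stdSimplex ℝ a⟩)
    symm
    refine Finset.sum_eq_zero fun k _ => ?_
    simp only [single_dotProduct, one_mul]
    simp [dotProduct]
  have hsum : 0 ≤ n * (K + ∑ k ∈ Finset.range t, 10 * n * η * w (k + 1) * s k) -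
        ∑ k ∈ Finset.range t, w k / (320 * N * η) * s k := by
    have h1 := Finset.sum_nonneg fun i (_ : i ∈ Finset.univ) => hnonneg i
    rw [Finset.sum_sub_distrib, Finset.sum_comm] at h1
    simp only [← Finset.mul_sum, Finset.sum_const, Finset.card_univ, Fintype.card_fin,
      nsmul_eq_mul] at h1 ⊢
    exact h1
  -- The step-size condition enters here, with `6400 = 10 * 320 * 2`. The positive movement terms,
  -- summed over the players, are at most half of the negative ones. With `hsum` this bounds them by
  -- `K`, whence the factor `2` in the conclusion.
  have hhalf : n * ∑ k ∈ Finset.range t, 10 * n * η * w (k + 1) * s k ≤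
      (∑ k ∈ Finset.range t, w k / (320 * N * η) * s k) / 2 := by
    rw [Finset.mul_sum, Finset.sum_div]
    refine Finset.sum_le_sum fun k _ => ?_
    have hw0 := hw k
    have h1 : n * (10 * n * η * w (k + 1)) ≤ w k / (320 * N * η) / 2 := by
      rw [div_div, le_div_iff₀ (by positivity)]
      calc n * (10 * n * η * w (k + 1)) * (320 * N * η * 2)
          = 6400 * (n : ℝ) ^ 2 * N * η ^ 2 * w (k + 1) := by ring
        _ ≤ 6400 * (n : ℝ) ^ 2 * N * η ^ 2 * (C * w k) :=
          mul_le_mul_of_nonneg_left (hC k) (by positivity)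
        _ = 6400 * (n : ℝ) ^ 2 * C * N * η ^ 2 * w k := by ring
        _ ≤ 1 * w k := mul_le_mul_of_nonneg_right hηC hw0.le
        _ = w k := one_mul _
    have := mul_le_mul_of_nonneg_right h1 (hs0 k)
    linarith
  have hfin : ∑ k ∈ Finset.range t, 10 * n * η * w (k + 1) * s k ≤ K := by
    refine le_of_mul_le_mul_left ?_ (show (0 : ℝ) < n by linarith)
    linarith
  have hd0 : 0 ≤ ∑ k ∈ Finset.range t, w k / (320 * N * η) * d k i ^ 2 :=
    Finset.sum_nonneg fun k _ => mul_nonneg (div_nonneg (hw k).le (by positivity)) (sq_nonneg _)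
  have := hB i M
  linarith

end Players

/-! ### Potentials along random paths -/

section Paths

variable {Y : Type*}

/-- Probability of a path whose `h`-th entry has the conditional law `κ h τ` given the path `τ`
before it. -/
def pathProb {K : ℕ} (κ : ∀ h : Fin K, (Fin h → Y) → Y → ℝ) (y : Fin K → Y) : ℝ :=
  ∏ h, κ h (fun k => y (Fin.castLE h.isLt.le k)) (y h)

theorem pathProb_snoc {K : ℕ} (κ : ∀ h : Fin (K + 1), (Fin h → Y) → Y → ℝ) (τ : Fin K → Y)
    (y : Y) : pathProb κ (Fin.snoc (α := fun _ => Y) τ y) =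
      pathProb (fun h : Fin K => κ h.castSucc) τ * κ (Fin.last K) τ y := by
  unfold pathProb
  rw [Fin.prod_univ_castSucc]
  congr 1
  · refine Finset.prod_congr rfl fun h _ => ?_
    rw [Fin.snoc_castSucc]
    congr 1
    funext k
    exact Fin.snoc_castSucc (α := fun _ => Y) y τ (Fin.castLE h.isLt.le k)
  · rw [Fin.snoc_last]
    congr 1
    funext k
    exact Fin.snoc_castSucc (α := fun _ => Y) y τ k

theorem pathProb_nonneg {K : ℕ} {κ : ∀ h : Fin K, (Fin h → Y) → Y → ℝ}
    (hκ : ∀ h τ y, 0 ≤ κ h τ y) (y : Fin K → Y) : 0 ≤ pathProb κ y :=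
  Finset.prod_nonneg fun _ _ => hκ _ _ _

theorem good_of_pathProb_ne_zero {K : ℕ} {κ : ∀ h : Fin K, (Fin h → Y) → Y → ℝ}
    {good : ∀ k : Fin (K + 1), (Fin k → Y) → Prop} (hgood0 : ∀ τ, good 0 τ)
    (hgood : ∀ (h : Fin K) (τ : Fin h → Y) (y : Y), κ h τ y ≠ 0 →
      good h.succ (Fin.snoc (α := fun _ => Y) τ y))
    (y : Fin K → Y) (hy : pathProb κ y ≠ 0) : good (Fin.last K) y := by
  cases K with
  | zero => exact hgood0 y
  | succ K =>
    obtain ⟨⟨y, τ⟩, rfl⟩ := (Fin.snocEquiv fun _ => Y).surjective y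
    change pathProb κ (Fin.snoc (α := fun _ => Y) τ y) ≠ 0 at hy
    rw [pathProb_snoc] at hy
    exact hgood (Fin.last K) τ y (right_ne_zero_of_mul hy)

/-- If `W` does not increase in expectation when the reward `ρ` is added, then it bounds the
expected total reward. -/
theorem sum_pathProb_mul_le [Fintype Y] {K : ℕ} {κ : ∀ h : Fin K, (Fin h → Y) → Y → ℝ}
    (ρ : Fin K → Y → ℝ) (W : ∀ k : Fin (K + 1), (Fin k → Y) → ℝ)
    (hκ : ∀ h τ y, 0 ≤ κ h τ y)
    {good : ∀ k : Fin (K + 1), (Fin k → Y) → Prop} (hgood0 : ∀ τ, good 0 τ)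
    (hgood : ∀ (h : Fin K) (τ : Fin h → Y) (y : Y), κ h τ y ≠ 0 →
      good h.succ (Fin.snoc (α := fun _ => Y) τ y))
    (hmass : ∀ (h : Fin K) (τ : Fin h → Y), good h.castSucc τ → ∑ y, κ h τ y = 1)
    (hW : ∀ (h : Fin K) (τ : Fin h → Y), good h.castSucc τ →
      ∑ y, κ h τ y * (ρ h y + W h.succ (Fin.snoc (α := fun _ => Y) τ y)) ≤ W h.castSucc τ) :
    ∑ y, pathProb κ y * (∑ h, ρ h (y h) + W (Fin.last K) y) ≤ W 0 Fin.elim0 := by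
  induction K with
  | zero =>
    simp only [pathProb, Finset.univ_eq_empty, Finset.prod_empty, Finset.sum_empty, one_mul,
      zero_add]
    rw [Fintype.sum_unique]
    apply le_of_eq
    congr 1
  | succ K ih =>
    have h1 := ih (κ := fun h => κ h.castSucc) (fun h => ρ h.castSucc) (fun k => W k.castSucc)
      (fun h => hκ h.castSucc) (good := fun k => good k.castSucc) hgood0
      (fun h => hgood h.castSucc) (fun h => hmass h.castSucc) (fun h => hW h.castSucc)
    refine le_trans ?_ h1
    rw [← (Fin.snocEquiv fun _ => Y).sum_comp, Fintype.sum_prod_type, Finset.sum_comm]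
    refine Finset.sum_le_sum fun τ _ => ?_
    change ∑ y, pathProb κ (Fin.snoc (α := fun _ => Y) τ y) *
      (∑ h, ρ h (Fin.snoc (α := fun _ => Y) τ y h) +
        W (Fin.last (K + 1)) (Fin.snoc (α := fun _ => Y) τ y)) ≤ _
    set P := pathProb (fun h : Fin K => κ h.castSucc) τ with hP
    -- The kernel need not have mass one after an impossible path, since `α_t^·` is a distribution
    -- only for `t ≥ 1`. Paths of probability zero are therefore discarded before `good` is used.
    rcases eq_or_ne P 0 with h0 | h0
    · rw [h0, zero_mul]
      refine le_of_eq (Finset.sum_eq_zero fun y _ => ?_)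
      rw [pathProb_snoc, ← hP, h0, zero_mul, zero_mul]
    have hτ : good (Fin.last K).castSucc τ :=
      good_of_pathProb_ne_zero (κ := fun h : Fin K => κ h.castSucc)
        (good := fun k => good k.castSucc) hgood0 (fun h => hgood h.castSucc) τ h0
    have hPn : 0 ≤ P := pathProb_nonneg (fun h => hκ h.castSucc) τ
    have h2 := hW (Fin.last K) τ hτ
    have h3 := hmass (Fin.last K) τ hτ
    have h4 : ∀ y, pathProb κ (Fin.snoc (α := fun _ => Y) τ y) *
        (∑ h, ρ h (Fin.snoc (α := fun _ => Y) τ y h) +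
          W (Fin.last (K + 1)) (Fin.snoc (α := fun _ => Y) τ y)) =
        P * (κ (Fin.last K) τ y * ∑ h : Fin K, ρ h.castSucc (τ h) +
          κ (Fin.last K) τ y * (ρ (Fin.last K) y +
            W (Fin.last K).succ (Fin.snoc (α := fun _ => Y) τ y))) := by
      intro y
      rw [pathProb_snoc, ← hP, Fin.sum_univ_castSucc, Fin.snoc_last]
      simp only [Fin.snoc_castSucc]
      change _ * (_ + _ + W (Fin.last K).succ (Fin.snoc (α := fun _ => Y) τ y)) = _
      ring
    rw [Finset.sum_congr rfl fun y _ => h4 y, ← Finset.mul_sum, Finset.sum_add_distrib,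
      ← Finset.sum_mul, h3, one_mul]
    exact mul_le_mul_of_nonneg_left (add_le_add le_rfl h2) hPn

end Paths

/-! ### Values of policies that draw a round index for every step -/

section PathValue

set_option linter.unusedSectionVars false

variable {n H : ℕ} {S : Type*} {A : Fin n → Type*} [∀ i, Fintype (A i)] [Fintype S] {T : ℕ}

theorem drawProb_eq_prod (H T k t : ℕ) (j : Fin k → Fin (T + 1)) :
    drawProb H T k t j = ∏ h : Fin k, alphaW H
      (if h.val = 0 then t else (j ⟨h.val - 1, lt_of_le_of_lt (Nat.sub_le _ _) h.isLt⟩).val)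
      (j h) := by
  induction k generalizing t with
  | zero => simp [drawProb]
  | succ k ih =>
    rw [drawProb, ih, Fin.prod_univ_succ]
    congr 1
    refine Finset.prod_congr rfl fun h _ => ?_
    congr 1
    rcases h with ⟨_ | h, hh⟩
    · rfl
    · rfl

/-- One step of a path: the round index, the state and the joint action. -/
abbrev PathStep (T : ℕ) (S : Type*) (A : Fin n → Type*) : Type _ := Fin (T + 1) × S × (∀ i, A i)

/-- The round index drawn before step `k`, or `T` if there is none. -/
noncomputable def prevIndex {k : ℕ} (τ : Fin k → PathStep T S A) : ℕ :=
  if hk : k = 0 then T else (τ ⟨k - 1, Nat.sub_lt (Nat.pos_of_ne_zero hk) one_pos⟩).1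

open Classical in
/-- The law of the state at step `k` after the path `τ`. -/
noncomputable def MarkovGame.nextState (G : MarkovGame n H S A) (k : Fin (H + 1))
    (τ : Fin k → PathStep T S A) (s : S) : ℝ :=
  if hk : k.val = 0 then (if s = G.init then 1 else 0)
  else
    let y := τ ⟨k.val - 1, Nat.sub_lt (Nat.pos_of_ne_zero hk) one_pos⟩
    (G.trans ⟨k.val - 1, by omega⟩ y.2.1 y.2.2).1 s

theorem MarkovGame.nextState_mem (G : MarkovGame n H S A) (k : Fin (H + 1))
    (τ : Fin k → PathStep T S A) : G.nextState k τ ∈ stdSimplex ℝ S := by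
  classical
  by_cases hk : k.val = 0
  · refine ⟨fun s => ?_, ?_⟩
    · simp only [nextState, hk, dif_pos]
      split_ifs <;> norm_num
    · simp [nextState, hk]
  · have : G.nextState k τ = (G.trans ⟨k.val - 1, by omega⟩
        (τ ⟨k.val - 1, Nat.sub_lt (Nat.pos_of_ne_zero hk) one_pos⟩).2.1
        (τ ⟨k.val - 1, Nat.sub_lt (Nat.pos_of_ne_zero hk) one_pos⟩).2.2).1 := by
      funext s
      simp [nextState, hk]
    rw [this]
    exact Subtype.property _

theorem prevIndex_snoc {k : ℕ} (τ : Fin k → PathStep T S A) (y : PathStep T S A) :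
    prevIndex (Fin.snoc (α := fun _ => PathStep T S A) τ y) = y.1 := by
  simp only [prevIndex, Nat.add_eq_zero_iff, one_ne_zero, and_false, dif_neg, not_false_eq_true]
  have : (⟨k + 1 - 1, Nat.sub_lt (Nat.succ_pos k) one_pos⟩ : Fin (k + 1)) = Fin.last k := rfl
  rw [this, Fin.snoc_last]

theorem MarkovGame.nextState_snoc (G : MarkovGame n H S A) (h : Fin H)
    (τ : Fin h → PathStep T S A) (y : PathStep T S A) (s : S) :
    G.nextState h.succ (Fin.snoc (α := fun _ => PathStep T S A) τ y) s =
      (G.trans h y.2.1 y.2.2).1 s := by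
  have hk : (h.succ).val ≠ 0 := by simp
  have e : (Fin.snoc (α := fun _ => PathStep T S A) τ y : Fin (h + 1) → PathStep T S A)
      ⟨h + 1 - 1, Nat.sub_lt (Nat.succ_pos h) one_pos⟩ = y := by
    have : (⟨h + 1 - 1, Nat.sub_lt (Nat.succ_pos h) one_pos⟩ : Fin (h + 1)) = Fin.last h := rfl
    rw [this, Fin.snoc_last]
  unfold nextState
  rw [dif_neg hk]
  change (G.trans h ((Fin.snoc (α := fun _ => PathStep T S A) τ y : Fin (h + 1) → PathStep T S A)
      ⟨h + 1 - 1, _⟩).2.1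
    ((Fin.snoc (α := fun _ => PathStep T S A) τ y : Fin (h + 1) → PathStep T S A)
      ⟨h + 1 - 1, _⟩).2.2).1 s = _
  rw [e]

/-- The conditional law of a step, when player `i` plays `f i h j τ s` with the round index `j`. -/
noncomputable def MarkovGame.stepProb (G : MarkovGame n H S A)
    (f : ∀ (i : Fin n) (h : Fin H), Fin (T + 1) → History S A h → S → stdSimplex ℝ (A i))
    (h : Fin H) (τ : Fin h → PathStep T S A) (y : PathStep T S A) : ℝ :=
  alphaW H (prevIndex τ) y.1 * (G.nextState h.castSucc τ y.2.1 *
    ∏ i, (f i h y.1 (fun k => (τ k).2) y.2.1).1 (y.2.2 i))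

/-- Expected total of `R` for a policy with the sample `ω` drawn as in the output policy. -/
noncomputable def MarkovGame.expectedTotal (G : MarkovGame n H S A)
    (π : JointPolicy H S A (Fin H → Fin (T + 1))) (R : Fin H → S → (∀ i, A i) → ℝ) : ℝ :=
  ∑ ω : Fin H → Fin (T + 1), drawProb H T H T ω *
    ∑ traj : Fin H → S × (∀ i, A i), G.trajProb π ω traj * ∑ h, R h (traj h).1 (traj h).2

theorem MarkovGame.value_eq_expectedTotal (G : MarkovGame n H S A)
    (π : JointPolicy H S A (Fin H → Fin (T + 1))) (hT : 1 ≤ T)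
    (hlaw : π.law = (drawPMF H T hT).toMeasure) (i : Fin n) :
    G.value π i = G.expectedTotal π (G.reward i) := by
  unfold value expectedTotal
  rw [hlaw, PMF.integral_eq_sum]
  refine Finset.sum_congr rfl fun ω _ => ?_
  rw [smul_eq_mul]
  congr 1
  simp only [drawPMF, PMF.ofFintype_apply]
  exact ENNReal.toReal_ofReal (drawProb_nonneg _ _ _ _ _)

/-- The strategies at step `h` use the sample only through its `h`-th index. Drawing all indices in
advance therefore gives the same law as drawing each one when its step is reached, and the process
becomes a path of triples (index, state, joint action). -/
theorem MarkovGame.expectedTotal_eq_sum_pathProb (G : MarkovGame n H S A)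
    (π : JointPolicy H S A (Fin H → Fin (T + 1)))
    (f : ∀ (i : Fin n) (h : Fin H), Fin (T + 1) → History S A h → S → stdSimplex ℝ (A i))
    (hf : ∀ i h ω τ s, π.strategy i h ω τ s = f i h (ω h) τ s)
    (R : Fin H → S → (∀ i, A i) → ℝ) :
    G.expectedTotal π R = ∑ y : Fin H → PathStep T S A,
      pathProb (G.stepProb f) y * ∑ h, R h (y h).2.1 (y h).2.2 := by
  unfold expectedTotal
  rw [← (Equiv.arrowProdEquivProdArrow (Fin H) (fun _ => Fin (T + 1))
    (fun _ => S × (∀ i, A i))).symm.sum_comp, Fintype.sum_prod_type]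
  refine Finset.sum_congr rfl fun ω _ => ?_
  rw [Finset.mul_sum]
  refine Finset.sum_congr rfl fun traj _ => ?_
  rw [← mul_assoc]
  congr 1
  rw [drawProb_eq_prod, trajProb, pathProb, ← Finset.prod_mul_distrib]
  refine Finset.prod_congr rfl fun h _ => ?_
  unfold stepProb
  refine congrArg₂ (· * ·) ?_ (congrArg₂ (· * ·) ?_ ?_)
  · unfold prevIndex
    split_ifs <;> rfl
  · unfold stateProb nextState
    by_cases h0 : h.val = 0
    · have h1 : h.castSucc.val = 0 := h0
      rw [if_pos h0, dif_pos h1]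
      rfl
    · have h1 : ¬ h.castSucc.val = 0 := h0
      rw [if_neg h0, dif_neg h1]
      rfl
  · refine Finset.prod_congr rfl fun i _ => ?_
    rw [hf]
    rfl

/-- Verification: a function `U` of step, previous index and state that dominates its one-step
expectations bounds the expected total. -/
theorem MarkovGame.expectedTotal_le (G : MarkovGame n H S A) (hT : 1 ≤ T)
    (π : JointPolicy H S A (Fin H → Fin (T + 1)))
    (f : ∀ (i : Fin n) (h : Fin H), Fin (T + 1) → History S A h → S → stdSimplex ℝ (A i))
    (hf : ∀ i h ω τ s, π.strategy i h ω τ s = f i h (ω h) τ s)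
    (R : Fin H → S → (∀ i, A i) → ℝ) (U : ℕ → Fin (H + 1) → S → ℝ)
    (hlast : ∀ t s, U t (Fin.last H) s = 0)
    (hU : ∀ (t : ℕ), 1 ≤ t → t ≤ T → ∀ (h : Fin H) (τ : History S A h) (s : S),
      ∑ j : Fin (T + 1), alphaW H t j * prodExp (fun i => (f i h j τ s).1)
        (fun a => R h s a + ∑ s', (G.trans h s a).1 s' * U j h.succ s') ≤ U t h.castSucc s) :
    G.expectedTotal π R ≤ U T 0 G.init := by
  classical
  rw [G.expectedTotal_eq_sum_pathProb π f hf R]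
  let W : ∀ k : Fin (H + 1), (Fin k → PathStep T S A) → ℝ := fun k τ =>
    ∑ s, G.nextState k τ s * U (prevIndex τ) k s
  have hmain := sum_pathProb_mul_le (κ := G.stepProb f) (fun h y => R h y.2.1 y.2.2) W
    (good := fun k τ => 1 ≤ prevIndex τ ∧ prevIndex τ ≤ T) ?_ ?_ ?_ ?_ ?_
  · have h0 : W 0 Fin.elim0 = U T 0 G.init := by
      simp [W, nextState, prevIndex]
    have hl : ∀ y : Fin H → PathStep T S A, W (Fin.last H) y = 0 := fun y => by
      simp [W, hlast]
    rw [h0] at hmain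
    refine le_trans (le_of_eq ?_) hmain
    refine Finset.sum_congr rfl fun y _ => ?_
    have := hl y
    rw [this, add_zero]
  · intro h τ y
    exact mul_nonneg (alphaW_nonneg _ _ _) (mul_nonneg ((G.nextState_mem _ _).1 _)
      (Finset.prod_nonneg fun i _ => (f i h y.1 _ y.2.1).2.1 _))
  · intro τ
    simp [prevIndex, hT]
  · intro h τ y hy
    have h1 : 1 ≤ (y.1 : ℕ) := one_le_of_alphaW_ne_zero (left_ne_zero_of_mul hy)
    have h2 : prevIndex (Fin.snoc (α := fun _ => PathStep T S A) τ y) = y.1 := prevIndex_snoc τ y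
    change 1 ≤ prevIndex (Fin.snoc (α := fun _ => PathStep T S A) τ y) ∧
      prevIndex (Fin.snoc (α := fun _ => PathStep T S A) τ y) ≤ T
    rw [h2]
    exact ⟨h1, Nat.le_of_lt_succ y.1.isLt⟩
  · intro h τ hτ
    rw [Fintype.sum_prod_type, ← alphaW_sum H (prevIndex τ) T hτ.1 hτ.2]
    refine Finset.sum_congr rfl fun j _ => ?_
    simp only [stepProb]
    rw [← Finset.mul_sum, Fintype.sum_prod_type]
    have : ∑ s, ∑ a : ∀ i, A i, G.nextState h.castSucc τ s *
        ∏ i, (f i h j (fun k => (τ k).2) s).1 (a i) = 1 := by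
      rw [← (G.nextState_mem h.castSucc τ).2]
      refine Finset.sum_congr rfl fun s _ => ?_
      rw [← Finset.mul_sum, sum_prod_eq_one fun i => (f i h j (fun k => (τ k).2) s).2, mul_one]
    rw [this, mul_one]
  · intro h τ hτ
    have hWs : ∀ y : PathStep T S A, W h.succ (Fin.snoc (α := fun _ => PathStep T S A) τ y) =
        ∑ s', (G.trans h y.2.1 y.2.2).1 s' * U y.1 h.succ s' := by
      intro y
      simp only [W]
      refine Finset.sum_congr rfl fun s' _ => ?_
      rw [G.nextState_snoc h τ y s']
      congr 2
      exact prevIndex_snoc τ y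
    have e : ∑ y : PathStep T S A, G.stepProb f h τ y * (R h y.2.1 y.2.2 +
        W h.succ (Fin.snoc (α := fun _ => PathStep T S A) τ y)) =
        ∑ s, G.nextState h.castSucc τ s * ∑ j : Fin (T + 1), alphaW H (prevIndex τ) j *
          prodExp (fun i => (f i h j (fun k => (τ k).2) s).1)
            (fun a => R h s a + ∑ s', (G.trans h s a).1 s' * U j h.succ s') := by
      rw [Fintype.sum_prod_type]
      simp only [Fintype.sum_prod_type, Finset.mul_sum]
      rw [Finset.sum_comm]
      refine Finset.sum_congr rfl fun s _ => Finset.sum_congr rfl fun j _ => ?_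
      rw [prodExp, Finset.mul_sum, Finset.mul_sum]
      refine Finset.sum_congr rfl fun a _ => ?_
      rw [hWs, stepProb]
      ring
    refine e.le.trans (Finset.sum_le_sum fun s _ => ?_)
    exact mul_le_mul_of_nonneg_left (hU _ hτ.1 hτ.2 h _ s) ((G.nextState_mem _ _).1 s)

end PathValue

/-! ### From swap regret to the equilibrium gap -/

section Gap

variable {n H : ℕ} {S : Type*} {A : Fin n → Type*} [∀ i, Fintype (A i)]

/-- The rows are the images of the vertices of the simplex. Linearity is what turns a strategy
modification into a comparator for swap regret. -/
theorem StrategyModification.exists_rows {i : Fin n} (φ : StrategyModification H S A i)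
    (h : Fin H) (τ : History S A h) (s : S) :
    ∃ M : A i → stdSimplex ℝ (A i), ∀ x : stdSimplex ℝ (A i), ∀ e : A i → ℝ,
      (φ.toFun h τ s x).1 ⬝ᵥ e = ∑ b, x.1 b * ((M b).1 ⬝ᵥ e) := by
  classical
  obtain ⟨L, hL'⟩ := φ.linear h τ s
  have hL : ∀ x : stdSimplex ℝ (A i), (φ.toFun h τ s x).1 = L x.1 := hL'
  refine ⟨fun b => φ.toFun h τ s ⟨Pi.single b 1, single_mem_stdSimplex ℝ b⟩, fun x e => ?_⟩
  have h1 : (φ.toFun h τ s x).1 =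
      ∑ b, x.1 b • (φ.toFun h τ s ⟨Pi.single b 1, single_mem_stdSimplex ℝ b⟩).1 := by
    rw [hL x]
    have hx : (x.1 : A i → ℝ) = ∑ b, x.1 b • (Pi.single b 1 : A i → ℝ) := by
      funext a
      simp [Finset.sum_apply, Pi.single_apply]
    change L x.1 = _
    conv_lhs => rw [hx]
    rw [map_sum]
    refine Finset.sum_congr rfl fun b _ => ?_
    rw [map_smul, hL]
  rw [h1, sum_dotProduct]
  exact Finset.sum_congr rfl fun b _ => smul_dotProduct _ _ _

/-- Each of the powers is at most `(1 + 1/H)^H ≤ e < 3`. -/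
theorem sum_geom_le (hH : 1 ≤ H) :
    ∑ j ∈ Finset.range H, (1 + 1 / (H : ℝ)) ^ j ≤ 3 * H := by
  have hH' : (1 : ℝ) ≤ H := by exact_mod_cast hH
  have hq : 1 ≤ 1 + 1 / (H : ℝ) := by
    have : 0 ≤ 1 / (H : ℝ) := by positivity
    linarith
  have hqH : (1 + 1 / (H : ℝ)) ^ H ≤ 3 := by
    have h1 : (1 + 1 / (H : ℝ)) ^ H ≤ Real.exp (1 / (H : ℝ)) ^ H := by
      refine pow_le_pow_left₀ (by positivity) ?_ H
      rw [add_comm]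
      exact Real.add_one_le_exp _
    rw [← Real.exp_nat_mul, mul_one_div_cancel (by positivity)] at h1
    have := Real.exp_one_lt_d9
    linarith
  calc ∑ j ∈ Finset.range H, (1 + 1 / (H : ℝ)) ^ j ≤ ∑ _j ∈ Finset.range H, (3 : ℝ) := by
        refine Finset.sum_le_sum fun j hj => le_trans ?_ hqH
        exact pow_le_pow_right₀ hq (Finset.mem_range.1 hj).le
    _ = 3 * H := by simp [mul_comm]

theorem prodExp_update_eq (π : MarkovProfile H S A) (i : Fin n) (h : Fin H) (s : S)
    (f : (∀ i, A i) → ℝ) (y : A i → ℝ) :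
    prodExp (Function.update (fun j => (π j h s).1) i y) f = y ⬝ᵥ expOthers π i h s f :=
  (sum_mul_expOthers π i h s f y).symm

theorem expJoint_eq_dotProduct (π : MarkovProfile H S A) (i : Fin n) (h : Fin H) (s : S)
    (f : (∀ i, A i) → ℝ) : expJoint π h s f = (π i h s).1 ⬝ᵥ expOthers π i h s f := by
  classical
  rw [← prodExp_update_eq, expJoint_eq_prodExp, Function.update_eq_self]

variable [Fintype S]

/-- The gain of player `i` from a strategy modification, when the values `v` obey the recursion of
the output policy and the weighted swap regret at every step, state and round is at most
`c * F t`. -/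
theorem MarkovGame.value_modify_sub_le (G : MarkovGame n H S A) (hH : 1 ≤ H)
    (π : ℕ → MarkovProfile H S A) {T : ℕ} (hT : 1 ≤ T) (i : Fin n)
    (v : ℕ → Fin (H + 1) → S → ℝ) (hlast : ∀ t s, v t (Fin.last H) s = 0)
    (hv : ∀ t, 1 ≤ t → t ≤ T → ∀ h s, v t h.castSucc s = ∑ k ∈ Finset.range t,
      alphaW H t (k + 1) * expJoint (π (k + 1)) h s (G.backup i h (v (k + 1) h.succ) s))
    {c : ℝ} (hc : 0 ≤ c) {F : ℕ → ℝ} (hF0 : 0 ≤ F T)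
    (hF : ∀ t, 1 ≤ t → ∑ k ∈ Finset.range t, alphaW H t (k + 1) * F (k + 1) ≤
      (1 + 1 / (H : ℝ)) * F t)
    (hreg : ∀ t, 1 ≤ t → t ≤ T → ∀ (h : Fin H) (s : S) (M : A i → stdSimplex ℝ (A i)),
      ∑ k ∈ Finset.range t, alphaW H t (k + 1) *
        (∑ b, (π (k + 1) i h s).1 b *
            ((M b).1 ⬝ᵥ expOthers (π (k + 1)) i h s (G.backup i h (v (k + 1) h.succ) s)) -
          (π (k + 1) i h s).1 ⬝ᵥ
            expOthers (π (k + 1)) i h s (G.backup i h (v (k + 1) h.succ) s)) ≤ c * F t)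
    (φ : StrategyModification H S A i) :
    G.value ((outputPolicy π T hT).modify i φ) i - G.value (outputPolicy π T hT) i ≤
      3 * H * c * F T := by
  classical
  -- With `m` steps to go, the potential allows the extra gain `c * F t * dd m`: one new regret plus
  -- the later ones, enlarged by `1 + 1/H` when averaged back to index `t`.
  let dd : ℕ → ℝ := fun m => ∑ j ∈ Finset.range m, (1 + 1 / (H : ℝ)) ^ j
  have hdd0 : ∀ m, 0 ≤ dd m := fun m => Finset.sum_nonneg fun j _ => by positivity
  have hdd : ∀ m, dd (m + 1) = 1 + (1 + 1 / (H : ℝ)) * dd m := by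
    intro m
    simp only [dd, Finset.sum_range_succ', pow_zero, Finset.mul_sum, pow_succ]
    rw [add_comm]
    congr 1
    exact Finset.sum_congr rfl fun j _ => by ring
  have hupper : G.value ((outputPolicy π T hT).modify i φ) i ≤
      v T 0 G.init + c * F T * dd H := by
    rw [G.value_eq_expectedTotal _ hT rfl]
    let fN : ∀ (i' : Fin n) (h : Fin H), ℕ → History S A h → S → stdSimplex ℝ (A i') :=
      Function.update (fun i' h j _ s => π j i' h s) i
        fun h j τ s => φ.toFun h τ s (π j i h s)
    have hle := G.expectedTotal_le hT ((outputPolicy π T hT).modify i φ)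
      (fun i' h j τ s => fN i' h j τ s) ?_ (G.reward i)
      (fun t k s => v t k s + c * F t * dd (H - k)) ?_ ?_
    · simpa using hle
    · intro i' h ω τ s
      rcases eq_or_ne i' i with rfl | hne
      · simp [JointPolicy.modify, fN, outputPolicy]
      · simp [JointPolicy.modify, fN, outputPolicy, hne]
    · intro t s
      simp [hlast, dd]
    · intro t ht htT h τ s
      -- A single `M` serves all round indices, because the modification depends on the history and
      -- the state but not on the sample. The gain of this step is thus a swap regret against a
      -- fixed comparator.
      obtain ⟨M, hM⟩ := φ.exists_rows h τ s
      refine (le_of_eq (sum_fin_alphaW_mul H t T htT fun j =>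
        prodExp (fun i' => (fN i' h j τ s).1) (fun a => G.reward i h s a +
          ∑ s', (G.trans h s a).1 s' * (v j h.succ s' + c * F j * dd (H - h.succ))))).trans ?_
      have hstep : ∀ k, prodExp (fun i' => (fN i' h (k + 1) τ s).1) (fun a => G.reward i h s a +
          ∑ s', (G.trans h s a).1 s' * (v (k + 1) h.succ s' + c * F (k + 1) * dd (H - h.succ))) =
          ∑ b, (π (k + 1) i h s).1 b *
            ((M b).1 ⬝ᵥ expOthers (π (k + 1)) i h s (G.backup i h (v (k + 1) h.succ) s)) +
          c * F (k + 1) * dd (H - h.succ) := by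
        intro k
        have e1 : (fun a => G.reward i h s a +
          ∑ s', (G.trans h s a).1 s' * (v (k + 1) h.succ s' + c * F (k + 1) * dd (H - h.succ))) =
            fun a => G.backup i h (v (k + 1) h.succ) s a + c * F (k + 1) * dd (H - h.succ) := by
          funext a
          simp only [backup, mul_add, Finset.sum_add_distrib]
          rw [← Finset.sum_mul, show ∑ s', (G.trans h s a).1 s' = 1 from (G.trans h s a).2.2]
          ring
        rw [e1, prodExp_add, prodExp_const fun j => (fN j h (k + 1) τ s).2]
        congr 1
        have e2 : (fun i' => (fN i' h (k + 1) τ s).1) =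
            Function.update (fun j => (π (k + 1) j h s).1) i
              (φ.toFun h τ s (π (k + 1) i h s)).1 := by
          funext j
          rcases eq_or_ne j i with rfl | hne
          · simp [fN]
          · simp [fN, hne]
        rw [e2, prodExp_update_eq, hM]
      simp only [hstep]
      have h1 := hreg t ht htT h s M
      have h2 := hv t ht htT h s
      have h3 := mul_le_mul_of_nonneg_left (hF t ht)
        (mul_nonneg hc (hdd0 (H - h.succ)))
      have h4 : dd (H - h.castSucc) = 1 + (1 + 1 / (H : ℝ)) * dd (H - h.succ) := by
        rw [← hdd]
        congr 1
        simp only [Fin.val_castSucc, Fin.val_succ]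
        omega
      have h5 : ∑ k ∈ Finset.range t, alphaW H t (k + 1) * (∑ b, (π (k + 1) i h s).1 b *
            ((M b).1 ⬝ᵥ expOthers (π (k + 1)) i h s (G.backup i h (v (k + 1) h.succ) s)) +
          c * F (k + 1) * dd (H - h.succ)) =
          ∑ k ∈ Finset.range t, alphaW H t (k + 1) *
        (∑ b, (π (k + 1) i h s).1 b *
            ((M b).1 ⬝ᵥ expOthers (π (k + 1)) i h s (G.backup i h (v (k + 1) h.succ) s)) -
          (π (k + 1) i h s).1 ⬝ᵥ
            expOthers (π (k + 1)) i h s (G.backup i h (v (k + 1) h.succ) s)) +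
          v t h.castSucc s +
          c * dd (H - h.succ) * ∑ k ∈ Finset.range t, alphaW H t (k + 1) * F (k + 1) := by
        rw [h2, Finset.mul_sum, ← Finset.sum_add_distrib, ← Finset.sum_add_distrib]
        refine Finset.sum_congr rfl fun k _ => ?_
        rw [expJoint_eq_dotProduct _ i]
        ring
      rw [h5, h4]
      linarith
  have hlower : v T 0 G.init ≤ G.value (outputPolicy π T hT) i := by
    rw [G.value_eq_expectedTotal _ hT rfl]
    -- The same verification with reversed signs gives the lower bound; here the one-step condition
    -- holds with equality.
    have hle := G.expectedTotal_le hT (outputPolicy π T hT)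
      (fun i' h j _ s => π j i' h s) (fun _ _ _ _ _ => rfl) (fun h s a => -G.reward i h s a)
      (fun t k s => -v t k s) ?_ ?_
    · have e : G.expectedTotal (outputPolicy π T hT) (fun h s a => -G.reward i h s a) =
          -G.expectedTotal (outputPolicy π T hT) (G.reward i) := by
        simp [expectedTotal, Finset.sum_neg_distrib]
      rw [e] at hle
      linarith
    · intro t s
      simp [hlast]
    · intro t ht htT h τ s
      refine (le_of_eq (sum_fin_alphaW_mul H t T htT fun j =>
        prodExp (fun i' => (π j i' h s).1) (fun a => -G.reward i h s a +
          ∑ s', (G.trans h s a).1 s' * -v j h.succ s'))).trans (le_of_eq ?_)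
      rw [hv t ht htT h s, ← Finset.sum_neg_distrib]
      refine Finset.sum_congr rfl fun k _ => ?_
      rw [← mul_neg, expJoint_eq_prodExp]
      congr 1
      rw [neg_eq_neg_one_mul, ← prodExp_smul]
      congr 1
      funext a
      simp only [backup, mul_neg, Finset.sum_neg_distrib]
      ring
  have h1 := mul_le_mul_of_nonneg_left (sum_geom_le hH) (mul_nonneg hc hF0)
  change c * F T * dd H ≤ _ at h1
  linarith

end Gap

/-! ### Runs of the two algorithms -/

/-- The factor `w_{t+1} / w_t` in the prediction replaces the weight already contained in the
received utility. The accumulated sum is reset at `t = 1`, so the utility of round `0` serves as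
prediction only. -/
theorem isSwapLearner_of_update {ι : Type*} [Fintype ι] [Nonempty ι] {w : ℕ → ℝ}
    (hw : ∀ t, 0 < w t) {η : ℝ} {u : ℕ → ι → ℝ} {L : ℕ → Learner ι}
    (hinit : L 0 = Learner.initial ι)
    (hstep : ∀ t, L (t + 1) = (L t).update w η (t + 1) (w t • u t)) :
    IsSwapLearner w η u fun t => (L t).output := by
  have hcum : ∀ t a, (L (t + 1)).cumUtil a =
      cumulUtil w (fun k => (L k).output.1 a • u k) t := by
    intro t a
    induction t with
    | zero =>
      rw [hstep]
      simp [Learner.update, cumulUtil]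
    | succ t ih =>
      rw [hstep (t + 1)]
      simp only [Learner.update, Nat.add_eq_right, Nat.add_eq_zero_iff, one_ne_zero, and_false,
        if_false]
      rw [ih]
      simp only [cumulUtil, Finset.sum_range_succ]
      rw [smul_comm (w (t + 1))]
  intro t
  rcases t with _ | t
  · simp only [hinit]
    exact isStationary_stationary _
  · have hrows : (L (t + 1)).output = stationary
        fun a => optPlay w η (fun k => (L k).output.1 a • u k) (t + 1) := by
      conv_lhs => rw [hstep t]
      simp only [Learner.update]
      congr 1
      funext a
      simp only [optPlay]
      congr 2
      have h1 : (if t + 1 = 1 then 0 else (L t).cumUtil a + (L t).output.1 a • w t • u t) =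
          (L (t + 1)).cumUtil a := by
        rw [hstep t]
        rfl
      rw [h1, hcum, Nat.add_sub_cancel]
      congr 1
      rw [smul_comm ((L t).output.1 a), smul_smul, div_mul_cancel₀ _ (hw t).ne']
    have := isStationary_stationary
      fun a => optPlay w η (fun k => (L k).output.1 a • u k) (t + 1)
    rw [← hrows] at this
    exact this

section Runs

set_option linter.unusedSectionVars false

variable {n H : ℕ} {S : Type*} {A : Fin n → Type*} [∀ i, Fintype (A i)] [Fintype S]
  [∀ i, Nonempty (A i)]

/-- What the runs of the two algorithms have in common: the learners receive the utilities
`u t`, which from round `1` on are the normalized action values for the value estimates `v t`. -/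
structure IsRun (G : MarkovGame n H S A) (η : ℝ)
    (L : ℕ → ∀ i : Fin n, Fin H → S → Learner (A i)) (v : ℕ → Fin n → Fin (H + 1) → S → ℝ)
    (u : ℕ → ∀ i : Fin n, Fin H → S → A i → ℝ) : Prop where
  init : ∀ i h s, L 0 i h s = Learner.initial (A i)
  step : ∀ t i h s, L (t + 1) i h s =
    (L t i h s).update (weight H) η (t + 1) (weight H t • u t i h s)
  util_zero : ∀ i h s a, u 0 i h s a ∈ Set.Icc (0 : ℝ) 1
  util_succ : ∀ t i h s, u (t + 1) i h s =
    (H : ℝ)⁻¹ • expOthers (profileOf (L (t + 1))) i h s (G.backup i h (v (t + 1) i h.succ) s)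
  val_last : ∀ t i s, v t i (Fin.last H) s = 0
  val_succ : ∀ t i h s, v (t + 1) i h.castSucc s = (1 - alpha H (t + 1)) * v t i h.castSucc s +
    alpha H (t + 1) *
      expJoint (profileOf (L (t + 1))) h s (G.backup i h (v (t + 1) i h.succ) s)

theorem MarkovGame.backup_mem_Icc (G : MarkovGame n H S A) (i : Fin n) (h : Fin H) {V : S → ℝ}
    {m : ℝ} (hV : ∀ s, V s ∈ Set.Icc 0 m) (s : S) (a : ∀ i, A i) :
    G.backup i h V s a ∈ Set.Icc 0 (1 + m) := by
  have h1 := G.reward_mem i h s a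
  have h0 := (G.trans h s a).2
  have h2 : 0 ≤ ∑ s', (G.trans h s a).1 s' * V s' :=
    Finset.sum_nonneg fun s' _ => mul_nonneg (h0.1 s') (hV s').1
  have h3 : ∑ s', (G.trans h s a).1 s' * V s' ≤ m := by
    calc ∑ s', (G.trans h s a).1 s' * V s' ≤ ∑ s', (G.trans h s a).1 s' * m :=
          Finset.sum_le_sum fun s' _ => mul_le_mul_of_nonneg_left (hV s').2 (h0.1 s')
      _ = m := by rw [← Finset.sum_mul, h0.2, one_mul]
  exact ⟨add_nonneg h1.1 h2, add_le_add h1.2 h3⟩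

theorem MarkovGame.abs_backup_sub_le (G : MarkovGame n H S A) (i : Fin n) (h : Fin H)
    {V V' : S → ℝ} {m : ℝ} (hV : ∀ s, |V s - V' s| ≤ m) (s : S) (a : ∀ i, A i) :
    |G.backup i h V s a - G.backup i h V' s a| ≤ m := by
  have h0 := (G.trans h s a).2
  have e : G.backup i h V s a - G.backup i h V' s a =
      ∑ s', (G.trans h s a).1 s' * (V s' - V' s') := by
    simp only [backup, mul_sub, Finset.sum_sub_distrib]
    ring
  rw [e]
  refine (Finset.abs_sum_le_sum_abs _ _).trans ?_
  calc ∑ s', |(G.trans h s a).1 s' * (V s' - V' s')| ≤ ∑ s', (G.trans h s a).1 s' * m := by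
        refine Finset.sum_le_sum fun s' _ => ?_
        have h1 : 0 ≤ (G.trans h s a).1 s' := h0.1 s'
        rw [abs_mul, abs_of_nonneg h1]
        exact mul_le_mul_of_nonneg_left (hV s') h1
    _ = m := by rw [← Finset.sum_mul, h0.2, one_mul]

namespace IsRun

variable {G : MarkovGame n H S A} {η : ℝ} {L : ℕ → ∀ i : Fin n, Fin H → S → Learner (A i)}
  {v : ℕ → Fin n → Fin (H + 1) → S → ℝ} {u : ℕ → ∀ i : Fin n, Fin H → S → A i → ℝ}

theorem isSwapLearner (hR : IsRun G η L v u) (i : Fin n) (h : Fin H) (s : S) :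
    IsSwapLearner (weight H) η (fun t => u t i h s) fun t => (L t i h s).output :=
  isSwapLearner_of_update (L := fun t => L t i h s) (weight_pos H) (hR.init i h s)
    fun t => hR.step t i h s

/-- As `α_1 = 1`, the first update erases the initial value, and the recursion unfolds into an
average over the rounds `1, …, t`. -/
theorem val_eq_sum (hR : IsRun G η L v u) (t : ℕ) (ht : 1 ≤ t) (i : Fin n) (h : Fin H) (s : S) :
    v t i h.castSucc s = ∑ k ∈ Finset.range t, alphaW H t (k + 1) *
      expJoint (profileOf (L (k + 1))) h s (G.backup i h (v (k + 1) i h.succ) s) := by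
  induction t, ht using Nat.le_induction with
  | base =>
    rw [hR.val_succ 0]
    simp [alphaW]
  | succ t ht ih =>
    rw [sum_alphaW_succ_mul H t fun k =>
      expJoint (profileOf (L k)) h s (G.backup i h (v k i h.succ) s), ← ih]
    exact hR.val_succ t i h s

theorem val_mem_Icc (hR : IsRun G η L v u) (t : ℕ) (ht : 1 ≤ t) (i : Fin n) (k : Fin (H + 1))
    (s : S) : v t i k s ∈ Set.Icc (0 : ℝ) (H - k) := by
  induction k using Fin.reverseInduction generalizing t s with
  | last => simp [hR.val_last]
  | cast h ih =>
    have hb : ∀ k, expJoint (profileOf (L (k + 1))) h s (G.backup i h (v (k + 1) i h.succ) s) ∈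
        Set.Icc (0 : ℝ) (H - h.castSucc) := by
      intro k
      rw [expJoint_eq_prodExp]
      have h1 := prodExp_mem_Icc (fun j => (profileOf (L (k + 1)) j h s).2) fun a =>
        G.backup_mem_Icc i h (fun s' => ih (k + 1) (by omega) s') s a
      simp only [Fin.val_succ, Fin.val_castSucc] at h1 ⊢
      push_cast at h1
      rw [show (1 : ℝ) + (H - (h + 1)) = H - h by ring] at h1
      exact h1
    rw [hR.val_eq_sum t ht]
    constructor
    · exact Finset.sum_nonneg fun k _ => mul_nonneg (alphaW_nonneg _ _ _) (hb k).1
    · calc _ ≤ ∑ k ∈ Finset.range t, alphaW H t (k + 1) * ((H : ℝ) - h.castSucc) :=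
            Finset.sum_le_sum fun k _ => mul_le_mul_of_nonneg_left (hb k).2 (alphaW_nonneg _ _ _)
        _ = _ := by rw [← Finset.sum_mul, sum_alphaW H t ht, one_mul]

theorem backup_mem_Icc (hR : IsRun G η L v u) (t : ℕ) (ht : 1 ≤ t) (i : Fin n) (h : Fin H)
    (s : S) (a : ∀ i, A i) : G.backup i h (v t i h.succ) s a ∈ Set.Icc (0 : ℝ) H := by
  have h1 := G.backup_mem_Icc i h (fun s' => hR.val_mem_Icc t ht i h.succ s') s a
  refine ⟨h1.1, h1.2.trans ?_⟩
  simp only [Fin.val_succ]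
  push_cast
  have : (0 : ℝ) ≤ (h : ℕ) := by positivity
  linarith

theorem util_mem_Icc (hR : IsRun G η L v u) (t : ℕ) (i : Fin n) (h : Fin H) (s : S) (a : A i) :
    u t i h s a ∈ Set.Icc (0 : ℝ) 1 := by
  rcases t with _ | t
  · exact hR.util_zero i h s a
  have hH : (0 : ℝ) < H := by exact_mod_cast h.pos
  rw [hR.util_succ]
  have h1 := expOthers_mem_Icc (profileOf (L (t + 1))) i h s
    (hR.backup_mem_Icc (t + 1) (by omega) i h s) a
  simp only [Pi.smul_apply, smul_eq_mul]
  refine ⟨mul_nonneg (by positivity) h1.1, ?_⟩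
  rw [inv_mul_le_iff₀ hH, mul_one]
  exact h1.2

/-- One update moves the estimate by `α` times the difference of two points of `[0, H]`. The bound
starts at round `1`, since `IsRun` does not control the range of the values of round `0`. -/
theorem abs_val_sub_le (hR : IsRun G η L v u) (hH : 1 ≤ H) (t : ℕ) (i : Fin n) (k : Fin (H + 1))
    (s : S) : |v (t + 2) i k s - v (t + 1) i k s| ≤ alpha H (t + 2) * H := by
  have hα := alpha_pos H (t + 2) hH
  induction k using Fin.lastCases with
  | last =>
    rw [hR.val_last, hR.val_last, sub_zero, abs_zero]
    positivity
  | cast h =>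
    have h1 := prodExp_mem_Icc (fun j => (profileOf (L (t + 2)) j h s).2)
      (hR.backup_mem_Icc (t + 2) (by omega) i h s)
    have h2 := hR.val_mem_Icc (t + 1) (by omega) i h.castSucc s
    have h3 : (0 : ℝ) ≤ (h.castSucc : ℕ) := by positivity
    rw [hR.val_succ (t + 1), expJoint_eq_prodExp]
    set e := prodExp (fun j => (profileOf (L (t + 2)) j h s).1)
      (G.backup i h (v (t + 2) i h.succ) s)
    change |(1 - alpha H (t + 2)) * v (t + 1) i h.castSucc s + alpha H (t + 2) * e -
      v (t + 1) i h.castSucc s| ≤ _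
    rw [show (1 - alpha H (t + 2)) * v (t + 1) i h.castSucc s + alpha H (t + 2) * e -
      v (t + 1) i h.castSucc s = alpha H (t + 2) * (e - v (t + 1) i h.castSucc s) by ring,
      abs_mul, abs_of_pos hα]
    refine mul_le_mul_of_nonneg_left (abs_le.2 ⟨?_, ?_⟩) hα.le
    · linarith [h1.1, h2.2]
    · linarith [h1.2, h2.1]

/-- The division by `H` turns the drift `α H` of the values and the range `H` of the backups into
the coefficients `α` and `1`. Between rounds `0` and `1` the bound is trivial because `α_1 = 1`. -/
theorem abs_util_sub_le (hR : IsRun G η L v u) (hH : 1 ≤ H) (k : ℕ) (i : Fin n) (h : Fin H)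
    (s : S) (a : A i) : |u (k + 1) i h s a - u k i h s a| ≤ alpha H (k + 1) +
      ∑ j ∈ Finset.univ.erase i,
        l1Dist (L (k + 1) j h s).output.1 (L k j h s).output.1 := by
  have hH' : (0 : ℝ) < H := by exact_mod_cast hH
  rcases k with _ | k
  · have h1 := hR.util_mem_Icc 1 i h s a
    have h2 := hR.util_mem_Icc 0 i h s a
    have h3 : 0 ≤ ∑ j ∈ Finset.univ.erase i,
        l1Dist (L (0 + 1) j h s).output.1 (L 0 j h s).output.1 :=
      Finset.sum_nonneg fun j _ => l1Dist_nonneg _ _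
    rw [zero_add, alpha_one]
    refine abs_le.2 ⟨?_, ?_⟩ <;> linarith [h1.1, h1.2, h2.1, h2.2]
  · rw [hR.util_succ, hR.util_succ]
    simp only [Pi.smul_apply, smul_eq_mul]
    rw [← mul_sub, abs_mul, abs_of_pos (inv_pos.2 hH'), inv_mul_le_iff₀ hH']
    have h1 := abs_expOthers_sub_le (profileOf (L (k + 2))) (profileOf (L (k + 1))) i h s
      (f := G.backup i h (v (k + 2) i h.succ) s) (g := G.backup i h (v (k + 1) i h.succ) s)
      (B := H) (ε := alpha H (k + 2) * H)
      (fun a => abs_le.2 ⟨by linarith [(hR.backup_mem_Icc (k + 2) (by omega) i h s a).1],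
        (hR.backup_mem_Icc (k + 2) (by omega) i h s a).2⟩)
      (G.abs_backup_sub_le i h (fun s' => hR.abs_val_sub_le hH k i h.succ s') s) a
    refine h1.trans (le_of_eq ?_)
    simp only [profileOf]
    ring

end IsRun

/-! The algorithm with `V` value update -/

theorem isRun_vRun (G : MarkovGame n H S A) (η : ℝ) :
    IsRun G η (fun t => (vRun G η t).learner) (fun t => (vRun G η t).V)
      (fun t i h s => (H : ℝ)⁻¹ • expOthers (profileOf (vRun G η t).learner) i h s
        (G.backup i h ((vRun G η t).V i h.succ) s)) where
  init _ _ _ := rfl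
  step t i h s := by
    change (_ : Learner (A i)).update _ _ _ _ = _
    rw [Nat.add_sub_cancel, div_eq_mul_inv, mul_smul]
  util_zero i h s a := by
    have hH : (0 : ℝ) < H := by exact_mod_cast h.pos
    have hh : ((h : ℕ) : ℝ) + 1 ≤ H := by exact_mod_cast h.isLt
    have hb : ∀ a, G.backup i h ((vRun G η 0).V i h.succ) s a ∈ Set.Icc (0 : ℝ) H := by
      intro a
      have h1 := G.backup_mem_Icc i h (V := (vRun G η 0).V i h.succ) (m := H - (h + 1))
        (fun s' => by
          change (H : ℝ) - (h.succ : ℕ) ∈ _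
          rw [Fin.val_succ]
          push_cast
          exact ⟨by linarith, le_rfl⟩) s a
      refine ⟨h1.1, h1.2.trans ?_⟩
      have : (0 : ℝ) ≤ (h : ℕ) := by positivity
      linarith
    have h1 := expOthers_mem_Icc (profileOf (vRun G η 0).learner) i h s hb a
    simp only [Pi.smul_apply, smul_eq_mul]
    refine ⟨mul_nonneg (by positivity) h1.1, ?_⟩
    rw [inv_mul_le_iff₀ hH, mul_one]
    exact h1.2
  util_succ _ _ _ _ := rfl
  val_last t i s := by
    rcases t with _ | t
    · simp [vRun]
    · simp [vRun, vStep]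
  val_succ t i h s := by
    simp [vRun, vStep]

/-! The algorithm with `Q` value update -/

/-- The value `[Q_{i,h} π_h](s)` computed in round `t`. -/
noncomputable def qRunValue (G : MarkovGame n H S A) (η : ℝ) (t : ℕ) (i : Fin n) :
    Fin (H + 1) → S → ℝ :=
  qValue G t (qRun G η (t - 1)).Q (profileOf (qRun G η t).learner) i

/-- The value of the output policy of the algorithm with `Q` value update. -/
noncomputable def qRunAverage (G : MarkovGame n H S A) (η : ℝ) :
    ℕ → Fin n → Fin (H + 1) → S → ℝ
  | 0 => fun _ _ _ => 0
  | t + 1 => fun i h s => (1 - alpha H (t + 1)) * qRunAverage G η t i h s +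
      alpha H (t + 1) * qRunValue G η (t + 1) i h s

theorem qRun_Q_succ (G : MarkovGame n H S A) (η : ℝ) (t : ℕ) (i : Fin n) (h : Fin H) (s : S)
    (a : ∀ i, A i) : (qRun G η (t + 1)).Q i h s a =
      (1 - alpha H (t + 1)) * (qRun G η t).Q i h s a +
        alpha H (t + 1) * G.backup i h (qRunValue G η (t + 1) i h.succ) s a := rfl

/-- Backups are affine in the value and the weights sum to one, so averaging backups is the same as
backing up the average. The initial table disappears because `α_1 = 1`. -/
theorem qRun_Q_eq (G : MarkovGame n H S A) (η : ℝ) (t : ℕ) (i : Fin n) (h : Fin H) (s : S)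
    (a : ∀ i, A i) : (qRun G η (t + 1)).Q i h s a =
      G.backup i h (qRunAverage G η (t + 1) i h.succ) s a := by
  induction t with
  | zero =>
    rw [qRun_Q_succ]
    simp [qRunAverage]
  | succ t ih =>
    rw [qRun_Q_succ, ih]
    conv_rhs => rw [MarkovGame.backup]
    simp only [MarkovGame.backup, mul_add]
    rw [show qRunAverage G η (t + 1 + 1) i h.succ = fun s =>
      (1 - alpha H (t + 1 + 1)) * qRunAverage G η (t + 1) i h.succ s +
      alpha H (t + 1 + 1) * qRunValue G η (t + 1 + 1) i h.succ s from rfl]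
    simp only [mul_add, Finset.sum_add_distrib, Finset.mul_sum, mul_left_comm]
    ring

theorem qRunValue_castSucc (G : MarkovGame n H S A) (η : ℝ) (t : ℕ) (i : Fin n) (h : Fin H)
    (s : S) : qRunValue G η (t + 1) i h.castSucc s =
      expJoint (profileOf (qRun G η (t + 1)).learner) h s ((qRun G η (t + 1)).Q i h s) := by
  conv_lhs => rw [qRunValue, qValue, Fin.reverseInduction_castSucc]
  rfl

theorem isRun_qRun (G : MarkovGame n H S A) (η : ℝ) :
    IsRun G η (fun t => (qRun G η t).learner) (qRunAverage G η)
      (fun t i h s => (H : ℝ)⁻¹ • expOthers (profileOf (qRun G η t).learner) i h s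
        ((qRun G η t).Q i h s)) where
  init _ _ _ := rfl
  step t i h s := by
    change (_ : Learner (A i)).update _ _ _ _ = _
    rw [Nat.add_sub_cancel, div_eq_mul_inv, mul_smul]
  util_zero i h s a := by
    have hH : (0 : ℝ) < H := by exact_mod_cast h.pos
    have hh : ((h : ℕ) : ℝ) ≤ H := by exact_mod_cast h.isLt.le
    have hb : ∀ a, (qRun G η 0).Q i h s a ∈ Set.Icc (0 : ℝ) H := by
      intro a
      change (H : ℝ) - (h : ℕ) ∈ _
      have : (0 : ℝ) ≤ (h : ℕ) := by positivity
      exact ⟨by linarith, by linarith⟩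
    have h1 := expOthers_mem_Icc (profileOf (qRun G η 0).learner) i h s hb a
    simp only [Pi.smul_apply, smul_eq_mul]
    refine ⟨mul_nonneg (by positivity) h1.1, ?_⟩
    rw [inv_mul_le_iff₀ hH, mul_one]
    exact h1.2
  util_succ t i h s := by
    rw [show (qRun G η (t + 1)).Q i h s = G.backup i h (qRunAverage G η (t + 1) i h.succ) s from
      funext (qRun_Q_eq G η t i h s)]
  val_last t i s := by
    induction t with
    | zero => rfl
    | succ t ih =>
      have h1 : qRunValue G η (t + 1) i (Fin.last H) s = 0 := by
        rw [qRunValue, qValue, Fin.reverseInduction_last]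
      simp only [qRunAverage, ih, h1, mul_zero, add_zero]
  val_succ t i h s := by
    rw [← show (qRun G η (t + 1)).Q i h s = G.backup i h (qRunAverage G η (t + 1) i h.succ) s from
      funext (qRun_Q_eq G η t i h s), ← qRunValue_castSucc]
    rfl

end Runs

/-! ### The convergence rate -/

section Rate

variable {n H : ℕ} {S : Type*} {A : Fin n → Type*} [∀ i, Fintype (A i)] [Fintype S]
  [∀ i, Nonempty (A i)]

theorem card_le_maxActions {n : ℕ} (A : Fin n → Type*) [∀ i, Fintype (A i)] (i : Fin n) :
    (Fintype.card (A i) : ℝ) ≤ maxActions A := by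
  exact_mod_cast Finset.le_sup (f := fun i => Fintype.card (A i)) (Finset.mem_univ i)

/-- One factor `α_k ≤ 1` is dropped and the other is at most `(H + 1) / k`. The drift of the values
thus contributes at rate `1/t` without a logarithm. -/
theorem sum_alphaW_mul_alpha_sq_le (H t : ℕ) (hH : 1 ≤ H) (ht : 1 ≤ t) :
    ∑ k ∈ Finset.range t, alphaW H t (k + 1) * alpha H (k + 1) ^ 2 ≤ 4 * H / t := by
  have hH' : (1 : ℝ) ≤ H := by exact_mod_cast hH
  have ht' : (1 : ℝ) ≤ t := by exact_mod_cast ht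
  have h1 := mul_le_mul_of_nonneg_left (sum_alphaW_div_le H t hH ht)
    (show 0 ≤ (H : ℝ) + 1 by positivity)
  calc ∑ k ∈ Finset.range t, alphaW H t (k + 1) * alpha H (k + 1) ^ 2
      ≤ ((H : ℝ) + 1) * ∑ k ∈ Finset.range t,
          alphaW H t (k + 1) * ((1 : ℝ) / ((k + 1 : ℕ) : ℝ)) := by
        rw [Finset.mul_sum]
        refine Finset.sum_le_sum fun k _ => ?_
        rw [mul_left_comm]
        refine mul_le_mul_of_nonneg_left ?_ (alphaW_nonneg _ _ _)
        have h2 := alpha_le_one H (k + 1) (by omega)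
        have h3 := alpha_pos H (k + 1) hH
        have h4 : alpha H (k + 1) ≤ ((H : ℝ) + 1) * ((1 : ℝ) / ((k + 1 : ℕ) : ℝ)) := by
          rw [mul_one_div]
          unfold alpha
          gcongr
          linarith
        nlinarith
    _ ≤ _ := h1
    _ ≤ 4 * H / t := by
        rw [mul_one_div, mul_div_assoc', div_le_div_iff_of_pos_right (by positivity)]
        have h5 : 1 / (H : ℝ) ≤ 1 := by
          rw [div_le_one (by positivity)]
          exact hH'
        have h6 : (H : ℝ) * (1 / (H : ℝ)) = 1 := mul_one_div_cancel (by positivity)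
        nlinarith

theorem alpha_le_div (H t : ℕ) (hH : 1 ≤ H) (ht : 1 ≤ t) : alpha H t ≤ 2 * H / t := by
  have hH' : (1 : ℝ) ≤ H := by exact_mod_cast hH
  have ht' : (1 : ℝ) ≤ t := by exact_mod_cast ht
  unfold alpha
  gcongr <;> linarith

/-- The weighted swap regret in a run. -/
theorem IsRun.swapRegret_le {G : MarkovGame n H S A}
    {L : ℕ → ∀ i : Fin n, Fin H → S → Learner (A i)}
    {v : ℕ → Fin n → Fin (H + 1) → S → ℝ} {u : ℕ → ∀ i : Fin n, Fin H → S → A i → ℝ}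
    (hR : IsRun G (stepSize H A) L v u) (hH : 1 ≤ H) {T t : ℕ} (ht : 1 ≤ t) (htT : t ≤ T)
    (i : Fin n) (h : Fin H) (s : S) (M : A i → stdSimplex ℝ (A i)) :
    ∑ k ∈ Finset.range t, alphaW H t (k + 1) *
        (∑ b, (profileOf (L (k + 1)) i h s).1 b * ((M b).1 ⬝ᵥ
            expOthers (profileOf (L (k + 1))) i h s (G.backup i h (v (k + 1) i h.succ) s)) -
          (profileOf (L (k + 1)) i h s).1 ⬝ᵥ
            expOthers (profileOf (L (k + 1))) i h s (G.backup i h (v (k + 1) i h.succ) s)) ≤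
      2 * H * (256 * n * H * Real.sqrt H * (maxActions A : ℝ) ^ 3 *
        Real.log (maxActions A * T) + 1 + H) * (1 / (t : ℝ)) := by
  set N : ℝ := (maxActions A : ℝ) with hN
  set η := stepSize H A with hη
  have hH' : (1 : ℝ) ≤ H := by exact_mod_cast hH
  have ht' : (1 : ℝ) ≤ t := by exact_mod_cast ht
  have hT : 1 ≤ T := ht.trans htT
  have htT' : (t : ℝ) ≤ T := by exact_mod_cast htT
  have hn : (1 : ℝ) ≤ n := by exact_mod_cast i.pos
  have hN1 : 1 ≤ N := le_trans (by exact_mod_cast Fintype.card_pos) (card_le_maxActions A i)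
  set q := Real.sqrt H with hq
  have hq1 : 1 ≤ q := Real.one_le_sqrt.2 hH'
  have hq2 : q ^ 2 = H := Real.sq_sqrt (by linarith)
  have hηdef : η = 1 / (128 * n * q * N) := rfl
  have hη0 : 0 < η := by rw [hηdef]; positivity
  have hprod : 1 ≤ n * q := one_le_mul_of_one_le_of_one_le hn hq1
  have hηN : η * N ≤ 1 / 128 := by
    rw [hηdef, one_div_mul_eq_div, div_le_div_iff₀ (by positivity) (by norm_num)]
    nlinarith
  have hη1 : η ≤ 1 / 128 := le_trans (by nlinarith) hηN
  -- Reduces to `12800 ≤ 128² * N`; this is the condition that fixes the scale `1 / (n √H)` of the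
  -- step size.
  have hηC : 6400 * (n : ℝ) ^ 2 * (2 * H) * N * η ^ 2 ≤ 1 := by
    rw [hηdef, ← hq2, one_div, inv_pow, ← div_eq_mul_inv, div_le_one (by positivity)]
    have : (n : ℝ) ^ 2 * q ^ 2 * N ≤ (n : ℝ) ^ 2 * q ^ 2 * N * N :=
      le_mul_of_one_le_right (by positivity) hN1
    nlinarith
  have hmain := swapRegret_le_of_variation (w := weight H) (β := fun k => alpha H (k + 1))
    (C := 2 * H) (N := N) (u := fun i t => u t i h s) (x := fun i t => (L t i h s).output)
    (fun i => hR.isSwapLearner i h s) hη0 (card_le_maxActions A) hηN (weight_pos H)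
    (weight_le_succ H) (fun t => weight_succ_le H t hH) hηC (weight_sum_drift_le H)
    (fun i t r => hR.util_mem_Icc t i h s r) (fun i k r => hR.abs_util_sub_le hH k i h s r)
    hT t i M
  have ha0 : 0 ≤ alphaW H t 1 := alphaW_nonneg _ _ _
  -- Multiplication by `H α_t^1` undoes the normalization of the utilities and turns the weights `w`
  -- into drawing probabilities. The barrier term becomes `α_t N² / η`, of order `1/t`.
  have hscale := mul_le_mul_of_nonneg_left hmain (mul_nonneg (by linarith : (0 : ℝ) ≤ H) ha0)
  have haw : ∀ k ∈ Finset.range t, alphaW H t 1 * weight H (k + 1) = alphaW H t (k + 1) :=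
    fun k hk => (alphaW_eq_mul_weight H t k (Finset.mem_range.1 hk)).symm
  have e1 : alphaW H t 1 * weight H t = alpha H t := by
    obtain ⟨m, rfl⟩ := Nat.exists_eq_add_of_le' ht
    rw [← alphaW_self H (m + 1) (by omega), alphaW_eq_mul_weight H (m + 1) m (by omega)]
  have e2 : alphaW H t 1 * ∑ k ∈ Finset.range t, weight H (k + 1) = 1 := by
    rw [Finset.mul_sum, Finset.sum_congr rfl haw, sum_alphaW H t ht]
  have e3 : alphaW H t 1 * ∑ k ∈ Finset.range t, weight H (k + 1) * alpha H (k + 1) ^ 2 =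
      ∑ k ∈ Finset.range t, alphaW H t (k + 1) * alpha H (k + 1) ^ 2 := by
    rw [Finset.mul_sum]
    refine Finset.sum_congr rfl fun k hk => ?_
    rw [← mul_assoc, haw k hk]
  have hlhs : ∑ k ∈ Finset.range t, alphaW H t (k + 1) *
        (∑ b, (profileOf (L (k + 1)) i h s).1 b * ((M b).1 ⬝ᵥ
            expOthers (profileOf (L (k + 1))) i h s (G.backup i h (v (k + 1) i h.succ) s)) -
          (profileOf (L (k + 1)) i h s).1 ⬝ᵥ
            expOthers (profileOf (L (k + 1))) i h s (G.backup i h (v (k + 1) i h.succ) s)) =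
      H * alphaW H t 1 * ∑ k ∈ Finset.range t, weight H (k + 1) *
        (∑ a, (L (k + 1) i h s).output.1 a * ((M a).1 ⬝ᵥ u (k + 1) i h s) -
          (L (k + 1) i h s).output.1 ⬝ᵥ u (k + 1) i h s) := by
    rw [Finset.mul_sum]
    refine Finset.sum_congr rfl fun k hk => ?_
    have hHne : (H : ℝ) ≠ 0 := by positivity
    rw [hR.util_succ, ← haw k hk]
    simp only [dotProduct_smul, smul_eq_mul, profileOf, mul_left_comm _ ((H : ℝ)⁻¹),
      ← Finset.mul_sum, ← mul_sub]
    field_simp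
  rw [hlhs]
  refine hscale.trans ?_
  have hlog : 0 ≤ Real.log (N * T) := Real.log_nonneg (by nlinarith)
  have b1 : alpha H t * (N ^ 2 / η) * Real.log (N * T) ≤
      256 * n * H * q * N ^ 3 * Real.log (N * T) * (1 / t) := by
    have h1 : N ^ 2 / η = 128 * n * q * N ^ 3 := by
      rw [hηdef]
      field_simp
    rw [h1]
    calc alpha H t * (128 * n * q * N ^ 3) * Real.log (N * T) ≤
          2 * H / t * (128 * n * q * N ^ 3) * Real.log (N * T) := by
          have := alpha_le_div H t hH ht
          gcongr
      _ = _ := by ring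
  have b2 : (1 : ℝ) / T ≤ 1 * (1 / t) := by
    rw [one_mul]
    exact one_div_le_one_div_of_le (by linarith) htT'
  have b3 : 10 * η * ∑ k ∈ Finset.range t, alphaW H t (k + 1) * alpha H (k + 1) ^ 2 ≤
      H * (1 / t) := by
    have h1 := mul_le_mul_of_nonneg_left (sum_alphaW_mul_alpha_sq_le H t hH ht)
      (show 0 ≤ 10 * η by positivity)
    refine h1.trans ?_
    have h2 : 10 * η * (4 * H / t) = 40 * η * (H * (1 / t)) := by ring
    rw [h2]
    have h3 : 0 ≤ (H : ℝ) * (1 / t) := by positivity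
    nlinarith
  have e4 : H * alphaW H t 1 * (2 * (N ^ 2 * (weight H t / η) * Real.log (N * T) +
        (∑ k ∈ Finset.range t, weight H (k + 1)) / T +
        10 * η * ∑ k ∈ Finset.range t, weight H (k + 1) * alpha H (k + 1) ^ 2)) =
      2 * H * (alpha H t * (N ^ 2 / η) * Real.log (N * T) + 1 / T +
        10 * η * ∑ k ∈ Finset.range t, alphaW H t (k + 1) * alpha H (k + 1) ^ 2) := by
    rw [← e1, ← e3, ← e2]
    ring
  rw [e4, mul_assoc (2 * (H : ℝ))]
  refine mul_le_mul_of_nonneg_left ?_ (by positivity)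
  linarith

/-- The trivial bound for the weighted swap regret in a run. -/
theorem IsRun.swapRegret_le_horizon {G : MarkovGame n H S A} {η : ℝ}
    {L : ℕ → ∀ i : Fin n, Fin H → S → Learner (A i)}
    {v : ℕ → Fin n → Fin (H + 1) → S → ℝ} {u : ℕ → ∀ i : Fin n, Fin H → S → A i → ℝ}
    (hR : IsRun G η L v u) {t : ℕ} (ht : 1 ≤ t) (i : Fin n) (h : Fin H) (s : S)
    (M : A i → stdSimplex ℝ (A i)) :
    ∑ k ∈ Finset.range t, alphaW H t (k + 1) *
        (∑ b, (profileOf (L (k + 1)) i h s).1 b * ((M b).1 ⬝ᵥ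
            expOthers (profileOf (L (k + 1))) i h s (G.backup i h (v (k + 1) i h.succ) s)) -
          (profileOf (L (k + 1)) i h s).1 ⬝ᵥ
            expOthers (profileOf (L (k + 1))) i h s (G.backup i h (v (k + 1) i h.succ) s)) ≤ H := by
  rw [← mul_one (H : ℝ), ← sum_alphaW H t ht, Finset.mul_sum]
  refine Finset.sum_le_sum fun k _ => ?_
  rw [mul_comm (H : ℝ)]
  refine mul_le_mul_of_nonneg_left ?_ (alphaW_nonneg _ _ _)
  set e := expOthers (profileOf (L (k + 1))) i h s (G.backup i h (v (k + 1) i h.succ) s)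
  have he : ∀ b, e b ∈ Set.Icc (0 : ℝ) H := fun b =>
    expOthers_mem_Icc _ i h s (hR.backup_mem_Icc (k + 1) (by omega) i h s) b
  have hx := (profileOf (L (k + 1)) i h s).2
  have h1 : 0 ≤ (profileOf (L (k + 1)) i h s).1 ⬝ᵥ e :=
    Finset.sum_nonneg fun b _ => mul_nonneg (hx.1 b) (he b).1
  have h2 : ∀ b, (M b).1 ⬝ᵥ e ≤ H := by
    intro b
    calc (M b).1 ⬝ᵥ e ≤ ∑ c, (M b).1 c * (H : ℝ) :=
          Finset.sum_le_sum fun c _ => mul_le_mul_of_nonneg_left (he c).2 ((M b).2.1 c)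
      _ = H := by rw [← Finset.sum_mul, show ∑ c, (M b).1 c = 1 from (M b).2.2, one_mul]
  have h3 : ∑ b, (profileOf (L (k + 1)) i h s).1 b * ((M b).1 ⬝ᵥ e) ≤ H := by
    calc _ ≤ ∑ b, (profileOf (L (k + 1)) i h s).1 b * (H : ℝ) :=
          Finset.sum_le_sum fun b _ => mul_le_mul_of_nonneg_left (h2 b) (hx.1 b)
      _ = H := by
          rw [← Finset.sum_mul, show ∑ b, (profileOf (L (k + 1)) i h s).1 b = 1 from hx.2, one_mul]
  linarith

theorem rpow_seven_halves {x : ℝ} (hx : 0 < x) : x ^ (3.5 : ℝ) = x ^ 3 * Real.sqrt x := by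
  rw [Real.sqrt_eq_rpow, ← Real.rpow_natCast x 3, ← Real.rpow_add hx]
  norm_num

/-- For `T ≥ 3` and `T ≥ N` the regret bound is used with `F t = 1 / t`; then `log (N T) ≤ 2 log T`,
and the argument needs only the first power of `log T`. In the remaining cases `T ≤ 3 N`, and the
trivial bound with constant `F` is already below the claim. -/
theorem IsRun.isApproxCE {G : MarkovGame n H S A}
    {L : ℕ → ∀ i : Fin n, Fin H → S → Learner (A i)}
    {v : ℕ → Fin n → Fin (H + 1) → S → ℝ} {u : ℕ → ∀ i : Fin n, Fin H → S → A i → ℝ}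
    (hR : IsRun G (stepSize H A) L v u) (hH : 1 ≤ H) {T : ℕ} (hT : 2 ≤ T) :
    G.IsApproxCE (outputPolicy (fun t => profileOf (L t)) T (one_le_two.trans hT))
      (8192 * (H : ℝ) ^ (3.5 : ℝ) * n * (maxActions A : ℝ) ^ 3 * (Real.log T) ^ 2 / T) := by
  refine iSup₂_le fun i φ => EReal.coe_le_coe_iff.2 ?_
  set N : ℝ := (maxActions A : ℝ) with hN
  have hH' : (1 : ℝ) ≤ H := by exact_mod_cast hH
  have hT1 : 1 ≤ T := one_le_two.trans hT
  have hT' : (2 : ℝ) ≤ T := by exact_mod_cast hT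
  have hn : (1 : ℝ) ≤ n := by exact_mod_cast i.pos
  have hN1 : 1 ≤ N := le_trans (by exact_mod_cast Fintype.card_pos) (card_le_maxActions A i)
  rw [rpow_seven_halves (by linarith)]
  set q := Real.sqrt H with hq
  have hq1 : 1 ≤ q := Real.one_le_sqrt.2 hH'
  set l := Real.log T with hl
  have hP1 : 1 ≤ n * q * N ^ 2 :=
    one_le_mul_of_one_le_of_one_le (one_le_mul_of_one_le_of_one_le hn hq1) (one_le_pow₀ hN1)
  have hgap := fun (c : ℝ) (hc : 0 ≤ c) (F : ℕ → ℝ) (hF0 : 0 ≤ F T) hF hreg =>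
    G.value_modify_sub_le hH (fun t => profileOf (L t)) hT1 i (fun t => v t i)
      (fun t s => hR.val_last t i s) (fun t ht _ h s => hR.val_eq_sum t ht i h s)
      (c := c) hc (F := F) hF0 hF hreg φ
  by_cases hlarge : N ≤ T ∧ 3 ≤ T
  · obtain ⟨hNT, hT3⟩ := hlarge
    have hT3' : (3 : ℝ) ≤ T := by exact_mod_cast hT3
    -- This needs `T ≥ 3 > e`, which is why `T = 2` goes to the other case.
    have hl1 : 1 ≤ l := by
      rw [hl, Real.le_log_iff_exp_le (by linarith)]
      have := Real.exp_one_lt_d9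
      linarith
    have hlog : Real.log (N * T) ≤ 2 * l := by
      rw [Real.log_mul (by positivity) (by positivity)]
      have := Real.log_le_log (by linarith) hNT
      linarith
    have hlog0 : 0 ≤ Real.log (N * T) := Real.log_nonneg (by nlinarith)
    refine (hgap (2 * H * (256 * n * H * q * N ^ 3 * Real.log (N * T) + 1 + H)) (by positivity)
      (fun t => 1 / (t : ℝ)) (by positivity) (fun t ht => sum_alphaW_div_le H t hH ht)
      (fun t ht htT h s M => hR.swapRegret_le hH ht htT i h s M)).trans ?_
    rw [mul_one_div]
    refine div_le_div_of_nonneg_right ?_ (by positivity)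
    set P := n * H * q * N ^ 3 with hP
    have hPH : (H : ℝ) ≤ P := by
      have h1 : 1 ≤ n * q * N ^ 3 :=
        one_le_mul_of_one_le_of_one_le (one_le_mul_of_one_le_of_one_le hn hq1) (one_le_pow₀ hN1)
      have : P = H * (n * q * N ^ 3) := by rw [hP]; ring
      rw [this]
      exact le_mul_of_one_le_right (by linarith) h1
    have hP0 : 0 ≤ P := by linarith
    -- `514 = 2 * 256 + 2`: the terms `1` and `H` are each at most `P * l`.
    have h2 : 256 * n * H * q * N ^ 3 * Real.log (N * T) + 1 + H ≤ 514 * (P * l) := by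
      have h3 := mul_le_mul_of_nonneg_left hlog hP0
      have h4 : P ≤ P * l := le_mul_of_one_le_right hP0 hl1
      have e : 256 * n * H * q * N ^ 3 * Real.log (N * T) = 256 * (P * Real.log (N * T)) := by
        rw [hP]; ring
      rw [e]
      linarith
    calc 3 * H * (2 * H * (256 * n * H * q * N ^ 3 * Real.log (N * T) + 1 + H))
        ≤ 3 * H * (2 * H * (514 * (P * l))) := by gcongr
      _ = 3084 * (H ^ 2 * P * l) := by ring
      _ ≤ 8192 * (H ^ 2 * P * l ^ 2) := by
          have h5 : l ≤ l ^ 2 := by nlinarith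
          have h6 : H ^ 2 * P * l ≤ H ^ 2 * P * l ^ 2 :=
            mul_le_mul_of_nonneg_left h5 (by positivity)
          have h7 : 0 ≤ H ^ 2 * P * l := by positivity
          linarith
      _ = _ := by rw [hP]; ring
  · have hTN : (T : ℝ) ≤ 3 * N := by
      by_contra hcon
      push Not at hcon
      refine hlarge ⟨by linarith, ?_⟩
      have : (3 : ℝ) ≤ T := by linarith
      exact_mod_cast this
    have hl2 : 0.69 ≤ l := by
      have h1 := Real.log_two_gt_d9
      have h2 : Real.log 2 ≤ l := Real.log_le_log (by norm_num) hT'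
      linarith
    refine (hgap H (by positivity) (fun _ => 1) zero_le_one (fun t ht => ?_)
      (fun t ht _ h s M => by
        rw [mul_one]
        exact hR.swapRegret_le_horizon ht i h s M)).trans ?_
    · simp only [mul_one]
      rw [sum_alphaW H t ht]
      have : 0 ≤ 1 / (H : ℝ) := by positivity
      linarith
    · rw [mul_one, le_div_iff₀ (by linarith)]
      have h1 : 0.47 ≤ l ^ 2 := by nlinarith
      calc 3 * H * H * T ≤ 3 * H * H * (3 * N) := by gcongr
        _ = 9 * (H ^ 2 * N) := by ring
        _ ≤ 8192 * 0.47 * ((H ^ 2 * N) * (H * (n * q * N ^ 2))) := by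
            have h2 : 1 ≤ H * (n * q * N ^ 2) := one_le_mul_of_one_le_of_one_le hH' hP1
            have h3 : H ^ 2 * N ≤ (H ^ 2 * N) * (H * (n * q * N ^ 2)) :=
              le_mul_of_one_le_right (by positivity) h2
            have h4 : 0 ≤ H ^ 2 * N := by positivity
            linarith
        _ = 8192 * (H ^ 3 * q) * n * N ^ 3 * 0.47 := by ring
        _ ≤ _ := mul_le_mul_of_nonneg_left h1 (by positivity)

end Rate

end MarkovCE

theorem mainTheorem1 {n H : ℕ} (hn : 1 ≤ n) (hH : 1 ≤ H) {S : Type*} [Fintype S]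
    {A : Fin n → Type*} [∀ i, Fintype (A i)] [∀ i, Nonempty (A i)]
    (G : MarkovCE.MarkovGame n H S A) (T : ℕ) (hT : 2 ≤ T) :
    G.IsApproxCE
      (MarkovCE.outputPolicy
        (fun t => MarkovCE.profileOf (MarkovCE.vRun G (MarkovCE.stepSize H A) t).learner)
        T (one_le_two.trans hT))
      (8192 * (H : ℝ) ^ (3.5 : ℝ) * n * (MarkovCE.maxActions A : ℝ) ^ 3 * (Real.log T) ^ 2 / T) ∧
    G.IsApproxCE
      (MarkovCE.outputPolicy
        (fun t => MarkovCE.profileOf (MarkovCE.qRun G (MarkovCE.stepSize H A) t).learner)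
        T (one_le_two.trans hT))
      (8192 * (H : ℝ) ^ (3.5 : ℝ) * n * (MarkovCE.maxActions A : ℝ) ^ 3 * (Real.log T) ^ 2 / T) := by
  exact ⟨(MarkovCE.isRun_vRun G _).isApproxCE hH hT, (MarkovCE.isRun_qRun G _).isApproxCE hH hT⟩
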